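/- Let $m\ge 3$ and let $(\mathcal M,g)$ be a smooth (second countable, Hausdorff, not necessarily complete) Riemannian manifold of dimension $m$ with smooth boundary $\partial\mathcal M$, the metric $g$ being smooth up to the boundary, such that every connected component of $\mathcal M$ meets $\partial\mathcal M$. Let $d=\mathrm{dist}_g(\cdot,\partial\mathcal M)$, let $\beta\in(-1,1)$, let $B_r^g(p)$ be the open ball of radius $r$ about $p$ for the Riemannian distance, and put \[ \omega(p,r)=\int_{B_r^g(p)} d^\beta\,\mathrm{dvol}_g ,\qquad E_\beta|_{\mathcal L}(v)=\frac12\int_{\mathcal L} d^\beta|Dv|_g^2\,\mathrm{dvol}_g , \] where $|Dv|_g^2=g^{ij}\langle\partial_i v,\partial_j v\rangle$ in local coordinates. For a compact smooth embedded submanifold without boundary $\mathcal N\subset\mathbb R^n$, let $W^{1,2}_{\beta,\mathrm{loc}}(\mathcal M;\mathcal N)$ be the set of maps $v:\mathcal M\to\mathbb R^n$ that are weakly differentiable in the interior of $\mathcal M$, take values in $\mathcal N$ almost everywhere, and satisfy $\int_{\mathcal L}d^\beta(|v|^2+|Dv|_g^2)\,\mathrm{dvol}_g<\infty$ for every compact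 $\mathcal L\subset\mathcal M$ (which may meet $\partial\mathcal M$). Such a $v$ is called weakly stationary harmonic with respect to free boundary data if (i) for every $\phi\in C_0^\infty(\mathcal M;\mathbb R^n)$ (whose support may meet $\partial\mathcal M$), $\frac{d}{dt}\big|_{t=0}E_\beta|_{\mathrm{supp}\,\phi}\big(\pi_{\mathcal N}(v+t\phi)\big)=0$, where $\pi_{\mathcal N}$ is the nearest point projection onto $\mathcal N$; and (ii) for every compact $\mathcal L\subset\mathcal M$ (which may meet $\partial\mathcal M$) and every smooth one-parameter family of diffeomorphisms $\Phi_t:\mathcal M\to\mathcal M$ with $\Phi_0=\mathrm{id}$ and $\Phi_t=\mathrm{id}$ on $\mathcal M\setminus\mathcal L$ for all $t$, $\frac{d}{dt}\big|_{t=0}E_\beta|_{\mathcal L}(v\circ\Phi_t)=0$. Then for every compact set $\mathcal K\subset\mathcal M$ there exist constants $C,R>0$, depending only on $\mathcal M,g,\beta$ and $\mathcal K$, such that for every $n$, every compact smooth embedded submanifold $\mathcal N\subset\mathbb R^n$, every $v\in W^{1,2}_{\beta,\mathrm{loc}}(\mathcal M;\mathcal N)$ that is weakly stationary harmonic with respect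 to free boundary data, every $p\in\mathcal K$ and all $0<t\le r\le R$, one has $0<\omega(p,t),\,\omega(p,r)<\infty$, the function $d^\beta|Dv|_g^2$ is integrable on $B_r^g(p)$, and \[ \frac{t^2}{\omega(p,t)}\int_{B_t^g(p)}d^\beta|Dv|_g^2\,\mathrm{dvol}_g\;\le\;\frac{C\,r^2}{\omega(p,r)}\int_{B_r^g(p)}d^\beta|Dv|_g^2\,\mathrm{dvol}_g . \] -/

import Mathlib

open Set MeasureTheory Manifold Bundle Metric
open scoped ENNReal ContDiff Topology

noncomputable section

namespace FreeBoundary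

/-- The set `N ⊆ ℝⁿ` is an embedded smooth `k`-dimensional submanifold (without boundary): near
each of its points a smooth diffeomorphism between open subsets of `ℝⁿ` straightens it to a
`k`-dimensional linear subspace. -/
def IsSmoothSubmanifold {n : ℕ} (k : ℕ) (N : Set (EuclideanSpace ℝ (Fin n))) : Prop :=
  ∀ p ∈ N, ∃ (e : OpenPartialHomeomorph (EuclideanSpace ℝ (Fin n)) (EuclideanSpace ℝ (Fin n)))
    (W : Submodule ℝ (EuclideanSpace ℝ (Fin n))),
    p ∈ e.source ∧ ContDiffOn ℝ ∞ e e.source ∧ ContDiffOn ℝ ∞ e.symm e.target ∧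
    Module.finrank ℝ W = k ∧ N ∩ e.source = e ⁻¹' (W : Set (EuclideanSpace ℝ (Fin n))) ∩ e.source

open Classical in
/-- The nearest point projection onto a set `N ⊆ ℝⁿ` (a nearest point is chosen where there is
more than one; for a compact submanifold it is unique on a neighbourhood of `N`). -/
def nearestPoint {n : ℕ} (N : Set (EuclideanSpace ℝ (Fin n))) (y : EuclideanSpace ℝ (Fin n)) :
    EuclideanSpace ℝ (Fin n) :=
  if h : ∃ z ∈ N, dist y z = Metric.infDist y N then h.choose else y

section Manifold

variable {m : ℕ} [NeZero m] {M : Type*} [EMetricSpace M] [ChartedSpace (EuclideanHalfSpace m) M]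

variable (m) in
/-- `d(p)`, the distance from `p` to the boundary of `M`. -/
def bdryDist (p : M) : ℝ :=
  (Metric.infEDist p ((𝓡∂ m).boundary M)).toReal

/-- The coordinate vector field of the chart around `c` in the coordinate direction `w`, at `x`:
the image of `w` under the derivative of the inverse of the chart (for `x` in the chart domain). -/
def coordVec (c x : M) (w : EuclideanSpace ℝ (Fin m)) : TangentSpace (𝓡∂ m) x :=
  mfderivWithin 𝓘(ℝ, EuclideanSpace ℝ (Fin m)) (𝓡∂ m) (extChartAt (𝓡∂ m) c).symm
    (range (𝓡∂ m)) (extChartAt (𝓡∂ m) c x) w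

/-- `∂ᵢ` at `x` in the chart around `c`. -/
def partialVec (c x : M) (i : Fin m) : TangentSpace (𝓡∂ m) x :=
  coordVec c x (EuclideanSpace.single i (1 : ℝ))

section Weak

variable {n : ℕ}

/-- `Dv` is a weak differential of `v : M → ℝⁿ` on the interior of `M`: in each chart both are
locally integrable on the interior of the chart image, and they satisfy the integration by parts
identity against all smooth test functions with compact support there. -/
def HasWeakDifferential (v : M → EuclideanSpace ℝ (Fin n))
    (Dv : (x : M) → TangentSpace (𝓡∂ m) x →L[ℝ] EuclideanSpace ℝ (Fin n)) : Prop :=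
  ∀ c : M,
    LocallyIntegrableOn (fun y => v ((extChartAt (𝓡∂ m) c).symm y))
      (interior (extChartAt (𝓡∂ m) c).target) volume ∧
    ∀ i : Fin m,
      LocallyIntegrableOn (fun y => Dv ((extChartAt (𝓡∂ m) c).symm y)
          (partialVec c ((extChartAt (𝓡∂ m) c).symm y) i))
        (interior (extChartAt (𝓡∂ m) c).target) volume ∧
      ∀ ζ : EuclideanSpace ℝ (Fin m) → ℝ, ContDiff ℝ ∞ ζ → HasCompactSupport ζ →
        tsupport ζ ⊆ interior (extChartAt (𝓡∂ m) c).target →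
        ∫ y, (fderiv ℝ ζ y (EuclideanSpace.single i (1 : ℝ))) •
            v ((extChartAt (𝓡∂ m) c).symm y) =
          - ∫ y, ζ y • Dv ((extChartAt (𝓡∂ m) c).symm y)
            (partialVec c ((extChartAt (𝓡∂ m) c).symm y) i)

open Classical in
/-- The weak differential of `v` (unique up to null sets; zero if there is none). -/
def weakDifferential (v : M → EuclideanSpace ℝ (Fin n)) :
    (x : M) → TangentSpace (𝓡∂ m) x →L[ℝ] EuclideanSpace ℝ (Fin n) :=
  if h : ∃ Dv, HasWeakDifferential v Dv then h.choose else fun _ => 0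

end Weak

variable [RiemannianBundle (fun x : M => TangentSpace (𝓡∂ m) x)]

/-- The matrix `(g_ij)` of the metric at `x` in the chart around `c`. -/
def gram (c x : M) : Matrix (Fin m) (Fin m) ℝ :=
  Matrix.of fun i j => inner ℝ (partialVec c x i) (partialVec c x j)

variable [MeasurableSpace M]

variable (m) in
/-- The Riemannian volume of the domain of the chart around `c`: the push-forward to `M` of
`√det(g_ij) dx` on the chart image. -/
def chartVolume (c : M) : Measure M :=
  Measure.map (extChartAt (𝓡∂ m) c).symm
    ((volume.restrict (extChartAt (𝓡∂ m) c).target).withDensity fun y : EuclideanSpace ℝ (Fin m) =>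
      ENNReal.ofReal (Real.sqrt (gram (m := m) c ((extChartAt (𝓡∂ m) c).symm y)).det))

variable (m M) in
/-- The Riemannian volume measure `dvol_g`: the least measure on `M` that dominates all the
chart volumes. (These agree on overlaps of charts, so on each chart domain the supremum
is the corresponding chart volume.) -/
def riemVolume : Measure M := ⨆ c : M, chartVolume m c

variable (m) in
/-- `ω(p, r) = ∫_{B_r(p)} d^β dvol_g`, with `B_r(p)` the ball of the Riemannian distance. -/
def omega (β : ℝ) (p : M) (r : ℝ) : ℝ :=
  ∫ x in eball p (ENNReal.ofReal r), bdryDist m x ^ β ∂(riemVolume m M)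

variable {n : ℕ}

/-- `|A|_g² = g^{ij} ⟨A ∂ᵢ, A ∂ⱼ⟩` for a linear map `A : T_x M → ℝⁿ`, in the chart around `x`. -/
def normSqDiff (x : M) (A : TangentSpace (𝓡∂ m) x →L[ℝ] EuclideanSpace ℝ (Fin n)) : ℝ :=
  ∑ i : Fin m, ∑ j : Fin m,
    (gram (m := m) x x)⁻¹ i j * inner ℝ (A (partialVec x x i)) (A (partialVec x x j))

variable (m) in
/-- The weighted energy density `d^β |Dv|_g²`. -/
def energyDensity (β : ℝ) (v : M → EuclideanSpace ℝ (Fin n)) (x : M) : ℝ :=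
  bdryDist m x ^ β * normSqDiff (m := m) x (weakDifferential v x)

variable (m) in
/-- The energy `E_β|_K(v) = ½ ∫_K d^β |Dv|_g² dvol_g`. -/
def energy (β : ℝ) (K : Set M) (v : M → EuclideanSpace ℝ (Fin n)) : ℝ :=
  (1 / 2) * ∫ x in K, energyDensity m β v x ∂(riemVolume m M)

variable (m) in
/-- `v ∈ W^{1,2}_{β,loc}(M; N)`: `v` is weakly differentiable with values in `N` almost everywhere,
and `v`, `Dv` are square integrable with weight `d^β` on every compact subset of `M`, which may
meet the boundary. -/
structure IsSobolevLoc (β : ℝ) (N : Set (EuclideanSpace ℝ (Fin n)))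
    (v : M → EuclideanSpace ℝ (Fin n)) : Prop where
  weaklyDifferentiable : ∃ Dv, HasWeakDifferential (m := m) v Dv
  ae_mem : ∀ᵐ x ∂(riemVolume m M), v x ∈ N
  integrableOn_sq : ∀ K : Set M, IsCompact K →
    IntegrableOn (fun x => bdryDist m x ^ β * ‖v x‖ ^ 2) K (riemVolume m M)
  integrableOn_energyDensity : ∀ K : Set M, IsCompact K →
    IntegrableOn (energyDensity m β v) K (riemVolume m M)

variable (m) in
/-- `v` is weakly harmonic with respect to free boundary data: `E_β` is stationary under the outer
variations `v_t = π_N(v + t φ)`, `φ ∈ C_0^∞(M; ℝⁿ)`; the support of `φ` may meet the boundary. -/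
def IsWeaklyHarmonicFree (β : ℝ) (N : Set (EuclideanSpace ℝ (Fin n)))
    (v : M → EuclideanSpace ℝ (Fin n)) : Prop :=
  ∀ φ : M → EuclideanSpace ℝ (Fin n),
    ContMDiff (𝓡∂ m) 𝓘(ℝ, EuclideanSpace ℝ (Fin n)) ∞ φ → HasCompactSupport φ →
    HasDerivAt (fun t : ℝ => energy m β (tsupport φ) (fun x => nearestPoint N (v x + t • φ x))) 0 0

variable (m) in
/-- `E_β` is stationary at `v` under the inner variations `v_t = v ∘ Φ_t`, where `Φ_t` is a smooth
one-parameter family of diffeomorphisms of `M` with `Φ_0 = id`, each equal to the identity outside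
a fixed compact set `K`, which may meet the boundary. -/
def IsInnerStationaryFree (β : ℝ) (v : M → EuclideanSpace ℝ (Fin n)) : Prop :=
  ∀ (K : Set M) (Φ : ℝ → (M ≃ₘ^∞⟮𝓡∂ m, 𝓡∂ m⟯ M)), IsCompact K →
    ContMDiff (𝓘(ℝ, ℝ).prod (𝓡∂ m)) (𝓡∂ m) ∞ (fun q : ℝ × M => Φ q.1 q.2) →
    (∀ x, Φ 0 x = x) → (∀ t, ∀ x ∉ K, Φ t x = x) →
    HasDerivAt (fun t : ℝ => energy m β K (fun x => v (Φ t x))) 0 0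

variable (m) in
/-- `v ∈ W^{1,2}_{β,loc}(M; N)` is weakly stationary harmonic with respect to free boundary
data. -/
structure IsWeaklyStationaryHarmonicFree (β : ℝ) (N : Set (EuclideanSpace ℝ (Fin n)))
    (v : M → EuclideanSpace ℝ (Fin n)) : Prop where
  sobolev : IsSobolevLoc m β N v
  weaklyHarmonic : IsWeaklyHarmonicFree m β N v
  innerStationary : IsInnerStationaryFree m β v

end Manifold

end FreeBoundary

end

/-!
The normalised energy `t² / ω(p, t) ∫_{B_t(p)} d^β |Dv|²` is almost monotone because `E_β` is
stationary under inner variations; the outer variations and the target manifold play no role.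

Around each point of `M` there is a chart, `IsGoodChart`, in which the metric is comparable to the
Euclidean one with Lipschitz coefficients (`exists_isGoodChart`). There the energy is
`∫ d^β ⟨A Dv, Dv⟩ dy` with `A = √det g · g⁻¹`. For a centre `x₀` let `Q = A(x₀)⁻¹`. The energy is
tested with the radial field `y - x₀`, cut off outside of an ellipsoid `⟨Q (y - x₀), y - x₀⟩ ≤ r²`.
For these ellipsoids the leading cross term of the variation has a sign
(`IsEllipticOn.variation_le`), and the oscillation of `A` costs only factors `1 + O(r)`. A radial
field is admissible if its centre lies on the boundary, since it is then tangent to the boundary,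
and if its ellipsoid does not meet the boundary.

The weight `d^β` is not smooth, so it is not differentiated. The energy of `v ∘ Φ_s` is only
estimated from above, by a change of variables that uses a one-sided bound for the growth of `d^β`
along rays from `x₀` (`IsEllipticOn.exists_pointwise_variation_le`). As the derivative at `s = 0`
vanishes, this suffices for a first variation inequality
(`IsInnerStationaryFree.integral_variationWeight_nonneg`). It is a differential inequality in `r`
for the energy of ellipsoids, which `smoothedEnergy_le` integrates: if `d^β` grows along rays with
exponent `b`, the energy grows at least with exponent `m - 2 + b`.

* About a boundary point, `b = β`: scaling about `x₀` by the factor `l` maps short curves to the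
  boundary to such curves, and their length is multiplied by `l` up to the oscillation of the metric
  (`IsGoodChart.bdryDist_scale_le`).
* About an interior point, `b = 0` on balls whose radius is at most a small multiple of the distance
  to the boundary, since `d` is Lipschitz and bounded below there.

For a centre at height `p` above the boundary the two regimes combine to the growth rate
`t^(m-2) (t + p)^β` (`mul_growthProfile_le`): below the scale `p` the interior estimate applies, and
above it balls are compared with balls about the projection of the centre to the boundary. The
weighted volume `ω(p, t)` is comparable to `t²` times this rate (`IsGoodChart.exists_omega_bounds`),
which gives the inequality near each point (`exists_isMonotoneOn_nhds`), with constants that do not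
depend on `v`. Compactness concludes.

Two facts on which this rests are proved first: the chain rule for weak differentials under
diffeomorphisms of `M` (`HasWeakDifferential.comp_diffeomorph`), which reduces to the Piola identity
in Euclidean space, and the formula for integrals against the Riemannian volume in a chart
(`setIntegral_riemVolume`).
-/

set_option linter.unusedSectionVars false

noncomputable section

namespace FreeBoundary

/-! ### Weak derivatives under smooth changes of variables in Euclidean space -/

/-- Euclidean `m`-space, the model vector space. -/
abbrev Eu (m : ℕ) : Type := EuclideanSpace ℝ (Fin m)

/-- The `i`-th standard basis vector of `ℝᵐ`. -/
abbrev stdVec {m : ℕ} (i : Fin m) : Eu m := EuclideanSpace.single i (1 : ℝ)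

section Euclid

variable {m n : ℕ}

/-- `P i` is the `i`-th weak partial derivative on the open set `U` of the locally integrable
function `u`. -/
def HasWeakGradOn (U : Set (Eu m)) (u : Eu m → Eu n) (P : Fin m → Eu m → Eu n) : Prop :=
  LocallyIntegrableOn u U volume ∧ ∀ i : Fin m, LocallyIntegrableOn (P i) U volume ∧
    ∀ ζ : Eu m → ℝ, ContDiff ℝ ∞ ζ → HasCompactSupport ζ → tsupport ζ ⊆ U →
      ∫ y, (fderiv ℝ ζ y (stdVec i)) • u y = - ∫ y, ζ y • P i y

lemma HasWeakGradOn.mono {U V : Set (Eu m)} {u : Eu m → Eu n} {P : Fin m → Eu m → Eu n}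
    (h : HasWeakGradOn V u P) (hUV : U ⊆ V) : HasWeakGradOn U u P :=
  ⟨h.1.mono_set hUV, fun i => ⟨(h.2 i).1.mono_set hUV, fun ζ h1 h2 h3 =>
    (h.2 i).2 ζ h1 h2 (h3.trans hUV)⟩⟩

lemma eq_sum_stdVec (x : Eu m) : x = ∑ j, x j • (stdVec j : Eu m) := by
  ext k
  simp [Finset.sum_apply, Pi.single_apply]

lemma map_eq_sum_stdVec {V : Type*} [AddCommGroup V] [Module ℝ V] [TopologicalSpace V]
    (L : Eu m →L[ℝ] V) (x : Eu m) : L x = ∑ j, x j • L (stdVec j) := by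
  conv_lhs => rw [eq_sum_stdVec x]
  simp [map_sum]

/-- A function that is smooth on an open set `V` and vanishes on `V` off a compact subset extends
by zero to a smooth compactly supported function. -/
lemma contDiff_indicator_of_isCompact {V K : Set (Eu m)} (hV : IsOpen V) (hK : IsCompact K)
    (hKV : K ⊆ V) {h : Eu m → ℝ} (hh : ContDiffOn ℝ ∞ h V) (h0 : ∀ y ∈ V, y ∉ K → h y = 0) :
    ContDiff ℝ ∞ (V.indicator h) ∧ HasCompactSupport (V.indicator h) ∧
      tsupport (V.indicator h) ⊆ K := by
  have hsupp : Function.support (V.indicator h) ⊆ K := by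
    intro y hy
    by_contra hyK
    apply hy
    by_cases hyV : y ∈ V
    · rw [indicator_of_mem hyV, h0 y hyV hyK]
    · rw [indicator_of_notMem hyV]
  have hts : tsupport (V.indicator h) ⊆ K := closure_minimal hsupp hK.isClosed
  refine ⟨?_, hK.of_isClosed_subset (isClosed_tsupport _) hts, hts⟩
  rw [contDiff_iff_contDiffAt]
  intro y
  by_cases hyV : y ∈ V
  · refine (hh.contDiffAt (hV.mem_nhds hyV)).congr_of_eventuallyEq ?_
    filter_upwards [hV.mem_nhds hyV] with z hz
    rw [indicator_of_mem hz]
  · have : y ∉ tsupport (V.indicator h) := fun hy => hyV (hKV (hts hy))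
    refine (contDiffAt_const (c := (0 : ℝ))).congr_of_eventuallyEq ?_
    exact notMem_tsupport_iff_eventuallyEq.1 this

lemma integral_fderiv_eq_zero {h : Eu m → ℝ} (hh : ContDiff ℝ ∞ h) (hc : HasCompactSupport h)
    (e : Eu m) : ∫ y, fderiv ℝ h y e = 0 := by
  have hd : Continuous fun y => fderiv ℝ h y e :=
    (hh.continuous_fderiv (by simp)).clm_apply continuous_const
  have hdc : HasCompactSupport fun y => fderiv ℝ h y e := hc.fderiv_apply (𝕜 := ℝ) e
  have := integral_mul_fderiv_eq_neg_fderiv_mul_of_integrable (𝕜 := ℝ)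
    (μ := (volume : Measure (Eu m))) (f := fun _ => (1 : ℝ)) (g := h) (v := e) (by simp)
    (by simpa using hd.integrable_of_hasCompactSupport hdc)
    (by simpa using hh.continuous.integrable_of_hasCompactSupport hc)
    (fun x _ => by fun_prop) (fun x _ => hh.differentiable (by simp) x)
  simpa using this

lemma integrable_smul_of_tsupport_subset {U : Set (Eu m)} {u : Eu m → Eu n}
    (hu : LocallyIntegrableOn u U volume) {g : Eu m → ℝ} (hg : Continuous g)
    (hc : HasCompactSupport g) (hs : tsupport g ⊆ U) : Integrable (fun y => g y • u y) := by
  have h1 : IntegrableOn u (tsupport g) volume := hu.integrableOn_compact_subset hs hc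
  have h2 := h1.continuousOn_smul hg.continuousOn hc
  rw [← integrableOn_iff_integrable_of_support_subset (s := tsupport g)]
  · exact h2
  · intro y hy
    apply subset_tsupport
    intro h
    apply hy
    simp [h]

section ChangeOfVariables

variable {U V : Set (Eu m)} {F Ψ : Eu m → Eu m}

/-- `F` is a smooth diffeomorphism of the open set `U` onto the open set `V`, with inverse `Ψ`. -/
structure IsDiffeoOn (U V : Set (Eu m)) (F Ψ : Eu m → Eu m) : Prop where
  isOpen_source : IsOpen U
  isOpen_target : IsOpen V
  contDiffOn : ContDiffOn ℝ ∞ F U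
  contDiffOn_inv : ContDiffOn ℝ ∞ Ψ V
  mapsTo : MapsTo F U V
  mapsTo_inv : MapsTo Ψ V U
  left_inv : ∀ x ∈ U, Ψ (F x) = x
  right_inv : ∀ y ∈ V, F (Ψ y) = y

namespace IsDiffeoOn

lemma fderiv_comp_fderiv_inverse (D : IsDiffeoOn U V F Ψ) (y : Eu m) (hy : y ∈ V) :
    (fderiv ℝ F (Ψ y)).comp (fderiv ℝ Ψ y) = ContinuousLinearMap.id ℝ _ := by
  have h1 : DifferentiableAt ℝ F (Ψ y) :=
    (D.contDiffOn.contDiffAt (D.isOpen_source.mem_nhds (D.mapsTo_inv hy))).differentiableAt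
      (by simp)
  have h2 : DifferentiableAt ℝ Ψ y :=
    (D.contDiffOn_inv.contDiffAt (D.isOpen_target.mem_nhds hy)).differentiableAt (by simp)
  rw [← fderiv_comp y h1 h2]
  have : F ∘ Ψ =ᶠ[𝓝 y] id := by
    filter_upwards [D.isOpen_target.mem_nhds hy] with z hz using D.right_inv z hz
  rw [this.fderiv_eq, fderiv_id]

lemma det_fderiv_inverse_ne_zero (D : IsDiffeoOn U V F Ψ) (y : Eu m) (hy : y ∈ V) :
    (fderiv ℝ Ψ y).det ≠ 0 := by
  have h := congrArg ContinuousLinearMap.det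
    (D.fderiv_comp_fderiv_inverse y hy)
  intro h0
  rw [ContinuousLinearMap.det, ContinuousLinearMap.toLinearMap_comp, LinearMap.det_comp] at h
  rw [ContinuousLinearMap.det] at h0
  rw [h0] at h
  simp [ContinuousLinearMap.det] at h

lemma contDiffOn_abs_det_fderiv_inverse (D : IsDiffeoOn U V F Ψ) :
    ContDiffOn ℝ ∞ (fun y => |(fderiv ℝ Ψ y).det|) V := by
  intro y hy
  apply ContDiffAt.contDiffWithinAt
  have h1 : ContDiffAt ℝ ∞ (fderiv ℝ Ψ) y :=
    (D.contDiffOn_inv.contDiffAt (D.isOpen_target.mem_nhds hy)).fderiv_right (m := ∞) (by simp)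
  have h2 : ContDiffAt ℝ ∞ (fun y => (fderiv ℝ Ψ y).det) y := by
    have : ContDiff ℝ ∞ (fun A : Eu m →L[ℝ] Eu m => A.det) := by
      have e : (fun A : Eu m →L[ℝ] Eu m => A.det) = fun A : Eu m →L[ℝ] Eu m =>
          Matrix.det (Matrix.of fun i j : Fin m => A (stdVec j) i) := by
        funext A
        rw [ContinuousLinearMap.det,
          ← LinearMap.det_toMatrix (EuclideanSpace.basisFun (Fin m) ℝ).toBasis]
        congr 1
      rw [e]
      simp only [Matrix.det_apply]
      refine ContDiff.sum fun σ _ => ContDiff.const_smul _ (contDiff_prod fun i _ => ?_)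
      exact ((EuclideanSpace.proj (𝕜 := ℝ) (σ i) : Eu m →L[ℝ] ℝ).contDiff).comp
        (ContinuousLinearMap.apply ℝ (Eu m) (stdVec i)).contDiff
    exact this.contDiffAt.comp y h1
  exact (contDiffAt_abs (D.det_fderiv_inverse_ne_zero y hy)).comp y h2

lemma setIntegral_eq (D : IsDiffeoOn U V F Ψ) {W : Type*} [NormedAddCommGroup W] [NormedSpace ℝ W]
    (h : Eu m → W) : ∫ x in U, h x = ∫ y in V, |(fderiv ℝ Ψ y).det| • h (Ψ y) := by
  have himg : Ψ '' V = U := by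
    apply Subset.antisymm (image_subset_iff.2 D.mapsTo_inv)
    intro x hx
    exact ⟨F x, D.mapsTo hx, D.left_inv x hx⟩
  rw [← himg]
  apply integral_image_eq_integral_abs_det_fderiv_smul _ D.isOpen_target.measurableSet
  · intro y hy
    exact ((D.contDiffOn_inv.contDiffAt (D.isOpen_target.mem_nhds hy)).differentiableAt
      (by simp)).hasFDerivAt.hasFDerivWithinAt
  · intro y hy z hz h
    rw [← D.right_inv y hy, h, D.right_inv z hz]

/-- The locally integrable functions are preserved by a smooth change of variables. -/
lemma locallyIntegrableOn_comp (D : IsDiffeoOn U V F Ψ) {u : Eu m → Eu n}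
    (hu : LocallyIntegrableOn u V volume) :
    LocallyIntegrableOn (fun x => u (F x)) U volume := by
  rw [locallyIntegrableOn_iff D.isOpen_source.isLocallyClosed]
  intro K hKU hK
  have hFK : IsCompact (F '' K) := hK.image_of_continuousOn (D.contDiffOn.continuousOn.mono hKU)
  have hFKV : F '' K ⊆ V := image_subset_iff.2 fun x hx => D.mapsTo (hKU hx)
  have h1 : IntegrableOn u (F '' K) volume := hu.integrableOn_compact_subset hFKV hFK
  have himg : Ψ '' (F '' K) = K := by
    rw [image_image]
    apply Subset.antisymm
    · rintro _ ⟨x, hx, rfl⟩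
      simpa only [D.left_inv x (hKU hx)] using hx
    · intro x hx
      exact ⟨x, hx, D.left_inv x (hKU hx)⟩
  rw [← himg, integrableOn_image_iff_integrableOn_abs_det_fderiv_smul volume hFK.measurableSet
    (f' := fderiv ℝ Ψ)]
  · have h2 := h1.continuousOn_smul
      (D.contDiffOn_abs_det_fderiv_inverse.continuousOn.mono hFKV) hFK
    refine h2.congr_fun (fun y hy => ?_) hFK.measurableSet
    simp only [D.right_inv y (hFKV hy)]
  · intro y hy
    exact ((D.contDiffOn_inv.contDiffAt (D.isOpen_target.mem_nhds (hFKV hy))).differentiableAt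
      (by simp)).hasFDerivAt.hasFDerivWithinAt
  · intro y hy z hz h
    rw [← D.right_inv y (hFKV hy), h, D.right_inv z (hFKV hz)]

/-- The components of the push-forward to `V` of the field `ζ eᵢ` on `U`, that is of
`|det DΨ| · (ζ ∂ᵢF) ∘ Ψ`, extended by zero; here `F` maps `U` to `V` with inverse `Ψ`. -/
def pushField (V : Set (Eu m)) (F Ψ : Eu m → Eu m) (ζ : Eu m → ℝ) (i j : Fin m) : Eu m → ℝ :=
  V.indicator fun y => |(fderiv ℝ Ψ y).det| * (ζ (Ψ y) * (fderiv ℝ F (Ψ y) (stdVec i)) j)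

lemma contDiff_push (D : IsDiffeoOn U V F Ψ) {ζ ξ : Eu m → ℝ} (hζc : HasCompactSupport ζ)
    (hζU : tsupport ζ ⊆ U) (hξ : ContDiffOn ℝ ∞ ξ U) (h0 : ∀ x, x ∉ tsupport ζ → ξ x = 0) :
    ContDiff ℝ ∞ (V.indicator fun y => |(fderiv ℝ Ψ y).det| * ξ (Ψ y)) ∧
      HasCompactSupport (V.indicator fun y => |(fderiv ℝ Ψ y).det| * ξ (Ψ y)) ∧
      tsupport (V.indicator fun y => |(fderiv ℝ Ψ y).det| * ξ (Ψ y)) ⊆ V := by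
  have hK : IsCompact (F '' tsupport ζ) :=
    IsCompact.image_of_continuousOn hζc (D.contDiffOn.continuousOn.mono hζU)
  have hKV : F '' tsupport ζ ⊆ V := image_subset_iff.2 fun x hx => D.mapsTo (hζU hx)
  obtain ⟨h1, h2, h3⟩ := contDiff_indicator_of_isCompact
    (h := fun y => |(fderiv ℝ Ψ y).det| * ξ (Ψ y)) D.isOpen_target hK hKV
    (D.contDiffOn_abs_det_fderiv_inverse.mul (hξ.comp D.contDiffOn_inv D.mapsTo_inv))
    (by
      intro y hy hyK
      have : Ψ y ∉ tsupport ζ := fun h => hyK ⟨Ψ y, h, D.right_inv y hy⟩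
      simp [h0 _ this])
  exact ⟨h1, h2, h3.trans hKV⟩

lemma contDiffOn_fderiv_apply (D : IsDiffeoOn U V F Ψ) (i j : Fin m) :
    ContDiffOn ℝ ∞ (fun x => (fderiv ℝ F x (stdVec i)) j) U := by
  have h := (D.contDiffOn.fderiv_of_isOpen D.isOpen_source (m := ∞) (by simp)).clm_apply
    (contDiffOn_const (c := (stdVec i : Eu m)))
  exact (EuclideanSpace.proj (𝕜 := ℝ) j : Eu m →L[ℝ] ℝ).contDiff.comp_contDiffOn h

lemma contDiff_pushField (D : IsDiffeoOn U V F Ψ) {ζ : Eu m → ℝ} (hζ : ContDiff ℝ ∞ ζ)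
    (hζc : HasCompactSupport ζ) (hζU : tsupport ζ ⊆ U) (i j : Fin m) :
    ContDiff ℝ ∞ (pushField V F Ψ ζ i j) ∧ HasCompactSupport (pushField V F Ψ ζ i j) ∧
      tsupport (pushField V F Ψ ζ i j) ⊆ V :=
  D.contDiff_push (ξ := fun x => ζ x * (fderiv ℝ F x (stdVec i)) j) hζc hζU
    (hζ.contDiffOn.mul (D.contDiffOn_fderiv_apply i j))
    (fun x hx => by simp [image_eq_zero_of_notMem_tsupport hx])

/-- The Piola identity: the pushed-forward field has divergence `|det DΨ| · (∂ᵢζ) ∘ Ψ`. It is the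
dual form of the chain rule for smooth functions, from which it is derived here by testing. -/
lemma ae_sum_fderiv_pushField (D : IsDiffeoOn U V F Ψ) {ζ : Eu m → ℝ} (hζ : ContDiff ℝ ∞ ζ)
    (hζc : HasCompactSupport ζ) (hζU : tsupport ζ ⊆ U) (i : Fin m) :
    ∀ᵐ y, ∑ j, fderiv ℝ (pushField V F Ψ ζ i j) y (stdVec j) =
      V.indicator (fun y => |(fderiv ℝ Ψ y).det| * fderiv ℝ ζ (Ψ y) (stdVec i)) y := by
  have hX := fun j => D.contDiff_pushField hζ hζc hζU i j
  have hdζ : ContDiff ℝ ∞ fun x => fderiv ℝ ζ x (stdVec i) :=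
    (hζ.fderiv_right (m := ∞) (by simp)).clm_apply contDiff_const
  obtain ⟨hR, hRc, -⟩ := D.contDiff_push (ξ := fun x => fderiv ℝ ζ x (stdVec i)) hζc hζU
    hdζ.contDiffOn
    (fun x hx => by
      rw [(notMem_tsupport_iff_eventuallyEq.1 hx).fderiv_eq]
      simp)
  have hdX : ∀ j, Continuous fun y => fderiv ℝ (pushField V F Ψ ζ i j) y (stdVec j) := fun j =>
    ((hX j).1.continuous_fderiv (by simp)).clm_apply continuous_const
  apply ae_eq_of_integral_contDiff_smul_eq
  · exact (continuous_finsetSum _ fun j _ => hdX j).locallyIntegrable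
  · exact hR.continuous.locallyIntegrable
  intro w hw hwc
  have hdw : ∀ j : Fin m, Continuous fun y => fderiv ℝ w y (stdVec j) := fun j =>
    (hw.continuous_fderiv (by simp)).clm_apply continuous_const
  have i1 : ∀ j, Integrable fun y => w y * fderiv ℝ (pushField V F Ψ ζ i j) y (stdVec j) :=
    fun j => (hw.continuous.mul (hdX j)).integrable_of_hasCompactSupport (hwc.mul_right)
  have i2 : ∀ j, Integrable fun y => fderiv ℝ w y (stdVec j) * pushField V F Ψ ζ i j y :=
    fun j => ((hdw j).mul (hX j).1.continuous).integrable_of_hasCompactSupport ((hX j).2.1.mul_left)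
  have i3 : ∀ j, Integrable fun y => w y * pushField V F Ψ ζ i j y :=
    fun j => (hw.continuous.mul (hX j).1.continuous).integrable_of_hasCompactSupport (hwc.mul_right)
  have hwF : ContDiffOn ℝ ∞ (fun x => w (F x)) U := hw.comp_contDiffOn D.contDiffOn
  have hprod := contDiff_indicator_of_isCompact (h := fun x => ζ x * w (F x)) D.isOpen_source
    hζc hζU (hζ.contDiffOn.mul hwF) (fun x _ hx => by simp [image_eq_zero_of_notMem_tsupport hx])
  calc ∫ y, w y • ∑ j, fderiv ℝ (pushField V F Ψ ζ i j) y (stdVec j)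
      = ∑ j, ∫ y, w y * fderiv ℝ (pushField V F Ψ ζ i j) y (stdVec j) := by
        simp only [smul_eq_mul, Finset.mul_sum]
        exact integral_finsetSum _ fun j _ => i1 j
    _ = ∑ j, - ∫ y, fderiv ℝ w y (stdVec j) * pushField V F Ψ ζ i j y := by
        refine Finset.sum_congr rfl fun j _ => ?_
        exact integral_mul_fderiv_eq_neg_fderiv_mul_of_integrable (i2 j) (i1 j) (i3 j)
          (fun x _ => hw.differentiable (by simp) x)
          (fun x _ => (hX j).1.differentiable (by simp) x)
    _ = - ∫ y, ∑ j, fderiv ℝ w y (stdVec j) * pushField V F Ψ ζ i j y := by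
        rw [integral_finsetSum _ fun j _ => i2 j, Finset.sum_neg_distrib]
    _ = - ∫ y in V, |(fderiv ℝ Ψ y).det| •
          (ζ (Ψ y) * fderiv ℝ (fun x => w (F x)) (Ψ y) (stdVec i)) := by
        rw [← integral_indicator D.isOpen_target.measurableSet]
        congr 2
        funext y
        by_cases hy : y ∈ V
        · have h1 : DifferentiableAt ℝ F (Ψ y) :=
            (D.contDiffOn.contDiffAt (D.isOpen_source.mem_nhds (D.mapsTo_inv hy))).differentiableAt
              (by simp)
          have h2 : DifferentiableAt ℝ w (F (Ψ y)) := hw.differentiable (by simp) _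
          rw [indicator_of_mem hy, show (fun x => w (F x)) = w ∘ F from rfl,
            fderiv_comp _ h2 h1, D.right_inv y hy, ContinuousLinearMap.comp_apply,
            map_eq_sum_stdVec (fderiv ℝ w y) (fderiv ℝ F (Ψ y) (stdVec i))]
          simp only [pushField, indicator_of_mem hy, smul_eq_mul, Finset.mul_sum]
          exact Finset.sum_congr rfl fun j _ => by ring
        · simp [pushField, indicator_of_notMem hy]
    _ = - ∫ x in U, ζ x * fderiv ℝ (fun x => w (F x)) x (stdVec i) := by
        rw [D.setIntegral_eq (fun x => ζ x * fderiv ℝ (fun x => w (F x)) x (stdVec i))]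
    _ = ∫ x in U, fderiv ℝ ζ x (stdVec i) * w (F x) := by
        have hz := integral_fderiv_eq_zero hprod.1 hprod.2.1 (stdVec i)
        have hint : ∀ {K : Set (Eu m)} {g : Eu m → ℝ}, IsCompact K → K ⊆ U → ContDiffOn ℝ ∞ g U →
            (∀ x ∈ U, x ∉ K → g x = 0) → IntegrableOn g U := fun hK hKU hg h0 => by
          rw [← integrable_indicator_iff D.isOpen_source.measurableSet]
          obtain ⟨a1, a2, -⟩ := contDiff_indicator_of_isCompact D.isOpen_source hK hKU hg h0
          exact a1.continuous.integrable_of_hasCompactSupport a2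
        have e1 : ∀ x ∈ U, fderiv ℝ (U.indicator fun x => ζ x * w (F x)) x (stdVec i) =
            ζ x * fderiv ℝ (fun x => w (F x)) x (stdVec i) +
              fderiv ℝ ζ x (stdVec i) * w (F x) := by
          intro x hx
          have : (U.indicator fun x => ζ x * w (F x)) =ᶠ[𝓝 x] fun x => ζ x * w (F x) := by
            filter_upwards [D.isOpen_source.mem_nhds hx] with z hz using indicator_of_mem hz _
          rw [this.fderiv_eq, fderiv_fun_mul (hζ.differentiable (by simp) x)
            ((hwF.contDiffAt (D.isOpen_source.mem_nhds hx)).differentiableAt (by simp))]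
          simp only [_root_.add_apply, _root_.smul_apply, smul_eq_mul]
          ring
        rw [← setIntegral_eq_integral_of_forall_compl_eq_zero (s := U)] at hz
        swap
        · intro x hx
          have : x ∉ tsupport (U.indicator fun x => ζ x * w (F x)) :=
            fun h => hx (hζU (hprod.2.2 h))
          rw [(notMem_tsupport_iff_eventuallyEq.1 this).fderiv_eq]
          simp
        rw [setIntegral_congr_fun D.isOpen_source.measurableSet e1, integral_add] at hz
        · linarith
        · exact hint hζc hζU (hζ.contDiffOn.mul
            ((hwF.fderiv_of_isOpen D.isOpen_source (m := ∞) (by simp)).clm_apply contDiffOn_const))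
            fun x _ hx => by simp [image_eq_zero_of_notMem_tsupport hx]
        · exact hint hζc hζU (hdζ.contDiffOn.mul hwF) fun x _ hx => by
            rw [(notMem_tsupport_iff_eventuallyEq.1 hx).fderiv_eq]
            simp
    _ = ∫ y in V, |(fderiv ℝ Ψ y).det| • (fderiv ℝ ζ (Ψ y) (stdVec i) * w (F (Ψ y))) := by
        rw [D.setIntegral_eq (fun x => fderiv ℝ ζ x (stdVec i) * w (F x))]
    _ = ∫ y, w y • V.indicator
          (fun y => |(fderiv ℝ Ψ y).det| * fderiv ℝ ζ (Ψ y) (stdVec i)) y := by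
        rw [← integral_indicator D.isOpen_target.measurableSet]
        congr 1
        funext y
        by_cases hy : y ∈ V
        · simp only [indicator_of_mem hy, smul_eq_mul, D.right_inv y hy]
          ring
        · simp [indicator_of_notMem hy]

/-- The chain rule for weak derivatives under a smooth change of variables. -/
lemma hasWeakGradOn_comp (D : IsDiffeoOn U V F Ψ) {u : Eu m → Eu n} {P : Fin m → Eu m → Eu n}
    (h : HasWeakGradOn V u P) :
    HasWeakGradOn U (fun x => u (F x))
      (fun i x => ∑ j, (fderiv ℝ F x (stdVec i)) j • P j (F x)) := by
  refine ⟨D.locallyIntegrableOn_comp h.1, fun i => ⟨?_, ?_⟩⟩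
  · have : ∀ j, LocallyIntegrableOn
        (fun x => (fderiv ℝ F x (stdVec i)) j • P j (F x)) U volume := fun j =>
      (D.locallyIntegrableOn_comp (h.2 j).1).continuousOn_smul D.isOpen_source.isLocallyClosed
        (D.contDiffOn_fderiv_apply i j).continuousOn
    rw [locallyIntegrableOn_iff D.isOpen_source.isLocallyClosed]
    exact fun K hKU hK =>
      integrable_finsetSum _ fun j _ => (this j).integrableOn_compact_subset hKU hK
  intro ζ hζ hζc hζU
  have hX := fun j => D.contDiff_pushField hζ hζc hζU i j
  have hdX : ∀ j, Continuous fun y => fderiv ℝ (pushField V F Ψ ζ i j) y (stdVec j) := fun j =>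
    ((hX j).1.continuous_fderiv (by simp)).clm_apply continuous_const
  have hdXc : ∀ j, HasCompactSupport fun y => fderiv ℝ (pushField V F Ψ ζ i j) y (stdVec j) :=
    fun j => (hX j).2.1.fderiv_apply (𝕜 := ℝ) _
  have hdXs : ∀ j, tsupport (fun y => fderiv ℝ (pushField V F Ψ ζ i j) y (stdVec j)) ⊆ V :=
    fun j => (tsupport_fderiv_apply_subset ℝ _).trans (hX j).2.2
  have out : ∀ {g : Eu m → ℝ} (w : Eu m → Eu n), tsupport g ⊆ U →
      ∫ x, g x • w x = ∫ x in U, g x • w x := fun {g} w hg =>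
    (setIntegral_eq_integral_of_forall_compl_eq_zero fun x hx => by
      simp [image_eq_zero_of_notMem_tsupport fun h => hx (hg h)]).symm
  rw [out _ hζU, out _ ((tsupport_fderiv_apply_subset ℝ _).trans hζU),
    D.setIntegral_eq, D.setIntegral_eq]
  calc ∫ y in V, |(fderiv ℝ Ψ y).det| • (fderiv ℝ ζ (Ψ y) (stdVec i)) • u (F (Ψ y))
      = ∫ y, (∑ j, fderiv ℝ (pushField V F Ψ ζ i j) y (stdVec j)) • u y := by
        rw [← integral_indicator D.isOpen_target.measurableSet]
        apply integral_congr_ae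
        filter_upwards [D.ae_sum_fderiv_pushField hζ hζc hζU i] with y hy
        rw [hy]
        by_cases hyV : y ∈ V
        · simp only [indicator_of_mem hyV, D.right_inv y hyV, smul_smul]
        · simp [indicator_of_notMem hyV]
    _ = ∑ j, ∫ y, fderiv ℝ (pushField V F Ψ ζ i j) y (stdVec j) • u y := by
        simp only [Finset.sum_smul]
        exact integral_finsetSum _ fun j _ =>
          integrable_smul_of_tsupport_subset h.1 (hdX j) (hdXc j) (hdXs j)
    _ = ∑ j, - ∫ y, pushField V F Ψ ζ i j y • P j y :=
        Finset.sum_congr rfl fun j _ => (h.2 j).2 _ (hX j).1 (hX j).2.1 (hX j).2.2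
    _ = - ∫ y, ∑ j, pushField V F Ψ ζ i j y • P j y := by
        rw [integral_finsetSum _ fun j _ => integrable_smul_of_tsupport_subset (h.2 j).1
          (hX j).1.continuous (hX j).2.1 (hX j).2.2, Finset.sum_neg_distrib]
    _ = _ := by
        rw [← integral_indicator D.isOpen_target.measurableSet]
        congr 2
        funext y
        by_cases hyV : y ∈ V
        · simp only [pushField, indicator_of_mem hyV, D.right_inv y hyV, Finset.smul_sum,
            smul_smul]
        · simp [pushField, indicator_of_notMem hyV]

end IsDiffeoOn

end ChangeOfVariables

lemma HasWeakGradOn.congr {U : Set (Eu m)} (hU : IsOpen U) {u u' : Eu m → Eu n}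
    {P P' : Fin m → Eu m → Eu n} (h : HasWeakGradOn U u P) (hu : EqOn u u' U)
    (hP : ∀ i, EqOn (P i) (P' i) U) : HasWeakGradOn U u' P' := by
  have hloc : ∀ {f g : Eu m → Eu n}, EqOn f g U → LocallyIntegrableOn f U volume →
      LocallyIntegrableOn g U volume := fun {f g} hfg hf => by
    rw [locallyIntegrableOn_iff hU.isLocallyClosed] at hf ⊢
    exact fun K hKU hK => (hf K hKU hK).congr_fun (fun x hx => hfg (hKU hx)) hK.measurableSet
  refine ⟨hloc hu h.1, fun i => ⟨hloc (hP i) (h.2 i).1, fun ζ h1 h2 h3 => ?_⟩⟩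
  have e : ∀ {g : Eu m → ℝ} {f f' : Eu m → Eu n}, tsupport g ⊆ U → EqOn f f' U →
      ∫ y, g y • f y = ∫ y, g y • f' y := fun {g f f'} hg hf => by
    congr 1
    funext y
    by_cases hy : y ∈ U
    · rw [hf hy]
    · simp [image_eq_zero_of_notMem_tsupport fun h => hy (hg h)]
  rw [← e ((tsupport_fderiv_apply_subset ℝ _).trans h3) hu, ← e h3 (hP i)]
  exact (h.2 i).2 ζ h1 h2 h3

/-- Being a weak gradient is a local property, by a partition of unity. -/
lemma hasWeakGradOn_of_locally {U : Set (Eu m)} {u : Eu m → Eu n}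
    {P : Fin m → Eu m → Eu n}
    (h : ∀ x ∈ U, ∃ O, IsOpen O ∧ x ∈ O ∧ HasWeakGradOn O u P) : HasWeakGradOn U u P := by
  have hloc : ∀ {f : Eu m → Eu n},
      (∀ x ∈ U, ∃ O, IsOpen O ∧ x ∈ O ∧ LocallyIntegrableOn f O volume) →
      LocallyIntegrableOn f U volume := fun {f} hf x hx => by
    obtain ⟨O, hO, hxO, hfO⟩ := hf x hx
    have := hfO x hxO
    rw [hO.nhdsWithin_eq hxO] at this
    exact this.filter_mono nhdsWithin_le_nhds
  refine ⟨hloc fun x hx => (h x hx).imp fun O hO => ⟨hO.1, hO.2.1, hO.2.2.1⟩, fun i =>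
    ⟨hloc fun x hx => (h x hx).imp fun O hO => ⟨hO.1, hO.2.1, (hO.2.2.2 i).1⟩, ?_⟩⟩
  have hu : LocallyIntegrableOn u U volume :=
    hloc fun x hx => (h x hx).imp fun O hO => ⟨hO.1, hO.2.1, hO.2.2.1⟩
  have hP : LocallyIntegrableOn (P i) U volume :=
    hloc fun x hx => (h x hx).imp fun O hO => ⟨hO.1, hO.2.1, (hO.2.2.2 i).1⟩
  intro ζ hζ hζc hζU
  choose! O hO hxO hgrad using h
  obtain ⟨t, htU⟩ := IsCompact.elim_nhds_subcover' hζc (fun x _ => O x)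
    (fun x hx => (hO x (hζU hx)).mem_nhds (hxO x (hζU hx)))
  have hcover : tsupport ζ ⊆ ⋃ k : t, O k.1 := by
    intro y hy
    obtain ⟨k, hk, hyk⟩ := mem_iUnion₂.1 (htU hy)
    exact mem_iUnion.2 ⟨⟨k, hk⟩, hyk⟩
  obtain ⟨ρ, hρ⟩ := SmoothPartitionOfUnity.exists_isSubordinate 𝓘(ℝ, Eu m)
    (isClosed_tsupport ζ) (fun k : t => O k.1) (fun k => hO _ (hζU k.1.2)) hcover
  have hρs : ∀ k, ContDiff ℝ ∞ (ρ k : Eu m → ℝ) := fun k => (ρ k).contMDiff.contDiff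
  have hsum : ∀ y, ζ y = ∑ k, ρ k y * ζ y := by
    intro y
    by_cases hy : y ∈ tsupport ζ
    · have := ρ.sum_eq_one hy
      rw [finsum_eq_sum_of_fintype] at this
      rw [← Finset.sum_mul, this, one_mul]
    · simp [image_eq_zero_of_notMem_tsupport hy]
  have hk1 : ∀ k, ContDiff ℝ ∞ fun y => ρ k y * ζ y := fun k => (hρs k).mul hζ
  have hk2 : ∀ k, HasCompactSupport fun y => ρ k y * ζ y := fun k => hζc.mul_left
  have hk3 : ∀ k, tsupport (fun y => ρ k y * ζ y) ⊆ O k.1 := fun k =>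
    (tsupport_mul_subset_left).trans (hρ k)
  have hk4 : ∀ k, tsupport (fun y => ρ k y * ζ y) ⊆ U := fun k =>
    (tsupport_mul_subset_right).trans hζU
  have hd : ∀ y, fderiv ℝ ζ y (stdVec i) =
      ∑ k, fderiv ℝ (fun y => ρ k y * ζ y) y (stdVec i) := by
    intro y
    have : ζ = fun y => ∑ k, ρ k y * ζ y := funext hsum
    conv_lhs => rw [this]
    rw [fderiv_fun_sum fun k _ => (hk1 k).differentiable (by simp) y]
    simp
  calc ∫ y, (fderiv ℝ ζ y (stdVec i)) • u y
      = ∑ k, ∫ y, fderiv ℝ (fun y => ρ k y * ζ y) y (stdVec i) • u y := by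
        simp only [hd, Finset.sum_smul]
        exact integral_finsetSum _ fun k _ => integrable_smul_of_tsupport_subset hu
          (((hk1 k).continuous_fderiv (by simp)).clm_apply continuous_const)
          ((hk2 k).fderiv_apply (𝕜 := ℝ) _) ((tsupport_fderiv_apply_subset ℝ _).trans (hk4 k))
    _ = ∑ k, - ∫ y, (ρ k y * ζ y) • P i y := Finset.sum_congr rfl fun k _ =>
        ((hgrad _ (hζU k.1.2)).2 i).2 _ (hk1 k) (hk2 k) (hk3 k)
    _ = - ∫ y, ζ y • P i y := by
        rw [Finset.sum_neg_distrib, ← integral_finsetSum _ fun k _ =>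
          integrable_smul_of_tsupport_subset hP (hk1 k).continuous (hk2 k) (hk4 k)]
        congr 2
        funext y
        rw [← Finset.sum_smul, ← hsum]

lemma HasWeakGradOn.ae_eq {U : Set (Eu m)} (hU : IsOpen U) {u : Eu m → Eu n}
    {P P' : Fin m → Eu m → Eu n} (h : HasWeakGradOn U u P) (h' : HasWeakGradOn U u P')
    (i : Fin m) : ∀ᵐ y, y ∈ U → P i y = P' i y := by
  have := hU.ae_eq_zero_of_integral_contDiff_smul_eq_zero (μ := volume)
    (f := fun y => P i y - P' i y) ((h.2 i).1.sub (h'.2 i).1) (by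
      intro ζ h1 h2 h3
      simp only [smul_sub]
      rw [integral_sub (integrable_smul_of_tsupport_subset (h.2 i).1 h1.continuous h2 h3)
        (integrable_smul_of_tsupport_subset (h'.2 i).1 h1.continuous h2 h3)]
      have e1 := (h.2 i).2 ζ h1 h2 h3
      have e2 := (h'.2 i).2 ζ h1 h2 h3
      rw [e1] at e2
      rw [sub_eq_zero]
      exact neg_injective e2)
  filter_upwards [this] with y hy hyU
  exact sub_eq_zero.1 (hy hyU)

end Euclid

/-! ### Coordinate frames and the metric in a chart -/

section ChartLayer

/-- The contraction of a bilinear form with the inverse metric does not depend on the basis. -/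
lemma sum_inv_mul_eq_of_congruence {m : ℕ} {G G' B B' P : Matrix (Fin m) (Fin m) ℝ}
    (hG : G' = P.transpose * G * P) (hB : B' = P.transpose * B * P) (hdet : G'.det ≠ 0) :
    ∑ i, ∑ j, G'⁻¹ i j * B' i j = ∑ i, ∑ j, G⁻¹ i j * B i j := by
  have htr : ∀ X Y : Matrix (Fin m) (Fin m) ℝ, ∑ i, ∑ j, X i j * Y i j =
      (X * Y.transpose).trace := fun X Y => by
    simp [Matrix.trace, Matrix.mul_apply]
  have hP : IsUnit P.det := by
    rw [hG, Matrix.det_mul] at hdet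
    exact (right_ne_zero_of_mul hdet).isUnit
  have hPt : IsUnit P.transpose.det := by rwa [Matrix.det_transpose]
  rw [htr, htr, hG, hB, Matrix.mul_inv_rev, Matrix.mul_inv_rev, Matrix.transpose_mul,
    Matrix.transpose_mul, Matrix.transpose_transpose, Matrix.trace_mul_comm]
  have e : P.transpose * (B.transpose * P) * (P⁻¹ * (G⁻¹ * P.transpose⁻¹)) =
      P.transpose * (B.transpose * G⁻¹ * P.transpose⁻¹) := by
    simp only [Matrix.mul_assoc]
    rw [Matrix.mul_nonsing_inv_cancel_left _ _ hP]
  rw [e, Matrix.trace_mul_comm, Matrix.mul_assoc, Matrix.nonsing_inv_mul _ hPt, Matrix.mul_one,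
    Matrix.trace_mul_comm]

variable {m : ℕ} [NeZero m] {M : Type*} [EMetricSpace M] [ChartedSpace (EuclideanHalfSpace m) M]

section Frame

variable [IsManifold (𝓡∂ m) ∞ M]

/-- The tangent bundle needs only a `C¹` structure; used as a local instance. -/
lemma isManifold_one : IsManifold (𝓡∂ m) 1 M := IsManifold.of_le (n := ∞) (by simp)

attribute [local instance] isManifold_one

lemma coordVec_eq_symmL {c x : M} (hx : x ∈ (extChartAt (𝓡∂ m) c).source) (w : Eu m) :
    coordVec c x w = (trivializationAt (Eu m) (TangentSpace (𝓡∂ m)) c).symmL ℝ x w := by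
  rw [TangentBundle.symmL_trivializationAt (by simpa using hx)]
  rfl

/-- The derivative of the inverse chart, as a linear map into the tangent space. -/
def coordMap (c x : M) : Eu m →L[ℝ] TangentSpace (𝓡∂ m) x :=
  (trivializationAt (Eu m) (TangentSpace (𝓡∂ m)) c).symmL ℝ x

lemma mem_baseSet_iff {c x : M} : x ∈ (trivializationAt (Eu m) (TangentSpace (𝓡∂ m)) c).baseSet ↔
    x ∈ (extChartAt (𝓡∂ m) c).source := by
  simp

lemma coordMap_apply {c x : M} (hx : x ∈ (extChartAt (𝓡∂ m) c).source) (w : Eu m) :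
    coordMap c x w = coordVec c x w := (coordVec_eq_symmL hx w).symm

lemma coordMap_bijective {c x : M} (hx : x ∈ (extChartAt (𝓡∂ m) c).source) :
    Function.Bijective (coordMap (m := m) c x) := by
  have hb := mem_baseSet_iff.2 hx
  refine Function.bijective_iff_has_inverse.2
    ⟨(trivializationAt (Eu m) (TangentSpace (𝓡∂ m)) c).continuousLinearMapAt ℝ x, fun w => ?_,
      fun w => ?_⟩
  · exact (trivializationAt (Eu m) (TangentSpace (𝓡∂ m)) c).linearMapAt_symmₗ (R := ℝ) hb w
  · exact (trivializationAt (Eu m) (TangentSpace (𝓡∂ m)) c).symmₗ_linearMapAt (R := ℝ) hb w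

lemma coordVec_eq_sum {c x : M} (hx : x ∈ (extChartAt (𝓡∂ m) c).source) (w : Eu m) :
    coordVec c x w = ∑ i, w i • partialVec (m := m) c x i := by
  rw [← coordMap_apply hx, map_eq_sum_stdVec]
  simp only [coordMap_apply hx]
  rfl

lemma coordMap_comp_mfderiv {c x : M} (hx : x ∈ (extChartAt (𝓡∂ m) c).source)
    (V : TangentSpace (𝓡∂ m) x) :
    coordVec c x (mfderiv (𝓡∂ m) 𝓘(ℝ, Eu m) (extChartAt (𝓡∂ m) c) x V) = V := by
  have h := mfderivWithin_extChartAt_symm_comp_mfderiv_extChartAt' (I := 𝓡∂ m) hx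
  exact congrArg (fun L => L V) h

/-- The differential of a map between charts, in coordinates. -/
lemma mfderiv_coordVec {Φ : M → M} {c c' : M} {y : Eu m} (hy : y ∈ (extChartAt (𝓡∂ m) c).target)
    (hΦ : MDifferentiableAt (𝓡∂ m) (𝓡∂ m) Φ ((extChartAt (𝓡∂ m) c).symm y))
    (hy' : Φ ((extChartAt (𝓡∂ m) c).symm y) ∈ (extChartAt (𝓡∂ m) c').source) :
    DifferentiableWithinAt ℝ
        (fun z => extChartAt (𝓡∂ m) c' (Φ ((extChartAt (𝓡∂ m) c).symm z))) (range (𝓡∂ m)) y ∧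
    ∀ w : Eu m, mfderiv (𝓡∂ m) (𝓡∂ m) Φ ((extChartAt (𝓡∂ m) c).symm y)
        (coordVec c ((extChartAt (𝓡∂ m) c).symm y) w) =
      coordVec c' (Φ ((extChartAt (𝓡∂ m) c).symm y)) (fderivWithin ℝ
        (fun z => extChartAt (𝓡∂ m) c' (Φ ((extChartAt (𝓡∂ m) c).symm z))) (range (𝓡∂ m)) y w) := by
  have h1 := mdifferentiableWithinAt_extChartAt_symm (I := 𝓡∂ m) hy
  have h2 : MDifferentiableWithinAt 𝓘(ℝ, Eu m) (𝓡∂ m)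
      (Φ ∘ (extChartAt (𝓡∂ m) c).symm) (range (𝓡∂ m)) y := hΦ.comp_mdifferentiableWithinAt y h1
  have h3 : MDifferentiableAt (𝓡∂ m) 𝓘(ℝ, Eu m) (extChartAt (𝓡∂ m) c')
      (Φ ((extChartAt (𝓡∂ m) c).symm y)) := mdifferentiableAt_extChartAt (by simpa using hy')
  have h4 : MDifferentiableWithinAt 𝓘(ℝ, Eu m) 𝓘(ℝ, Eu m)
      (extChartAt (𝓡∂ m) c' ∘ (Φ ∘ (extChartAt (𝓡∂ m) c).symm)) (range (𝓡∂ m)) y :=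
    MDifferentiableAt.comp_mdifferentiableWithinAt y h3 h2
  have hu : UniqueMDiffWithinAt 𝓘(ℝ, Eu m) (range (𝓡∂ m)) y :=
    (𝓡∂ m).uniqueMDiffOn _ (extChartAt_target_subset_range c hy)
  refine ⟨h4.differentiableWithinAt, fun w => ?_⟩
  have e1 : mfderivWithin 𝓘(ℝ, Eu m) 𝓘(ℝ, Eu m)
      (extChartAt (𝓡∂ m) c' ∘ (Φ ∘ (extChartAt (𝓡∂ m) c).symm)) (range (𝓡∂ m)) y =
      (mfderiv (𝓡∂ m) 𝓘(ℝ, Eu m) (extChartAt (𝓡∂ m) c')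
        (Φ ((extChartAt (𝓡∂ m) c).symm y))).comp
      (mfderivWithin 𝓘(ℝ, Eu m) (𝓡∂ m) (Φ ∘ (extChartAt (𝓡∂ m) c).symm) (range (𝓡∂ m)) y) :=
    mfderiv_comp_mfderivWithin y h3 h2 hu
  have e2 : mfderivWithin 𝓘(ℝ, Eu m) (𝓡∂ m) (Φ ∘ (extChartAt (𝓡∂ m) c).symm) (range (𝓡∂ m)) y =
      (mfderiv (𝓡∂ m) (𝓡∂ m) Φ ((extChartAt (𝓡∂ m) c).symm y)).comp
      (mfderivWithin 𝓘(ℝ, Eu m) (𝓡∂ m) (extChartAt (𝓡∂ m) c).symm (range (𝓡∂ m)) y) :=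
    mfderiv_comp_mfderivWithin y hΦ h1 hu
  rw [mfderivWithin_eq_fderivWithin] at e1
  have e3 : coordVec c ((extChartAt (𝓡∂ m) c).symm y) w =
      mfderivWithin 𝓘(ℝ, Eu m) (𝓡∂ m) (extChartAt (𝓡∂ m) c).symm (range (𝓡∂ m)) y w := by
    rw [coordVec, (extChartAt (𝓡∂ m) c).right_inv hy]
  have e5 : coordVec c' (Φ ((extChartAt (𝓡∂ m) c).symm y)) (fderivWithin ℝ
        (fun z => extChartAt (𝓡∂ m) c' (Φ ((extChartAt (𝓡∂ m) c).symm z))) (range (𝓡∂ m)) y w) =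
      coordVec c' (Φ ((extChartAt (𝓡∂ m) c).symm y))
        (mfderiv (𝓡∂ m) 𝓘(ℝ, Eu m) (extChartAt (𝓡∂ m) c')
        (Φ ((extChartAt (𝓡∂ m) c).symm y)) (mfderivWithin 𝓘(ℝ, Eu m) (𝓡∂ m)
          (Φ ∘ (extChartAt (𝓡∂ m) c).symm) (range (𝓡∂ m)) y w)) :=
    congrArg (coordVec c' (Φ ((extChartAt (𝓡∂ m) c).symm y)))
      (congrArg (fun L : Eu m →L[ℝ] Eu m => L w) e1)
  rw [e5, coordMap_comp_mfderiv hy', e2, e3]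
  rfl

end Frame

variable [RiemannianBundle (fun x : M => TangentSpace (𝓡∂ m) x)]

lemma gram_eq_of_partialVec_eq_sum {c c' x : M} {P : Matrix (Fin m) (Fin m) ℝ}
    (h : ∀ i, partialVec (m := m) c' x i = ∑ k, P k i • partialVec c x k) :
    gram (m := m) c' x = P.transpose * gram c x * P := by
  ext i j
  simp only [gram, Matrix.of_apply, h, sum_inner, inner_sum, inner_smul_left, inner_smul_right,
    Matrix.mul_apply, Matrix.transpose_apply, Finset.sum_mul, Finset.mul_sum]
  refine Finset.sum_congr rfl fun k _ => Finset.sum_congr rfl fun l _ => ?_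
  simp
  ring

variable [IsManifold (𝓡∂ m) ∞ M]

attribute [local instance] isManifold_one

lemma inner_coordVec {c x : M} (hx : x ∈ (extChartAt (𝓡∂ m) c).source) (w z : Eu m) :
    inner ℝ (coordVec c x w) (coordVec c x z) = ∑ i, ∑ j, w i * z j * gram (m := m) c x i j := by
  rw [coordVec_eq_sum hx, coordVec_eq_sum hx, sum_inner]
  simp only [inner_sum, inner_smul_left, inner_smul_right, gram, Matrix.of_apply]
  refine Finset.sum_congr rfl fun i _ => Finset.sum_congr rfl fun j _ => ?_
  simp
  ring

lemma gram_posDef {c x : M} (hx : x ∈ (extChartAt (𝓡∂ m) c).source) :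
    (gram (m := m) c x).PosDef := by
  refine Matrix.PosDef.of_dotProduct_mulVec_pos ?_ fun w hw => ?_
  · ext i j
    simp [gram, real_inner_comm]
  · have hw' : (WithLp.toLp 2 w : Eu m) ≠ 0 := fun h => hw (by simpa using h)
    have h0 : coordVec c x (WithLp.toLp 2 w : Eu m) ≠ 0 := by
      rw [← coordMap_apply hx]
      intro h
      exact hw' ((coordMap_bijective hx).1 (h.trans (map_zero _).symm))
    have h1 : 0 <
        inner ℝ (coordVec c x (WithLp.toLp 2 w : Eu m)) (coordVec c x (WithLp.toLp 2 w)) :=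
      real_inner_self_pos.2 h0
    rw [inner_coordVec hx] at h1
    refine h1.trans_eq ?_
    simp only [dotProduct, Matrix.mulVec, Finset.mul_sum, star_trivial]
    exact Finset.sum_congr rfl fun i _ => Finset.sum_congr rfl fun j _ => by ring

lemma normSqDiff_eq_sum {n : ℕ} {c x : M} (hx : x ∈ (extChartAt (𝓡∂ m) c).source)
    (A : TangentSpace (𝓡∂ m) x →L[ℝ] EuclideanSpace ℝ (Fin n)) :
    normSqDiff (m := m) x A = ∑ i, ∑ j, (gram (m := m) c x)⁻¹ i j *
      inner ℝ (A (partialVec c x i)) (A (partialVec c x j)) := by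
  choose w hw using fun i => (coordMap_bijective hx).2 (partialVec (m := m) x x i)
  have h : ∀ i, partialVec (m := m) x x i =
      ∑ k, (Matrix.of fun k i => w i k) k i • partialVec c x k := by
    intro i
    rw [← hw i, coordMap_apply hx, coordVec_eq_sum hx]
    rfl
  have := sum_inv_mul_eq_of_congruence (G := gram (m := m) c x)
    (B := Matrix.of fun i j => inner ℝ (A (partialVec c x i)) (A (partialVec c x j)))
    (B' := Matrix.of fun i j => inner ℝ (A (partialVec x x i)) (A (partialVec x x j)))
    (gram_eq_of_partialVec_eq_sum h) (by
      ext i j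
      simp only [Matrix.of_apply, h, map_sum, map_smul, sum_inner, inner_sum, inner_smul_left,
        inner_smul_right, Matrix.mul_apply, Matrix.transpose_apply, Finset.sum_mul,
        Finset.mul_sum]
      refine Finset.sum_congr rfl fun k _ => Finset.sum_congr rfl fun l _ => ?_
      simp
      ring) (gram_posDef (mem_extChartAt_source x)).det_pos.ne'
  simpa [normSqDiff] using this

variable [IsContMDiffRiemannianBundle (𝓡∂ m) ∞ (EuclideanSpace ℝ (Fin m))
      (fun x : M => TangentSpace (𝓡∂ m) x)]

lemma contMDiffOn_gram (c : M) (i j : Fin m) :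
    ContMDiffOn (𝓡∂ m) 𝓘(ℝ, ℝ) ∞ (fun x => gram (m := m) c x i j)
      (extChartAt (𝓡∂ m) c).source := by
  let e := trivializationAt (Eu m) (TangentSpace (𝓡∂ m) : M → Type _) c
  let b := (EuclideanSpace.basisFun (Fin m) ℝ).toBasis
  have h : ∀ i, ContMDiffOn (𝓡∂ m) ((𝓡∂ m).prod 𝓘(ℝ, Eu m)) ∞
      (fun x => (⟨x, e.localFrame b i x⟩ : TotalSpace (Eu m) (TangentSpace (𝓡∂ m) : M → Type _)))
      e.baseSet := fun i => e.contMDiffOn_localFrame_baseSet ∞ b i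
  have h2 := (h i).inner_bundle (h j)
  have hs : e.baseSet = (extChartAt (𝓡∂ m) c).source := by
    ext x; exact mem_baseSet_iff
  rw [hs] at h2
  refine h2.congr fun x hx => ?_
  have h3 : ∀ i, partialVec (m := m) c x i = e.localFrame b i x := by
    intro i
    rw [e.localFrame_apply_of_mem_baseSet b (by rw [hs]; exact hx), partialVec,
      coordVec_eq_symmL hx,
      Trivialization.symmL_apply (R := ℝ) e (mem_baseSet_iff.2 hx)]
    simp [Trivialization.basisAt, b]
  simp [gram, h3]

end ChartLayer

/-! ### The Riemannian volume in a chart -/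

section Volume

variable {m : ℕ} [NeZero m] {M : Type*} [EMetricSpace M] [ChartedSpace (EuclideanHalfSpace m) M]
  [IsManifold (𝓡∂ m) ∞ M]

attribute [local instance] isManifold_one

/-- The density `√det(g_ij)` of the Riemannian volume in the chart around `c`. -/
def volDensity [RiemannianBundle (fun x : M => TangentSpace (𝓡∂ m) x)] (c : M) (y : Eu m) : ℝ :=
  Real.sqrt (gram (m := m) c ((extChartAt (𝓡∂ m) c).symm y)).det

lemma measurableSet_target (c : M) : MeasurableSet (extChartAt (𝓡∂ m) c).target := by
  rw [extChartAt_target]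
  exact ((chartAt _ c).open_target.preimage (𝓡∂ m).continuous_symm).measurableSet.inter
    (𝓡∂ m).isClosed_range.measurableSet

variable [MeasurableSpace M] [BorelSpace M]

lemma measurableEmbedding_restrict_symm (c : M) :
    MeasurableEmbedding ((extChartAt (𝓡∂ m) c).target.domRestrict (extChartAt (𝓡∂ m) c).symm) := by
  let e : (extChartAt (𝓡∂ m) c).target ≃ₜ (extChartAt (𝓡∂ m) c).source :=
    { (extChartAt (𝓡∂ m) c).symm.toEquiv with
      continuous_toFun := (continuousOn_extChartAt_symm c).mapsToRestrict
        fun _ hy => (extChartAt (𝓡∂ m) c).map_target hy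
      continuous_invFun := (continuousOn_extChartAt c).mapsToRestrict
        fun _ hy => (extChartAt (𝓡∂ m) c).map_source hy }
  exact (MeasurableEmbedding.subtype_coe (isOpen_extChartAt_source c).measurableSet).comp
    e.measurableEmbedding

variable [RiemannianBundle (fun x : M => TangentSpace (𝓡∂ m) x)]
  [IsContMDiffRiemannianBundle (𝓡∂ m) ∞ (EuclideanSpace ℝ (Fin m))
      (fun x : M => TangentSpace (𝓡∂ m) x)]

lemma contDiffOn_gram (c : M) (i j : Fin m) :
    ContDiffOn ℝ ∞ (fun y => gram (m := m) c ((extChartAt (𝓡∂ m) c).symm y) i j)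
      (extChartAt (𝓡∂ m) c).target :=
  ((contMDiffOn_gram c i j).comp (contMDiffOn_extChartAt_symm c)
    (fun _ hy => (extChartAt (𝓡∂ m) c).map_target hy)).contDiffOn

lemma contDiffOn_det_gram (c : M) :
    ContDiffOn ℝ ∞ (fun y => (gram (m := m) c ((extChartAt (𝓡∂ m) c).symm y)).det)
      (extChartAt (𝓡∂ m) c).target := by
  simp only [Matrix.det_apply]
  exact ContDiffOn.sum fun σ _ => ContDiffOn.const_smul _
    (contDiffOn_prod fun i _ => contDiffOn_gram c _ _)

lemma det_gram_pos (c : M) {y : Eu m} (hy : y ∈ (extChartAt (𝓡∂ m) c).target) :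
    0 < (gram (m := m) c ((extChartAt (𝓡∂ m) c).symm y)).det :=
  (gram_posDef ((extChartAt (𝓡∂ m) c).map_target hy)).det_pos

lemma contDiffOn_volDensity (c : M) :
    ContDiffOn ℝ ∞ (volDensity (m := m) c) (extChartAt (𝓡∂ m) c).target :=
  (contDiffOn_det_gram c).sqrt fun _ hy => (det_gram_pos c hy).ne'

lemma volDensity_pos (c : M) {y : Eu m} (hy : y ∈ (extChartAt (𝓡∂ m) c).target) :
    0 < volDensity (m := m) c y := Real.sqrt_pos.2 (det_gram_pos c hy)

lemma aemeasurable_volDensity (c : M) :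
    AEMeasurable (fun y => ENNReal.ofReal (volDensity (m := m) c y))
      (volume.restrict (extChartAt (𝓡∂ m) c).target) :=
  ((contDiffOn_volDensity c).continuousOn.aemeasurable (measurableSet_target c)).ennreal_ofReal

/-- The chart volume on the chart image. -/
def coordVolume (c : M) : Measure (Eu m) :=
  (volume.restrict (extChartAt (𝓡∂ m) c).target).withDensity fun y =>
    ENNReal.ofReal (volDensity (m := m) c y)

lemma chartVolume_eq (c : M) : chartVolume m c = Measure.map
    ((extChartAt (𝓡∂ m) c).target.domRestrict (extChartAt (𝓡∂ m) c).symm)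
    (Measure.comap Subtype.val (coordVolume (m := m) c)) := by
  have h1 : chartVolume m c = Measure.map (extChartAt (𝓡∂ m) c).symm (coordVolume (m := m) c) := rfl
  have h2 : coordVolume (m := m) c = Measure.map Subtype.val
      (Measure.comap (Subtype.val : (extChartAt (𝓡∂ m) c).target → Eu m) (coordVolume c)) := by
    rw [map_comap_subtype_coe (measurableSet_target c), coordVolume,
      restrict_withDensity (measurableSet_target c),
      Measure.restrict_restrict (measurableSet_target c), inter_self]
  have h3 : AEMeasurable (extChartAt (𝓡∂ m) c).symm (coordVolume (m := m) c) :=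
    ((continuousOn_extChartAt_symm c).aemeasurable (measurableSet_target c)).mono_ac
      (withDensity_absolutelyContinuous _ _)
  rw [h1]
  conv_lhs => rw [h2]
  rw [AEMeasurable.map_map_of_aemeasurable _ measurable_subtype_coe.aemeasurable]
  · rfl
  · rwa [← h2]

lemma image_val_preimage_domRestrict {α γ : Type*} (T : Set α) (f : α → γ) (A : Set γ) :
    Subtype.val '' (T.domRestrict f ⁻¹' A) = T ∩ f ⁻¹' A := by
  ext y
  simp [and_comm]

lemma measurableSet_target_inter (c : M) {A : Set M} (hA : MeasurableSet A) :
    MeasurableSet ((extChartAt (𝓡∂ m) c).target ∩ (extChartAt (𝓡∂ m) c).symm ⁻¹' A) := by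
  have := (MeasurableEmbedding.subtype_coe (measurableSet_target (m := m) c)).measurableSet_image'
    ((measurableEmbedding_restrict_symm (m := m) c).measurable hA)
  rwa [image_val_preimage_domRestrict] at this

lemma chartVolume_apply (c : M) {A : Set M} (hA : MeasurableSet A) :
    chartVolume m c A = ∫⁻ y in (extChartAt (𝓡∂ m) c).target ∩ (extChartAt (𝓡∂ m) c).symm ⁻¹' A,
      ENNReal.ofReal (volDensity (m := m) c y) := by
  rw [chartVolume_eq, Measure.map_apply
    (measurableEmbedding_restrict_symm (m := m) c).measurable hA,
    (MeasurableEmbedding.subtype_coe (measurableSet_target (m := m) c)).comap_apply]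
  rw [image_val_preimage_domRestrict, coordVolume,
    withDensity_apply _ (measurableSet_target_inter c hA),
    Measure.restrict_restrict (measurableSet_target_inter c hA), inter_right_comm, inter_self]

lemma det_eq_det_of_stdVec (A : Eu m →L[ℝ] Eu m) :
    A.det = Matrix.det (Matrix.of fun i j : Fin m => A (stdVec j) i) := by
  rw [ContinuousLinearMap.det,
    ← LinearMap.det_toMatrix (EuclideanSpace.basisFun (Fin m) ℝ).toBasis]
  congr 1

lemma coordVec_transition (c c' : M) {y : Eu m} (hy : y ∈ (extChartAt (𝓡∂ m) c).target)
    (hy' : (extChartAt (𝓡∂ m) c).symm y ∈ (extChartAt (𝓡∂ m) c').source) :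
    DifferentiableWithinAt ℝ
        (fun z => extChartAt (𝓡∂ m) c' ((extChartAt (𝓡∂ m) c).symm z)) (range (𝓡∂ m)) y ∧
    ∀ w : Eu m, coordVec c ((extChartAt (𝓡∂ m) c).symm y) w =
      coordVec c' ((extChartAt (𝓡∂ m) c).symm y) (fderivWithin ℝ
        (fun z => extChartAt (𝓡∂ m) c' ((extChartAt (𝓡∂ m) c).symm z)) (range (𝓡∂ m)) y w) := by
  have h := mfderiv_coordVec (Φ := fun x : M => x) hy mdifferentiableAt_id hy'
  refine ⟨h.1, fun w => ?_⟩
  have h2 := h.2 w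
  have e : mfderiv (𝓡∂ m) (𝓡∂ m) (fun x : M => x) ((extChartAt (𝓡∂ m) c).symm y) =
    ContinuousLinearMap.id ℝ _ := mfderiv_id
  rw [e] at h2
  exact h2

/-- The transformation law of the Riemannian volume density. -/
lemma volDensity_eq_abs_det_mul (c c' : M) {y : Eu m} (hy : y ∈ (extChartAt (𝓡∂ m) c).target)
    (hy' : (extChartAt (𝓡∂ m) c).symm y ∈ (extChartAt (𝓡∂ m) c').source) :
    volDensity (m := m) c y = |(fderivWithin ℝ (fun z => extChartAt (𝓡∂ m) c'
        ((extChartAt (𝓡∂ m) c).symm z)) (range (𝓡∂ m)) y).det| *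
      volDensity (m := m) c' (extChartAt (𝓡∂ m) c' ((extChartAt (𝓡∂ m) c).symm y)) := by
  have h := (coordVec_transition c c' hy hy').2
  set L := fderivWithin ℝ (fun z => extChartAt (𝓡∂ m) c'
        ((extChartAt (𝓡∂ m) c).symm z)) (range (𝓡∂ m)) y
  have hg := gram_eq_of_partialVec_eq_sum (c := c') (c' := c)
    (P := Matrix.of fun i j : Fin m => L (stdVec j) i) (fun i => by
      refine (h (stdVec i)).trans ?_
      rw [coordVec_eq_sum hy']
      rfl)
  rw [volDensity, volDensity, hg, (extChartAt (𝓡∂ m) c').left_inv hy', Matrix.det_mul,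
    Matrix.det_mul, Matrix.det_transpose, ← det_eq_det_of_stdVec, mul_right_comm,
    Real.sqrt_mul (mul_self_nonneg _), Real.sqrt_mul_self_eq_abs]

/-- Chart volumes agree on overlaps of charts: here the inequality, by a change of variables. -/
lemma chartVolume_le (c c' : M) {A : Set M} (hA : MeasurableSet A)
    (hAc : A ⊆ (extChartAt (𝓡∂ m) c).source) : chartVolume m c' A ≤ chartVolume m c A := by
  rw [chartVolume_apply c hA, chartVolume_apply c' hA]
  set τ := fun z => extChartAt (𝓡∂ m) c' ((extChartAt (𝓡∂ m) c).symm z)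
  set S := (extChartAt (𝓡∂ m) c).target ∩
    (extChartAt (𝓡∂ m) c).symm ⁻¹' (A ∩ (extChartAt (𝓡∂ m) c').source)
  have hS : MeasurableSet S := measurableSet_target_inter c
    (hA.inter (isOpen_extChartAt_source c').measurableSet)
  have himg : (extChartAt (𝓡∂ m) c').target ∩ (extChartAt (𝓡∂ m) c').symm ⁻¹' A = τ '' S := by
    ext y
    constructor
    · rintro ⟨hy, hyA⟩
      have h1 := hAc hyA
      have h2 := (extChartAt (𝓡∂ m) c').map_target hy
      refine ⟨extChartAt (𝓡∂ m) c ((extChartAt (𝓡∂ m) c').symm y), ⟨?_, ?_, ?_⟩, ?_⟩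
      · exact (extChartAt (𝓡∂ m) c).map_source h1
      · simpa only [mem_preimage, (extChartAt (𝓡∂ m) c).left_inv h1] using hyA
      · simpa only [(extChartAt (𝓡∂ m) c).left_inv h1] using h2
      · simp only [τ, (extChartAt (𝓡∂ m) c).left_inv h1, (extChartAt (𝓡∂ m) c').right_inv hy]
    · rintro ⟨z, ⟨hz, hzA, hz'⟩, rfl⟩
      refine ⟨(extChartAt (𝓡∂ m) c').map_source hz', ?_⟩
      simpa only [mem_preimage, τ, (extChartAt (𝓡∂ m) c').left_inv hz'] using hzA
  rw [himg, lintegral_image_eq_lintegral_abs_det_fderiv_mul volume hS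
    (f' := fun y => fderivWithin ℝ τ (range (𝓡∂ m)) y)]
  · calc _ = ∫⁻ y in S, ENNReal.ofReal (volDensity (m := m) c y) := by
          refine setLIntegral_congr_fun hS fun y hy => ?_
          simp only [τ, volDensity_eq_abs_det_mul c c' hy.1 hy.2.2,
            ENNReal.ofReal_mul (abs_nonneg _)]
      _ ≤ _ := lintegral_mono_set (inter_subset_inter_right _ (preimage_mono inter_subset_left))
  · intro y hy
    exact ((coordVec_transition c c' hy.1 hy.2.2).1.hasFDerivWithinAt).mono
      (fun z hz => extChartAt_target_subset_range c hz.1)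
  · intro y hy z hz h
    have := (extChartAt (𝓡∂ m) c').injOn hy.2.2 hz.2.2 h
    exact (extChartAt (𝓡∂ m) c).symm.injOn hy.1 hz.1 this

/-- On a chart domain the Riemannian volume, a supremum of measures, is the chart volume. -/
lemma riemVolume_restrict (c : M) : (riemVolume m M).restrict (extChartAt (𝓡∂ m) c).source =
    chartVolume m c := by
  have hS : MeasurableSet (extChartAt (𝓡∂ m) c).source :=
    (isOpen_extChartAt_source c).measurableSet
  have h0 : (chartVolume m c).restrict (extChartAt (𝓡∂ m) c).source = chartVolume m c := by
    ext A hA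
    rw [Measure.restrict_apply hA, chartVolume_apply c (hA.inter hS), chartVolume_apply c hA]
    congr 2
    ext y
    simp only [mem_inter_iff, mem_preimage, and_congr_right_iff, and_iff_left_iff_imp]
    exact fun hy _ => (extChartAt (𝓡∂ m) c).map_target hy
  apply le_antisymm
  · have hle : riemVolume m M ≤ chartVolume m c +
        (riemVolume m M).restrict (extChartAt (𝓡∂ m) c).sourceᶜ := by
      refine iSup_le fun c' => ?_
      have hc' : chartVolume m c' ≤ riemVolume m M := le_iSup (fun c => chartVolume m c) c'
      rw [← Measure.restrict_add_restrict_compl (μ := chartVolume m c') hS]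
      refine add_le_add (Measure.le_iff.2 fun A hA => ?_) (Measure.restrict_mono subset_rfl hc')
      rw [Measure.restrict_apply hA]
      exact (chartVolume_le c c' (hA.inter hS) inter_subset_right).trans
        (measure_mono inter_subset_left)
    refine (Measure.restrict_mono subset_rfl hle).trans ?_
    rw [Measure.restrict_add, h0, Measure.restrict_restrict hS, inter_compl_self,
      Measure.restrict_empty, add_zero]
  · conv_lhs => rw [← h0]
    exact Measure.restrict_mono subset_rfl (le_iSup (fun c => chartVolume m c) c)

lemma restrict_riemVolume_eq_map (c : M) {S : Set M} (hS : MeasurableSet S)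
    (hSc : S ⊆ (extChartAt (𝓡∂ m) c).source) :
    (riemVolume m M).restrict S = Measure.map
      ((extChartAt (𝓡∂ m) c).target.domRestrict (extChartAt (𝓡∂ m) c).symm)
      (Measure.comap Subtype.val ((coordVolume (m := m) c).restrict
        ((extChartAt (𝓡∂ m) c).target ∩ (extChartAt (𝓡∂ m) c).symm ⁻¹' S))) := by
  have h1 : (riemVolume m M).restrict S = (chartVolume m c).restrict S := by
    rw [← riemVolume_restrict c, Measure.restrict_restrict hS, inter_eq_self_of_subset_left hSc]
  have he := MeasurableEmbedding.subtype_coe (measurableSet_target (m := m) c)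
  rw [h1, chartVolume_eq, (measurableEmbedding_restrict_symm (m := m) c).restrict_map]
  congr 1
  rw [he.restrict_comap, image_val_preimage_domRestrict]

lemma restrict_coordVolume (c : M) {S : Set M} (hS : MeasurableSet S) :
    (coordVolume (m := m) c).restrict
      ((extChartAt (𝓡∂ m) c).target ∩ (extChartAt (𝓡∂ m) c).symm ⁻¹' S) =
    (volume.restrict ((extChartAt (𝓡∂ m) c).target ∩
      (extChartAt (𝓡∂ m) c).symm ⁻¹' S)).withDensity
        fun y => ENNReal.ofReal (volDensity (m := m) c y) := by
  rw [coordVolume, restrict_withDensity (measurableSet_target_inter c hS),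
    Measure.restrict_restrict (measurableSet_target_inter c hS), inter_right_comm, inter_self]

lemma aemeasurable_volDensity_inter (c : M) (S : Set M) :
    AEMeasurable (fun y => ENNReal.ofReal (volDensity (m := m) c y))
      (volume.restrict ((extChartAt (𝓡∂ m) c).target ∩ (extChartAt (𝓡∂ m) c).symm ⁻¹' S)) :=
  (aemeasurable_volDensity c).mono_measure (Measure.restrict_mono inter_subset_left le_rfl)

lemma toReal_volDensity (c : M) (y : Eu m) :
    (ENNReal.ofReal (volDensity (m := m) c y)).toReal = volDensity (m := m) c y :=
  ENNReal.toReal_ofReal (Real.sqrt_nonneg _)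

/-- Integrals over subsets of a chart domain, in coordinates; `h` need not be measurable. -/
lemma setIntegral_riemVolume (c : M) {S : Set M} (hS : MeasurableSet S)
    (hSc : S ⊆ (extChartAt (𝓡∂ m) c).source) (h : M → ℝ) :
    ∫ x in S, h x ∂(riemVolume m M) =
      ∫ y in (extChartAt (𝓡∂ m) c).target ∩ (extChartAt (𝓡∂ m) c).symm ⁻¹' S,
        volDensity (m := m) c y * h ((extChartAt (𝓡∂ m) c).symm y) := by
  have he := MeasurableEmbedding.subtype_coe (measurableSet_target (m := m) c)
  rw [restrict_riemVolume_eq_map c hS hSc, (measurableEmbedding_restrict_symm c).integral_map]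
  have h1 : ∀ ν : Measure (Eu m), ∫ y, h ((extChartAt (𝓡∂ m) c).target.domRestrict
      (extChartAt (𝓡∂ m) c).symm y) ∂(Measure.comap Subtype.val ν) =
      ∫ y in (extChartAt (𝓡∂ m) c).target, h ((extChartAt (𝓡∂ m) c).symm y) ∂ν := fun ν => by
    rw [← map_comap_subtype_coe (measurableSet_target (m := m) c), he.integral_map]
    rfl
  rw [h1, Measure.restrict_restrict (measurableSet_target c), ← inter_assoc, inter_self,
    restrict_coordVolume c hS, integral_withDensity_eq_integral_toReal_smul₀
      (aemeasurable_volDensity_inter c S) (by simp)]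
  simp only [toReal_volDensity, smul_eq_mul]

lemma integrableOn_riemVolume_iff (c : M) {S : Set M} (hS : MeasurableSet S)
    (hSc : S ⊆ (extChartAt (𝓡∂ m) c).source) (h : M → ℝ) :
    IntegrableOn h S (riemVolume m M) ↔
      IntegrableOn (fun y => volDensity (m := m) c y * h ((extChartAt (𝓡∂ m) c).symm y))
        ((extChartAt (𝓡∂ m) c).target ∩ (extChartAt (𝓡∂ m) c).symm ⁻¹' S) := by
  have he := MeasurableEmbedding.subtype_coe (measurableSet_target (m := m) c)
  rw [IntegrableOn, restrict_riemVolume_eq_map c hS hSc,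
    (measurableEmbedding_restrict_symm c).integrable_map_iff]
  have h1 : ∀ ν : Measure (Eu m), Integrable (h ∘ ((extChartAt (𝓡∂ m) c).target.domRestrict
      (extChartAt (𝓡∂ m) c).symm)) (Measure.comap Subtype.val ν) ↔
      Integrable (fun y => h ((extChartAt (𝓡∂ m) c).symm y))
        (ν.restrict (extChartAt (𝓡∂ m) c).target) := fun ν => by
    rw [← map_comap_subtype_coe (measurableSet_target (m := m) c), he.integrable_map_iff]
    rfl
  rw [h1, Measure.restrict_restrict (measurableSet_target c), ← inter_assoc, inter_self,
    restrict_coordVolume c hS, integrable_withDensity_iff_integrable_smul₀'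
      (aemeasurable_volDensity_inter c S) (by simp)]
  simp only [toReal_volDensity, smul_eq_mul, IntegrableOn]

end Volume

/-! ### Weak differentials of compositions with diffeomorphisms -/

section WeakComp

variable {m n : ℕ} [NeZero m] {M : Type*} [EMetricSpace M] [ChartedSpace (EuclideanHalfSpace m) M]
  [IsManifold (𝓡∂ m) ∞ M]

attribute [local instance] isManifold_one

lemma range_modelHalfSpace : range (𝓡∂ m) = {y : Eu m | 0 ≤ y 0} :=
  range_euclideanHalfSpace m

lemma mem_interior_target_of_pos {c : M} {y : Eu m} (hy : y ∈ (extChartAt (𝓡∂ m) c).target)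
    (h0 : 0 < y 0) : y ∈ interior (extChartAt (𝓡∂ m) c).target := by
  rw [mem_interior_iff_mem_nhds, extChartAt_target]
  rw [extChartAt_target] at hy
  refine Filter.inter_mem
    (((chartAt _ c).open_target.preimage (𝓡∂ m).continuous_symm).mem_nhds hy.1) ?_
  rw [range_modelHalfSpace, ← mem_interior_iff_mem_nhds]
  have := interior_halfSpace 2 (0 : ℝ) (0 : Fin m)
  exact this.symm ▸ h0

lemma range_mem_nhds_of_mem_interior_target {c : M} {y : Eu m}
    (hy : y ∈ interior (extChartAt (𝓡∂ m) c).target) : range (𝓡∂ m) ∈ 𝓝 y :=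
  Filter.mem_of_superset (mem_interior_iff_mem_nhds.1 hy) (extChartAt_target_subset_range c)

lemma volume_coord_zero : volume {y : Eu m | y 0 = 0} = 0 := by
  have h : {y : Eu m | y 0 = 0} =
      (LinearMap.ker (EuclideanSpace.proj (𝕜 := ℝ) (0 : Fin m) : Eu m →L[ℝ] ℝ).toLinearMap :
        Set (Eu m)) := by
    ext y
    simp
  rw [h]
  apply Measure.addHaar_submodule
  intro htop
  have : (stdVec 0 : Eu m) ∈
      LinearMap.ker (EuclideanSpace.proj (𝕜 := ℝ) (0 : Fin m) : Eu m →L[ℝ] ℝ).toLinearMap := by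
    rw [htop]; trivial
  simp at this

lemma ae_mem_interior_target (c : M) :
    ∀ᵐ y : Eu m, y ∈ (extChartAt (𝓡∂ m) c).target → y ∈ interior (extChartAt (𝓡∂ m) c).target := by
  have h : ∀ᵐ y : Eu m, y 0 ≠ 0 := by
    rw [ae_iff]
    simpa using volume_coord_zero (m := m)
  filter_upwards [h] with y hy hyT
  refine mem_interior_target_of_pos hyT (lt_of_le_of_ne ?_ hy.symm)
  have := extChartAt_target_subset_range c hyT
  rw [range_modelHalfSpace] at this
  exact this

lemma hasWeakDifferential_iff {v : M → Eu n}
    {Dv : (x : M) → TangentSpace (𝓡∂ m) x →L[ℝ] EuclideanSpace ℝ (Fin n)} :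
    HasWeakDifferential v Dv ↔ ∀ c : M, HasWeakGradOn (interior (extChartAt (𝓡∂ m) c).target)
      (fun y => v ((extChartAt (𝓡∂ m) c).symm y))
      (fun i y => Dv ((extChartAt (𝓡∂ m) c).symm y)
        (partialVec c ((extChartAt (𝓡∂ m) c).symm y) i)) := Iff.rfl

lemma hasWeakDifferential_weakDifferential {v : M → Eu n}
    (h : ∃ Dv, HasWeakDifferential (m := m) v Dv) :
    HasWeakDifferential (m := m) v (weakDifferential v) := by
  rw [weakDifferential, dif_pos h]
  exact h.choose_spec

lemma isInteriorPoint_iff_mem_interior_target {c x : M} (hx : x ∈ (extChartAt (𝓡∂ m) c).source) :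
    (𝓡∂ m).IsInteriorPoint x ↔
      extChartAt (𝓡∂ m) c x ∈ interior (extChartAt (𝓡∂ m) c).target :=
  (𝓡∂ m).isInteriorPoint_iff_of_mem_atlas (n := ∞) (by simp) (chart_mem_atlas _ c)
    (by simpa using hx)

/-- A diffeomorphism, read in two charts, restricts to a Euclidean diffeomorphism between open
sets. -/
lemma isDiffeoOn_chart (Φ : M ≃ₘ^∞⟮𝓡∂ m, 𝓡∂ m⟯ M) (c q : M) :
    IsDiffeoOn
      (interior (extChartAt (𝓡∂ m) c).target ∩
        (extChartAt (𝓡∂ m) c).symm ⁻¹' (Φ ⁻¹' (extChartAt (𝓡∂ m) q).source))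
      (interior (extChartAt (𝓡∂ m) q).target ∩
        (extChartAt (𝓡∂ m) q).symm ⁻¹' (Φ.symm ⁻¹' (extChartAt (𝓡∂ m) c).source))
      (fun z => extChartAt (𝓡∂ m) q (Φ ((extChartAt (𝓡∂ m) c).symm z)))
      (fun z => extChartAt (𝓡∂ m) c (Φ.symm ((extChartAt (𝓡∂ m) q).symm z))) := by
  have key : ∀ (Φ : M ≃ₘ^∞⟮𝓡∂ m, 𝓡∂ m⟯ M) (c q : M),
      IsOpen (interior (extChartAt (𝓡∂ m) c).target ∩
        (extChartAt (𝓡∂ m) c).symm ⁻¹' (Φ ⁻¹' (extChartAt (𝓡∂ m) q).source)) ∧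
      ContDiffOn ℝ ∞ (fun z => extChartAt (𝓡∂ m) q (Φ ((extChartAt (𝓡∂ m) c).symm z)))
        (interior (extChartAt (𝓡∂ m) c).target ∩
        (extChartAt (𝓡∂ m) c).symm ⁻¹' (Φ ⁻¹' (extChartAt (𝓡∂ m) q).source)) ∧
      MapsTo (fun z => extChartAt (𝓡∂ m) q (Φ ((extChartAt (𝓡∂ m) c).symm z)))
        (interior (extChartAt (𝓡∂ m) c).target ∩
          (extChartAt (𝓡∂ m) c).symm ⁻¹' (Φ ⁻¹' (extChartAt (𝓡∂ m) q).source))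
        (interior (extChartAt (𝓡∂ m) q).target ∩
          (extChartAt (𝓡∂ m) q).symm ⁻¹' (Φ.symm ⁻¹' (extChartAt (𝓡∂ m) c).source)) ∧
      ∀ z ∈ (interior (extChartAt (𝓡∂ m) c).target ∩
          (extChartAt (𝓡∂ m) c).symm ⁻¹' (Φ ⁻¹' (extChartAt (𝓡∂ m) q).source)),
        extChartAt (𝓡∂ m) c (Φ.symm ((extChartAt (𝓡∂ m) q).symm
          (extChartAt (𝓡∂ m) q (Φ ((extChartAt (𝓡∂ m) c).symm z))))) = z := by
    intro Φ c q
    refine ⟨?_, ?_, ?_, ?_⟩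
    · exact ((continuousOn_extChartAt_symm c).mono interior_subset).isOpen_inter_preimage
        isOpen_interior ((isOpen_extChartAt_source q).preimage Φ.continuous)
    · have h1 := (contMDiffOn_extChartAt_symm (I := 𝓡∂ m) (n := ∞) c).mono interior_subset
      have h2 := (Φ.contMDiff.comp_contMDiffOn h1)
      exact ((contMDiffOn_extChartAt (I := 𝓡∂ m) (n := ∞) (x := q)).comp
        (h2.mono inter_subset_left) (fun z hz => by simpa using hz.2)).contDiffOn
    · rintro z ⟨hz, hz'⟩
      have hzT := interior_subset hz
      refine ⟨?_, ?_⟩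
      · rw [← isInteriorPoint_iff_mem_interior_target hz']
        have h1 : (𝓡∂ m).IsInteriorPoint ((extChartAt (𝓡∂ m) c).symm z) := by
          rw [isInteriorPoint_iff_mem_interior_target ((extChartAt (𝓡∂ m) c).map_target hzT),
            (extChartAt (𝓡∂ m) c).right_inv hzT]
          exact hz
        have := Φ.preimage_interior (n := ∞) (by simp)
        exact this.symm.subset h1
      · simp only [mem_preimage, (extChartAt (𝓡∂ m) q).left_inv hz', Φ.symm_apply_apply]
        exact (extChartAt (𝓡∂ m) c).map_target hzT
    · rintro z ⟨hz, hz'⟩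
      rw [(extChartAt (𝓡∂ m) q).left_inv hz', Φ.symm_apply_apply,
        (extChartAt (𝓡∂ m) c).right_inv (interior_subset hz)]
  obtain ⟨a1, a2, a3, a4⟩ := key Φ c q
  obtain ⟨b1, b2, b3, b4⟩ := key Φ.symm q c
  exact ⟨a1, b1, a2, b2, a3, b3, a4, b4⟩

/-- The chain rule `D(v ∘ Φ) = Dv ∘ dΦ` for weak differentials and diffeomorphisms. -/
lemma HasWeakDifferential.comp_diffeomorph {v : M → Eu n}
    {Dv : (x : M) → TangentSpace (𝓡∂ m) x →L[ℝ] EuclideanSpace ℝ (Fin n)}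
    (h : HasWeakDifferential v Dv) (Φ : M ≃ₘ^∞⟮𝓡∂ m, 𝓡∂ m⟯ M) :
    HasWeakDifferential (fun x => v (Φ x))
      (fun x => (Dv (Φ x)).comp (mfderiv (𝓡∂ m) (𝓡∂ m) Φ x)) := by
  rw [hasWeakDifferential_iff] at h ⊢
  intro c
  refine hasWeakGradOn_of_locally fun z hz => ?_
  set q := Φ ((extChartAt (𝓡∂ m) c).symm z)
  have hD := isDiffeoOn_chart Φ c q
  refine ⟨_, hD.isOpen_source, ⟨hz, mem_extChartAt_source q⟩, ?_⟩
  refine (hD.hasWeakGradOn_comp ((h q).mono inter_subset_left)).congr hD.isOpen_source ?_ ?_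
  · rintro y ⟨hy, hy'⟩
    simp only [(extChartAt (𝓡∂ m) q).left_inv hy']
  · rintro i y ⟨hy, hy'⟩
    have hyT := interior_subset hy
    have hΦ : MDifferentiableAt (𝓡∂ m) (𝓡∂ m) Φ ((extChartAt (𝓡∂ m) c).symm y) :=
      Φ.contMDiff.mdifferentiable (by simp) _
    have h2 := (mfderiv_coordVec hyT hΦ hy').2 (stdVec i)
    rw [fderivWithin_of_mem_nhds (range_mem_nhds_of_mem_interior_target hy)] at h2
    have e : ∀ x, x = Φ ((extChartAt (𝓡∂ m) c).symm y) → ∀ j,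
        Dv x (partialVec q x j) = Dv (Φ ((extChartAt (𝓡∂ m) c).symm y))
          (partialVec q (Φ ((extChartAt (𝓡∂ m) c).symm y)) j) := by
      rintro x rfl j
      rfl
    simp only [e _ ((extChartAt (𝓡∂ m) q).left_inv hy')]
    rw [ContinuousLinearMap.comp_apply]
    refine Eq.trans ?_ (congrArg (Dv (Φ ((extChartAt (𝓡∂ m) c).symm y))) h2).symm
    rw [coordVec_eq_sum hy', map_sum]
    simp only [map_smul]

/-- The chain rule for the chosen weak differentials, in the coordinates of a single chart. The
exceptional null set contains the boundary points, where weak differentials are not determined. -/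
lemma weakDifferential_comp_ae {v : M → Eu n} (h : ∃ Dv, HasWeakDifferential (m := m) v Dv)
    (Φ : M ≃ₘ^∞⟮𝓡∂ m, 𝓡∂ m⟯ M) (c : M) (i : Fin m) :
    ∀ᵐ y, y ∈ (extChartAt (𝓡∂ m) c).target →
      Φ ((extChartAt (𝓡∂ m) c).symm y) ∈ (extChartAt (𝓡∂ m) c).source →
      weakDifferential (fun x => v (Φ x)) ((extChartAt (𝓡∂ m) c).symm y)
        (partialVec c ((extChartAt (𝓡∂ m) c).symm y) i) =
      ∑ j, (fderivWithin ℝ (fun z => extChartAt (𝓡∂ m) c (Φ ((extChartAt (𝓡∂ m) c).symm z)))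
          (range (𝓡∂ m)) y (stdVec i)) j •
        weakDifferential v (Φ ((extChartAt (𝓡∂ m) c).symm y))
          (partialVec (m := m) c (Φ ((extChartAt (𝓡∂ m) c).symm y)) j) := by
  have h1 := (hasWeakDifferential_weakDifferential h).comp_diffeomorph Φ
  have h2 := hasWeakDifferential_weakDifferential ⟨_, h1⟩
  have h3 := HasWeakGradOn.ae_eq isOpen_interior (hasWeakDifferential_iff.1 h2 c)
    (hasWeakDifferential_iff.1 h1 c) i
  filter_upwards [h3, ae_mem_interior_target c] with y hy hyi hyT hy'
  rw [hy (hyi hyT), ContinuousLinearMap.comp_apply]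
  have hΦ : MDifferentiableAt (𝓡∂ m) (𝓡∂ m) Φ ((extChartAt (𝓡∂ m) c).symm y) :=
    Φ.contMDiff.mdifferentiable (by simp) _
  have h4 := (mfderiv_coordVec hyT hΦ hy').2 (stdVec i)
  refine Eq.trans (congrArg (weakDifferential v (Φ ((extChartAt (𝓡∂ m) c).symm y))) h4) ?_
  rw [coordVec_eq_sum hy', map_sum]
  simp only [map_smul]

end WeakComp

/-! ### Diffeomorphisms supported in a chart -/

section Perturb

variable {E : Type*} [NormedAddCommGroup E] [NormedSpace ℝ E] [FiniteDimensional ℝ E]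

/-- Small compactly supported smooth perturbations of the identity of a vector space are
diffeomorphisms: they are bijective as Lipschitz perturbations of the identity, and the inverse is
smooth by the inverse function theorem. -/
lemma exists_contDiff_inverse {ξ : E → E} (hξ : ContDiff ℝ ∞ ξ) (hc : HasCompactSupport ξ) :
    ∃ ε > 0, ∀ σ : ℝ, |σ| ≤ ε → ∃ e : E ≃ E, (∀ y, e y = y + σ • ξ y) ∧ ContDiff ℝ ∞ e.symm := by
  obtain ⟨L, hL⟩ := ContDiff.lipschitzWith_of_hasCompactSupport hc hξ (by simp)
  refine ⟨1 / (2 * (L + 1)), by positivity, fun σ hσ => ?_⟩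
  set c : NNReal := ‖σ‖₊ * L with hcdef
  have hcc : (c : ℝ) = |σ| * L := by rw [hcdef, NNReal.coe_mul]; rfl
  have hc1 : (c : ℝ) ≤ 1 / 2 := by
    rw [hcc]
    calc |σ| * L ≤ 1 / (2 * (L + 1)) * L := by gcongr
      _ ≤ 1 / 2 := by
        rw [div_mul_eq_mul_div, div_le_div_iff₀ (by positivity) (by positivity)]
        nlinarith [L.2]
  have hF : ContDiff ℝ ∞ fun y => y + σ • ξ y := contDiff_id.add (hξ.const_smul σ)
  have happ : ApproximatesLinearOn (fun y => y + σ • ξ y)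
      ((ContinuousLinearEquiv.refl ℝ E : E ≃L[ℝ] E) : E →L[ℝ] E) univ c := by
    intro x _ y _
    simp only [ContinuousLinearEquiv.coe_refl, ContinuousLinearMap.coe_id', id]
    have : x + σ • ξ x - (y + σ • ξ y) - (x - y) = σ • (ξ x - ξ y) := by
      rw [smul_sub]; abel
    rw [this, norm_smul, Real.norm_eq_abs]
    have h := hL.dist_le_mul x y
    rw [dist_eq_norm, dist_eq_norm] at h
    calc |σ| * ‖ξ x - ξ y‖ ≤ |σ| * (L * ‖x - y‖) := by gcongr
      _ = c * ‖x - y‖ := by rw [hcc]; ring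
  have hN : Subsingleton E ∨
      c < ‖((ContinuousLinearEquiv.refl ℝ E).symm : E →L[ℝ] E)‖₊⁻¹ := by
    rcases subsingleton_or_nontrivial E with h | h
    · exact Or.inl h
    · right
      have : ‖((ContinuousLinearEquiv.refl ℝ E).symm : E →L[ℝ] E)‖₊ = 1 := by
        simp [ContinuousLinearMap.nnnorm_id]
      rw [this, inv_one, ← NNReal.coe_lt_coe]
      push_cast
      linarith
  let e := happ.toHomeomorph _ hN
  refine ⟨e.toEquiv, fun y => rfl, ?_⟩
  have hinj : ∀ a : E, Function.Injective (fderiv ℝ (fun y => y + σ • ξ y) a) := by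
    intro a
    rw [injective_iff_map_eq_zero]
    intro w hw
    have h1 : HasFDerivAt (fun y => y + σ • ξ y)
        (ContinuousLinearMap.id ℝ E + σ • fderiv ℝ ξ a) a :=
      (hasFDerivAt_id a).add (((hξ.differentiable (by simp)) a).hasFDerivAt.const_smul σ)
    rw [h1.fderiv] at hw
    simp only [add_apply, ContinuousLinearMap.coe_id', id,
      smul_apply] at hw
    have h2 : ‖fderiv ℝ ξ a‖ ≤ L := norm_fderiv_le_of_lipschitz ℝ hL
    have h3 : w = - (σ • fderiv ℝ ξ a w) := eq_neg_of_add_eq_zero_left hw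
    have h4 : ‖w‖ ≤ c * ‖w‖ := by
      calc ‖w‖ = |σ| * ‖fderiv ℝ ξ a w‖ := by
            conv_lhs => rw [h3]
            rw [norm_neg, norm_smul, Real.norm_eq_abs]
        _ ≤ |σ| * (L * ‖w‖) := by
            gcongr
            exact (ContinuousLinearMap.le_opNorm _ _).trans (by gcongr)
        _ = c * ‖w‖ := by rw [hcc]; ring
    have : ‖w‖ ≤ 0 := by nlinarith [norm_nonneg w]
    exact norm_le_zero_iff.1 this
  let f' : E → E ≃L[ℝ] E := fun a =>
    (LinearEquiv.ofInjectiveEndo (fderiv ℝ (fun y => y + σ • ξ y) a).toLinearMap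
      (hinj a)).toContinuousLinearEquiv
  exact Homeomorph.contDiff_symm e (f₀' := f') (fun a => by
    have : ((f' a : E ≃L[ℝ] E) : E →L[ℝ] E) = fderiv ℝ (fun y => y + σ • ξ y) a := by
      ext w; rfl
    rw [this]
    exact ((hF.differentiable (by simp)) a).hasFDerivAt) hF

end Perturb

section Lift

variable {m : ℕ} [NeZero m] {M : Type*} [EMetricSpace M] [ChartedSpace (EuclideanHalfSpace m) M]

open Classical in
/-- The self-map of `M` which is `g` in the chart around `c` and the identity off the domain of
that chart. -/
def chartLift (c : M) (g : Eu m → Eu m) (x : M) : M :=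
  if x ∈ (extChartAt (𝓡∂ m) c).source then
    (extChartAt (𝓡∂ m) c).symm (g (extChartAt (𝓡∂ m) c x)) else x

lemma chartLift_symm {c : M} {g : Eu m → Eu m} {y : Eu m}
    (hy : y ∈ (extChartAt (𝓡∂ m) c).target) :
    chartLift c g ((extChartAt (𝓡∂ m) c).symm y) = (extChartAt (𝓡∂ m) c).symm (g y) := by
  rw [chartLift, if_pos ((extChartAt (𝓡∂ m) c).map_target hy), (extChartAt (𝓡∂ m) c).right_inv hy]

lemma chartLift_of_notMem_image {c : M} {Z : Set (Eu m)} {g : Eu m → Eu m}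
    (hg : ∀ y ∉ Z, g y = y) {x : M}
    (hx : x ∉ (extChartAt (𝓡∂ m) c).symm '' (Z ∩ {y | 0 ≤ y 0})) : chartLift c g x = x := by
  rw [chartLift]
  split_ifs with h
  · have hT := (extChartAt (𝓡∂ m) c).map_source h
    rw [hg, (extChartAt (𝓡∂ m) c).left_inv h]
    intro hZ
    refine hx ⟨_, ⟨hZ, ?_⟩, (extChartAt (𝓡∂ m) c).left_inv h⟩
    have := extChartAt_target_subset_range c hT
    rwa [range_modelHalfSpace] at this
  · rfl

lemma chartLift_comp {c : M} {g h : Eu m → Eu m}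
    (hT : MapsTo h (extChartAt (𝓡∂ m) c).target (extChartAt (𝓡∂ m) c).target)
    (hgh : ∀ y, g (h y) = y) (x : M) : chartLift c g (chartLift c h x) = x := by
  by_cases hx : x ∈ (extChartAt (𝓡∂ m) c).source
  · obtain ⟨y, hy, rfl⟩ : ∃ y ∈ (extChartAt (𝓡∂ m) c).target, (extChartAt (𝓡∂ m) c).symm y = x :=
      ⟨_, (extChartAt (𝓡∂ m) c).map_source hx, (extChartAt (𝓡∂ m) c).left_inv hx⟩
    rw [chartLift_symm hy, chartLift_symm (hT hy), hgh]
  · have : chartLift c h x = x := if_neg hx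
    rw [this]
    exact if_neg hx

variable [IsManifold (𝓡∂ m) ∞ M]

/-- Smoothness of the extension by the identity: `M` is covered by the chart domain and the
complement of the closed set `(extChartAt c).symm '' (Z ∩ {y | 0 ≤ y 0})`. -/
lemma contMDiff_chartLift_family {c : M} {Z : Set (Eu m)} (hZ : IsCompact Z)
    (hZT : Z ∩ {y | 0 ≤ y 0} ⊆ (extChartAt (𝓡∂ m) c).target) {G : ℝ → Eu m → Eu m}
    (hG : ContDiff ℝ ∞ fun p : ℝ × Eu m => G p.1 p.2) (hid : ∀ s, ∀ y ∉ Z, G s y = y)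
    (hT : ∀ s, MapsTo (G s) (extChartAt (𝓡∂ m) c).target (extChartAt (𝓡∂ m) c).target) :
    ContMDiff (𝓘(ℝ, ℝ).prod (𝓡∂ m)) (𝓡∂ m) ∞ fun p : ℝ × M => chartLift c (G p.1) p.2 := by
  rintro ⟨s, x⟩
  by_cases hx : x ∈ (extChartAt (𝓡∂ m) c).source
  · have hO : IsOpen (univ ×ˢ (extChartAt (𝓡∂ m) c).source : Set (ℝ × M)) :=
      isOpen_univ.prod (isOpen_extChartAt_source c)
    have h1 : ContMDiffOn (𝓘(ℝ, ℝ).prod (𝓡∂ m)) 𝓘(ℝ, ℝ × Eu m) ∞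
        (fun p : ℝ × M => (p.1, extChartAt (𝓡∂ m) c p.2))
        (univ ×ˢ (extChartAt (𝓡∂ m) c).source) := by
      refine ContMDiffOn.prodMk_space contMDiff_fst.contMDiffOn ?_
      exact (contMDiffOn_extChartAt (I := 𝓡∂ m) (n := ∞) (x := c)).comp
        contMDiff_snd.contMDiffOn (fun p hp => by simpa using hp.2)
    have h2 := hG.contMDiff.comp_contMDiffOn h1
    have h3 := (contMDiffOn_extChartAt_symm (I := 𝓡∂ m) (n := ∞) c).comp h2
      (fun p hp => hT _ ((extChartAt (𝓡∂ m) c).map_source hp.2))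
    have h4 := h3.contMDiffAt (hO.mem_nhds (x := (s, x)) ⟨trivial, hx⟩)
    refine h4.congr_of_eventuallyEq ?_
    filter_upwards [hO.mem_nhds (x := (s, x)) ⟨trivial, hx⟩] with p hp
    exact if_pos hp.2
  · have hK : IsClosed ((extChartAt (𝓡∂ m) c).symm '' (Z ∩ {y | 0 ≤ y 0})) := by
      have hc : IsClosed {y : Eu m | 0 ≤ y 0} :=
        isClosed_le continuous_const (EuclideanSpace.proj (𝕜 := ℝ) (0 : Fin m)).continuous
      exact ((hZ.inter_right hc).image_of_continuousOn
        ((continuousOn_extChartAt_symm c).mono hZT)).isClosed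
    have hO : IsOpen (univ ×ˢ ((extChartAt (𝓡∂ m) c).symm '' (Z ∩ {y | 0 ≤ y 0}))ᶜ : Set (ℝ × M)) :=
      isOpen_univ.prod hK.isOpen_compl
    have hmem : (s, x) ∈
        (univ ×ˢ ((extChartAt (𝓡∂ m) c).symm '' (Z ∩ {y | 0 ≤ y 0}))ᶜ : Set (ℝ × M)) := by
      refine ⟨trivial, ?_⟩
      rintro ⟨y, hy, rfl⟩
      exact hx ((extChartAt (𝓡∂ m) c).map_target (hZT hy))
    refine (contMDiff_snd.contMDiffAt (x := (s, x))).congr_of_eventuallyEq ?_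
    filter_upwards [hO.mem_nhds hmem] with p hp
    exact chartLift_of_notMem_image (hid p.1) hp.2

lemma contMDiff_chartLift {c : M} {Z : Set (Eu m)} (hZ : IsCompact Z)
    (hZT : Z ∩ {y | 0 ≤ y 0} ⊆ (extChartAt (𝓡∂ m) c).target) {g : Eu m → Eu m}
    (hg : ContDiff ℝ ∞ g) (hid : ∀ y ∉ Z, g y = y)
    (hT : MapsTo g (extChartAt (𝓡∂ m) c).target (extChartAt (𝓡∂ m) c).target) :
    ContMDiff (𝓡∂ m) (𝓡∂ m) ∞ (chartLift c g) := by
  have h := contMDiff_chartLift_family hZ hZT (G := fun _ => g) (hg.comp contDiff_snd)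
    (fun _ => hid) (fun _ => hT)
  exact h.comp ((contMDiff_const (c := (0 : ℝ))).prodMk contMDiff_id)

/-- The flow-like family generated by a smooth vector field `ξ` supported in a chart: a smooth
family of diffeomorphisms which in the chart is `y ↦ y + σ(s) ξ(y)`, where the reparametrisation `σ`
keeps the perturbation small for all times. By `hpres` the perturbation preserves the half space,
either because `ξ` is tangent to its boundary or because its support lies inside. -/
lemma exists_diffeomorph_family {c : M} {Z : Set (Eu m)} (hZ : IsCompact Z)
    (hZT : Z ∩ {y | 0 ≤ y 0} ⊆ (extChartAt (𝓡∂ m) c).target) {ξ : Eu m → Eu m}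
    (hξ : ContDiff ℝ ∞ ξ) (hsupp : ∀ y ∉ Z, ξ y = 0)
    (hpres : (∃ ε > 0, ∀ σ : ℝ, |σ| ≤ ε → ∀ y ∈ Z, 0 ≤ (y + σ • ξ y) 0 ↔ 0 ≤ y 0) ∨
      Z ⊆ {y | 0 ≤ y 0}) :
    ∃ (Φ : ℝ → (M ≃ₘ^∞⟮𝓡∂ m, 𝓡∂ m⟯ M)) (σ : ℝ → ℝ),
      ContMDiff (𝓘(ℝ, ℝ).prod (𝓡∂ m)) (𝓡∂ m) ∞ (fun q : ℝ × M => Φ q.1 q.2) ∧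
      (∀ x, Φ 0 x = x) ∧
      (∀ s, ∀ x ∉ (extChartAt (𝓡∂ m) c).symm '' (Z ∩ {y | 0 ≤ y 0}), Φ s x = x) ∧
      HasDerivAt σ 1 0 ∧ σ 0 = 0 ∧
      (∀ s, ∀ y ∈ (extChartAt (𝓡∂ m) c).target, y + σ s • ξ y ∈ (extChartAt (𝓡∂ m) c).target ∧
        Φ s ((extChartAt (𝓡∂ m) c).symm y) = (extChartAt (𝓡∂ m) c).symm (y + σ s • ξ y)) ∧
      (∀ s, Function.Injective fun y => y + σ s • ξ y) ∧
      ∀ s, (fun y => y + σ s • ξ y) '' (Z ∩ {y | 0 ≤ y 0}) = Z ∩ {y | 0 ≤ y 0} := by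
  have hcs : HasCompactSupport ξ := HasCompactSupport.intro hZ hsupp
  obtain ⟨ε₁, hε₁, h1⟩ := exists_contDiff_inverse hξ hcs
  obtain ⟨ε₂, hε₂, h2⟩ : ∃ ε > 0, (∀ σ : ℝ, |σ| ≤ ε → ∀ y ∈ Z, 0 ≤ (y + σ • ξ y) 0 ↔ 0 ≤ y 0) ∨
      Z ⊆ {y | 0 ≤ y 0} := by
    rcases hpres with ⟨ε, hε, h⟩ | h
    · exact ⟨ε, hε, Or.inl h⟩
    · exact ⟨1, one_pos, Or.inr h⟩
  set ε := min ε₁ ε₂ with hε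
  have hε0 : 0 < ε := lt_min hε₁ hε₂
  -- a smooth function with `σ 0 = 0` and derivative `1` at `0` that is bounded by `ε`
  let σ : ℝ → ℝ := fun s => ε * Real.sin (s / ε)
  have hσ : ∀ s, |σ s| ≤ ε := fun s => by
    rw [abs_mul, abs_of_pos hε0]
    nlinarith [Real.abs_sin_le_one (s / ε)]
  choose e he hes using fun s => h1 (σ s) ((hσ s).trans (min_le_left _ _))
  have heid : ∀ s, ∀ y ∉ Z, e s y = y := fun s y hy => by rw [he, hsupp y hy]; simp
  have heZ : ∀ s y, e s y ∈ Z ↔ y ∈ Z := fun s y => by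
    constructor
    · intro h
      by_contra hy
      rw [heid s y hy] at h
      exact hy h
    · intro h
      by_contra hy
      have := (e s).injective (heid s _ hy)
      rw [this] at hy
      exact hy h
  have heH : ∀ s y, 0 ≤ (e s y) 0 ↔ 0 ≤ y 0 := fun s y => by
    by_cases hy : y ∈ Z
    · rcases h2 with h2 | h2
      · rw [he]
        exact h2 _ ((hσ s).trans (min_le_right _ _)) y hy
      · exact iff_of_true (h2 ((heZ s y).2 hy)) (h2 hy)
    · rw [heid s y hy]
  have hsid : ∀ s, ∀ y ∉ Z, (e s).symm y = y := fun s y hy => by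
    rw [Equiv.symm_apply_eq, heid s y hy]
  have hTr : ∀ y ∈ (extChartAt (𝓡∂ m) c).target, 0 ≤ y 0 := fun y hy => by
    have := extChartAt_target_subset_range c hy
    rwa [range_modelHalfSpace] at this
  have heT : ∀ s, MapsTo (e s) (extChartAt (𝓡∂ m) c).target (extChartAt (𝓡∂ m) c).target := by
    intro s y hy
    by_cases hyZ : y ∈ Z
    · exact hZT ⟨(heZ s y).2 hyZ, (heH s y).2 (hTr y hy)⟩
    · rwa [heid s y hyZ]
  have hesT : ∀ s, MapsTo (e s).symm (extChartAt (𝓡∂ m) c).target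
      (extChartAt (𝓡∂ m) c).target := by
    intro s y hy
    by_cases hyZ : y ∈ Z
    · refine hZT ⟨?_, ?_⟩
      · rw [← heZ s, Equiv.apply_symm_apply]; exact hyZ
      · change 0 ≤ ((e s).symm y) 0
        rw [← heH s, Equiv.apply_symm_apply]; exact hTr y hy
    · rwa [hsid s y hyZ]
  have heC : ContDiff ℝ ∞ fun p : ℝ × Eu m => e p.1 p.2 := by
    simp only [he]
    refine contDiff_snd.add (ContDiff.fun_smul ?_ (hξ.comp contDiff_snd))
    exact contDiff_const.mul (Real.contDiff_sin.comp (contDiff_fst.div_const _))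
  let Φ : ℝ → (M ≃ₘ^∞⟮𝓡∂ m, 𝓡∂ m⟯ M) := fun s =>
    { toFun := chartLift c (e s)
      invFun := chartLift c (e s).symm
      left_inv := chartLift_comp (heT s) (e s).symm_apply_apply
      right_inv := chartLift_comp (hesT s) (e s).apply_symm_apply
      contMDiff_toFun := contMDiff_chartLift hZ hZT
        (heC.comp (contDiff_const.prodMk contDiff_id)) (heid s) (heT s)
      contMDiff_invFun := contMDiff_chartLift hZ hZT (hes s) (hsid s) (hesT s) }
  refine ⟨Φ, σ, contMDiff_chartLift_family hZ hZT (G := fun s => e s) heC heid heT, ?_, ?_, ?_, ?_,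
    ?_, ?_, ?_⟩
  · intro x
    refine (chartLift_of_notMem_image (Z := ∅) (fun y _ => ?_) (by simp) : chartLift c (e 0) x = x)
    rw [he]
    simp [σ]
  · intro s x hx
    exact chartLift_of_notMem_image (heid s) hx
  · have h := ((Real.hasDerivAt_sin (0 / ε)).comp 0
      ((hasDerivAt_id (0 : ℝ)).div_const ε)).const_mul ε
    simpa [σ, hε0.ne'] using h
  · simp [σ]
  · intro s y hy
    rw [← he]
    exact ⟨heT s hy, chartLift_symm hy⟩
  · intro s
    have : (fun y => y + σ s • ξ y) = e s := by ext1 y; exact (he s y).symm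
    rw [this]
    exact (e s).injective
  · intro s
    have : (fun y => y + σ s • ξ y) = e s := by ext1 y; exact (he s y).symm
    rw [this]
    ext y
    constructor
    · rintro ⟨z, ⟨hz, hz0⟩, rfl⟩
      exact ⟨(heZ s z).2 hz, (heH s z).2 hz0⟩
    · rintro ⟨hz, hz0⟩
      refine ⟨(e s).symm y, ⟨?_, ?_⟩, (e s).apply_symm_apply y⟩
      · rw [← heZ s, Equiv.apply_symm_apply]; exact hz
      · change 0 ≤ ((e s).symm y) 0
        rw [← heH s, Equiv.apply_symm_apply]; exact hz0

end Lift

/-! ### Pointwise effect of a radial inner variation -/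

section Scalar

lemma exp_sub_two_mul_sq_le {u : ℝ} (hu : |u| ≤ 1 / 2) : Real.exp (u - 2 * u ^ 2) ≤ 1 + u := by
  have h := abs_le.1 hu
  have hpos : 0 < 1 + u := by linarith
  rw [← Real.le_log_iff_exp_le hpos]
  refine le_trans ?_ (Real.one_sub_inv_le_log_of_pos hpos)
  have e : 1 - (1 + u)⁻¹ = u / (1 + u) := by field_simp; ring
  rw [e, le_div_iff₀ hpos]
  nlinarith [sq_nonneg u, mul_nonneg (sq_nonneg u) (by linarith : (0 : ℝ) ≤ 1 + 2 * u)]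

/-- Second order expansion of the distortion factors of a radial variation, uniformly in the value
`φ` of the cutoff and in `τ`, which stands for minus the radial derivative of the cutoff. On the
left are the growth of the weight and the distortion of the quadratic form, on the right the
Jacobian determinant; the coefficient of `s` in the last factor is what remains of them. -/
lemma exists_distortion_bound (m : ℕ) {K κ C₀ c₁ c₂ c₃ : ℝ} (hK : 0 ≤ K) (hC₀ : 0 ≤ C₀)
    (hc₁ : 0 ≤ c₁) (hc₂ : 0 ≤ c₂) (hc₃ : 0 ≤ c₃) :
    ∃ s₀ > 0, ∃ C ≥ 0, s₀ ≤ 1 ∧ ∀ s φ τ : ℝ, 0 ≤ s → s ≤ s₀ → 0 ≤ φ → φ ≤ 1 → 0 ≤ τ → τ ≤ K →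
      0 < 1 - 2 * s * τ / (1 + s * φ) ∧
      Real.exp (κ * (s * φ) + C₀ * s ^ 2) *
          ((1 + s * φ) ^ 2 * (1 + s * (c₁ * φ + c₂ * τ) + c₃ * s ^ 2)) ≤
        (1 + s * φ) ^ m * (1 - 2 * s * τ / (1 + s * φ)) *
          (1 + s * (-(m - 2 - κ - c₁) * φ + (2 + c₂) * τ) + C * s ^ 2) := by
  set bb : ℝ := |(m : ℝ) - 2 - κ - c₁| + (2 + c₂) * K with hbb
  set C₁ : ℝ := C₀ + c₃ + 2 * m + 8 * K ^ 2 with hC₁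
  have hbb0 : 0 ≤ bb := by positivity
  have hC₁0 : 0 ≤ C₁ := by positivity
  refine ⟨min (1 / 2) (min (1 / (4 * K + 1)) (1 / (bb + C₁ + 1))), by positivity,
    C₁ + (bb + C₁) ^ 2, by positivity, (min_le_left _ _).trans (by norm_num), ?_⟩
  intro s φ τ hs hs₀ hφ hφ1 hτ hτK
  have hs1 : s ≤ 1 / 2 := hs₀.trans (min_le_left _ _)
  have hs2 : s * (4 * K + 1) ≤ 1 := by
    rw [← le_div_iff₀ (by positivity)]
    exact hs₀.trans ((min_le_right _ _).trans (min_le_left _ _))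
  have hs3 : s * (bb + C₁ + 1) ≤ 1 := by
    rw [← le_div_iff₀ (by positivity)]
    exact hs₀.trans ((min_le_right _ _).trans (min_le_right _ _))
  have hsφ : 0 ≤ s * φ := by positivity
  have hsφ1 : s * φ ≤ s := mul_le_of_le_one_right hs hφ1
  have hsτ : 0 ≤ s * τ := by positivity
  have hsτK : s * τ ≤ s * K := by gcongr
  have hl : 1 ≤ 1 + s * φ := by linarith
  have hd : 1 - 2 * (s * τ) ≤ 1 - 2 * s * τ / (1 + s * φ) := by
    have : 2 * s * τ / (1 + s * φ) ≤ 2 * s * τ := div_le_self (by positivity) hl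
    linarith
  have hd0 : 0 < 1 - 2 * s * τ / (1 + s * φ) := by linarith
  refine ⟨hd0, ?_⟩
  -- every factor is compared with an exponential, so that the exponents can be added
  have e1 : Real.exp (m * (s * φ - 2 * s ^ 2)) ≤ (1 + s * φ) ^ m := by
    rw [Real.exp_nat_mul]
    gcongr
    refine le_trans (Real.exp_le_exp.2 ?_)
      (exp_sub_two_mul_sq_le (u := s * φ) (by rw [abs_of_nonneg hsφ]; linarith))
    have : (s * φ) ^ 2 ≤ s ^ 2 := by gcongr
    linarith
  have e2 : Real.exp (-(2 * (s * τ)) - 8 * K ^ 2 * s ^ 2) ≤ 1 - 2 * s * τ / (1 + s * φ) := by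
    refine le_trans ?_ hd
    refine le_trans (Real.exp_le_exp.2 ?_) (le_trans (exp_sub_two_mul_sq_le (u := -(2 * (s * τ)))
      (by rw [abs_neg, abs_of_nonneg (by positivity)]; linarith)) (by linarith))
    have : (s * τ) ^ 2 ≤ (s * K) ^ 2 := by gcongr
    have h2 : (s * K) ^ 2 = K ^ 2 * s ^ 2 := by ring
    have h3 : (-(2 * (s * τ))) ^ 2 = 4 * (s * τ) ^ 2 := by ring
    rw [h3]
    linarith
  have e3 : (1 + s * φ) ^ 2 ≤ Real.exp (2 * (s * φ)) := by
    have h2 : Real.exp (2 * (s * φ)) = Real.exp (s * φ) ^ 2 := by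
      rw [← Real.exp_nat_mul]; norm_num
    rw [h2]
    gcongr
    linarith [Real.add_one_le_exp (s * φ)]
  have e4 : 1 + s * (c₁ * φ + c₂ * τ) + c₃ * s ^ 2 ≤
      Real.exp (s * (c₁ * φ + c₂ * τ) + c₃ * s ^ 2) := by
    linarith [Real.add_one_le_exp (s * (c₁ * φ + c₂ * τ) + c₃ * s ^ 2)]
  set b : ℝ := -(m - 2 - κ - c₁) * φ + (2 + c₂) * τ with hb
  have hbabs : |b| ≤ bb := by
    refine (abs_add_le _ _).trans ?_
    rw [hbb, abs_mul, abs_neg, abs_of_nonneg hφ, abs_of_nonneg (by positivity : 0 ≤ (2 + c₂) * τ)]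
    gcongr
    exact mul_le_of_le_one_right (abs_nonneg _) hφ1
  have e5 : Real.exp (s * b + C₁ * s ^ 2) ≤ 1 + s * b + (C₁ + (bb + C₁) ^ 2) * s ^ 2 := by
    have hx : |s * b + C₁ * s ^ 2| ≤ s * (bb + C₁) := by
      refine (abs_add_le _ _).trans ?_
      rw [abs_mul, abs_of_nonneg hs, abs_of_nonneg (by positivity : 0 ≤ C₁ * s ^ 2)]
      have h1 : s * |b| ≤ s * bb := by gcongr
      have h2 : C₁ * s ^ 2 ≤ C₁ * s := by
        gcongr
        exact pow_le_of_le_one hs (by linarith) two_ne_zero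
      linarith
    have h1 := Real.abs_exp_sub_one_sub_id_le (hx.trans (by linarith))
    have h2 : (s * b + C₁ * s ^ 2) ^ 2 ≤ (s * (bb + C₁)) ^ 2 :=
      sq_le_sq' (abs_le.1 hx).1 (abs_le.1 hx).2
    have h3 := (abs_le.1 h1).2
    have h4 : (s * (bb + C₁)) ^ 2 = (bb + C₁) ^ 2 * s ^ 2 := by ring
    rw [h4] at h2
    have h5 := add_mul C₁ ((bb + C₁) ^ 2) (s ^ 2)
    rw [h5]
    linarith
  calc _ ≤ Real.exp (κ * (s * φ) + C₀ * s ^ 2) * (Real.exp (2 * (s * φ)) *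
        Real.exp (s * (c₁ * φ + c₂ * τ) + c₃ * s ^ 2)) := by
        gcongr
    _ = Real.exp (m * (s * φ - 2 * s ^ 2)) * Real.exp (-(2 * (s * τ)) - 8 * K ^ 2 * s ^ 2) *
        Real.exp (s * b + C₁ * s ^ 2) := by
        simp only [← Real.exp_add]
        congr 1
        rw [hb, hC₁]
        ring
    _ ≤ _ := by
        gcongr

end Scalar

/-! ### Cutoff functions -/

section Cutoff

/-- A smooth nonincreasing cutoff on the line, equal to `1` on `(-∞, 1/4]` and to `0` on
`[1, ∞)`. -/
def cutoff (τ : ℝ) : ℝ := 1 - Real.smoothTransition ((4 * τ - 1) / 3)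

lemma contDiff_cutoff : ContDiff ℝ ∞ cutoff :=
  contDiff_const.sub ((Real.smoothTransition.contDiff (n := ⊤)).comp
    (((contDiff_const.mul contDiff_id).sub contDiff_const).div_const _))

lemma cutoff_nonneg (τ : ℝ) : 0 ≤ cutoff τ := sub_nonneg.2 (Real.smoothTransition.le_one _)

lemma cutoff_le_one (τ : ℝ) : cutoff τ ≤ 1 := sub_le_self _ (Real.smoothTransition.nonneg _)

lemma cutoff_eq_one {τ : ℝ} (h : τ ≤ 1 / 4) : cutoff τ = 1 := by
  rw [cutoff, Real.smoothTransition.zero_of_nonpos (by linarith), sub_zero]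

lemma cutoff_eq_zero {τ : ℝ} (h : 1 ≤ τ) : cutoff τ = 0 := by
  rw [cutoff, Real.smoothTransition.one_of_one_le (by linarith), sub_self]

lemma antitone_cutoff : Antitone cutoff := fun a b h =>
  sub_le_sub_left (Real.smoothTransition.monotone (by linarith)) _

lemma differentiable_cutoff : Differentiable ℝ cutoff := contDiff_cutoff.differentiable (by simp)

lemma deriv_cutoff_nonpos (τ : ℝ) : deriv cutoff τ ≤ 0 := antitone_cutoff.deriv_nonpos

lemma deriv_cutoff_eq_zero_of_le {τ : ℝ} (h : τ ≤ 1 / 4) : deriv cutoff τ = 0 := by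
  have hmax : IsLocalMax cutoff τ := by
    refine Filter.Eventually.of_forall fun x => ?_
    rw [cutoff_eq_one h]
    exact cutoff_le_one x
  exact hmax.deriv_eq_zero

lemma deriv_cutoff_eq_zero_of_ge {τ : ℝ} (h : 1 ≤ τ) : deriv cutoff τ = 0 := by
  have hmin : IsLocalMin cutoff τ := by
    refine Filter.Eventually.of_forall fun x => ?_
    rw [cutoff_eq_zero h]
    exact cutoff_nonneg x
  exact hmin.deriv_eq_zero

lemma contDiff_deriv_cutoff : ContDiff ℝ ∞ (deriv cutoff) :=
  (contDiff_infty_iff_deriv.1 contDiff_cutoff).2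

lemma exists_deriv_cutoff_bound : ∃ K > 0, ∀ τ, |deriv cutoff τ| ≤ K := by
  have hcs : HasCompactSupport (deriv cutoff) := by
    refine HasCompactSupport.intro (K := Icc (1 / 4) 1) isCompact_Icc fun x hx => ?_
    rw [mem_Icc, not_and_or, not_le, not_le] at hx
    rcases hx with h | h
    · exact deriv_cutoff_eq_zero_of_le h.le
    · exact deriv_cutoff_eq_zero_of_ge h.le
  obtain ⟨C, hC⟩ := hcs.exists_bound_of_continuous contDiff_deriv_cutoff.continuous
  exact ⟨|C| + 1, by positivity, fun τ => (hC τ).trans ((le_abs_self C).trans (by linarith))⟩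

end Cutoff

/-! ### Elliptic coefficients -/

section Coeff

variable {m : ℕ}

/-- `A` is a field of uniformly elliptic symmetric operators on `D` with Lipschitz coefficients; all
the constants are controlled by `Λ`. -/
structure IsEllipticOn (D : Set (Eu m)) (A : Eu m → Eu m →L[ℝ] Eu m) (Λ : ℝ) : Prop where
  one_le : 1 ≤ Λ
  symm : ∀ x ∈ D, ∀ u w, inner ℝ (A x u) w = inner ℝ u (A x w)
  lower : ∀ x ∈ D, ∀ u, ‖u‖ ^ 2 ≤ Λ * inner ℝ (A x u) u
  norm_le : ∀ x ∈ D, ‖A x‖ ≤ Λ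
  lip : ∀ x ∈ D, ∀ y ∈ D, ‖A x - A y‖ ≤ Λ * ‖x - y‖

variable {D : Set (Eu m)} {A : Eu m → Eu m →L[ℝ] Eu m} {Λ : ℝ}

lemma IsEllipticOn.inner_nonneg (h : IsEllipticOn D A Λ) {x : Eu m} (hx : x ∈ D) (u : Eu m) :
    0 ≤ inner ℝ (A x u) u := by
  have h1 := h.lower x hx u
  have h2 := h.one_le
  by_contra h3
  push Not at h3
  nlinarith [sq_nonneg ‖u‖]

/-- `Q` is a symmetric inverse of `B`. For `B` the coefficient operator at a point `x₀`, the
quadratic form of `Q` defines the ellipsoids about `x₀` which are adapted to the coefficients. -/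
structure IsSymmInverse (B Q : Eu m →L[ℝ] Eu m) : Prop where
  apply_apply : ∀ u, B (Q u) = u
  symm : ∀ u w, inner ℝ (Q u) w = inner ℝ u (Q w)

lemma IsEllipticOn.exists_symmInverse (h : IsEllipticOn D A Λ) {x : Eu m} (hx : x ∈ D) :
    ∃ Q, IsSymmInverse (A x) Q := by
  have hinj : Function.Injective (A x) := by
    rw [injective_iff_map_eq_zero]
    intro u hu
    have := h.lower x hx u
    rw [hu, inner_zero_left, mul_zero] at this
    have : ‖u‖ = 0 := by nlinarith [norm_nonneg u]
    exact norm_eq_zero.1 this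
  let e := LinearEquiv.ofInjectiveEndo (A x).toLinearMap hinj
  have he : ∀ u, A x (e.symm u) = u := fun u => e.apply_symm_apply u
  refine ⟨(e.symm.toContinuousLinearEquiv : Eu m →L[ℝ] Eu m), he, fun u w => ?_⟩
  change inner ℝ (e.symm u) w = inner ℝ u (e.symm w)
  conv_lhs => rw [← he w]
  conv_rhs => rw [← he u]
  exact (h.symm x hx _ _).symm

lemma IsEllipticOn.norm_symmInverse_le (h : IsEllipticOn D A Λ) {x : Eu m} (hx : x ∈ D)
    {Q : Eu m →L[ℝ] Eu m} (hQ : IsSymmInverse (A x) Q) (u : Eu m) : ‖Q u‖ ≤ Λ * ‖u‖ := by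
  have h1 := h.lower x hx (Q u)
  rw [hQ.apply_apply] at h1
  have h2 := real_inner_le_norm u (Q u)
  have h3 := h.one_le
  rcases (norm_nonneg (Q u)).eq_or_lt with h0 | h0
  · rw [← h0]; positivity
  · have : ‖Q u‖ * ‖Q u‖ ≤ (Λ * ‖u‖) * ‖Q u‖ := by nlinarith
    exact le_of_mul_le_mul_right this h0

lemma IsEllipticOn.sq_norm_le_symmInverse (h : IsEllipticOn D A Λ) {x : Eu m} (hx : x ∈ D)
    {Q : Eu m →L[ℝ] Eu m} (hQ : IsSymmInverse (A x) Q) (u : Eu m) :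
    ‖u‖ ^ 2 ≤ Λ ^ 3 * inner ℝ (Q u) u := by
  have h1 := h.lower x hx (Q u)
  rw [hQ.apply_apply, real_inner_comm] at h1
  have h3 := h.one_le
  have h4 : ‖u‖ ≤ Λ * ‖Q u‖ := by
    conv_lhs => rw [← hQ.apply_apply u]
    exact (ContinuousLinearMap.le_opNorm _ _).trans
      (mul_le_mul_of_nonneg_right (h.norm_le x hx) (norm_nonneg _))
  calc ‖u‖ ^ 2 ≤ (Λ * ‖Q u‖) ^ 2 := by gcongr
    _ = Λ ^ 2 * ‖Q u‖ ^ 2 := by ring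
    _ ≤ Λ ^ 2 * (Λ * inner ℝ (Q u) u) := by gcongr
    _ = _ := by ring

lemma IsEllipticOn.symmInverse_le (h : IsEllipticOn D A Λ) {x : Eu m} (hx : x ∈ D)
    {Q : Eu m →L[ℝ] Eu m} (hQ : IsSymmInverse (A x) Q) (u : Eu m) :
    inner ℝ (Q u) u ≤ Λ * ‖u‖ ^ 2 := by
  have h1 := real_inner_le_norm (Q u) u
  have h2 := h.norm_symmInverse_le hx hQ u
  nlinarith [norm_nonneg u]

/-- The effect of a radial variation on the quadratic form of the coefficients: the adjoint of the
differential of `x ↦ x + s η(x) (x - x₀)` is `p ↦ (1 + s η) p + s ⟨x - x₀, p⟩ ∇η`. Since `∇η` is a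
nonpositive multiple of `Q (x - x₀)` and `A x₀ Q = 1`, the leading part of the cross term has a
sign. -/
lemma IsEllipticOn.variation_le (h : IsEllipticOn D A Λ) {x₀ x y : Eu m} (hx₀ : x₀ ∈ D)
    (hx : x ∈ D) (hy : y ∈ D) {Q : Eu m →L[ℝ] Eu m} (hQ : IsSymmInverse (A x₀) Q)
    {s η c ℓ : ℝ} (hs : 0 ≤ s) (hη : 0 ≤ η) (hc : c ≤ 0)
    (hℓ : ‖x - x₀‖ ≤ ℓ) (hxy : y = x + (s * η) • (x - x₀)) {g : Eu m} (hg : g = c • Q (x - x₀))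
    (p : Eu m) :
    inner ℝ (A x ((1 + s * η) • p + (s * inner ℝ (x - x₀) p) • g))
        ((1 + s * η) • p + (s * inner ℝ (x - x₀) p) • g) ≤
      (1 + s * η) ^ 2 * (1 + s * (Λ ^ 2 * ℓ * η + 2 * Λ ^ 2 * ℓ ^ 2 * ‖g‖) +
        s ^ 2 * (Λ ^ 2 * ℓ ^ 2 * ‖g‖ ^ 2)) * inner ℝ (A y p) p := by
  set X := x - x₀ with hX
  set l := 1 + s * η with hl
  have hsη : 0 ≤ s * η := mul_nonneg hs hη
  have hl1 : 1 ≤ l := by linarith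
  have hΛ := h.one_le
  have hℓ0 : 0 ≤ ℓ := (norm_nonneg _).trans hℓ
  have expand : inner ℝ (A x (l • p + (s * inner ℝ X p) • g)) (l • p + (s * inner ℝ X p) • g) =
      l ^ 2 * inner ℝ (A x p) p + 2 * s * l * inner ℝ X p * inner ℝ (A x g) p +
        s ^ 2 * inner ℝ X p ^ 2 * inner ℝ (A x g) g := by
    have : inner ℝ (A x p) g = inner ℝ (A x g) p := by
      rw [h.symm x hx, real_inner_comm]
    simp only [map_add, map_smul, inner_add_left, inner_add_right, real_inner_smul_left,
      real_inner_smul_right, this]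
    ring
  rw [expand]
  set N := inner ℝ (A y p) p with hN
  have hN0 : 0 ≤ N := h.inner_nonneg hy p
  have hpN : ‖p‖ ^ 2 ≤ Λ * N := h.lower y hy p
  have hXp : |inner ℝ X p| ≤ ℓ * ‖p‖ := (abs_real_inner_le_norm X p).trans (by gcongr)
  have b1 : inner ℝ (A x p) p ≤ N + Λ * (s * η * ℓ) * ‖p‖ ^ 2 := by
    have h1 : inner ℝ (A x p) p = N + inner ℝ ((A x - A y) p) p := by
      rw [hN, sub_apply, inner_sub_left]; ring
    have h2 : inner ℝ ((A x - A y) p) p ≤ Λ * (s * η * ℓ) * ‖p‖ * ‖p‖ := by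
      refine (real_inner_le_norm _ _).trans ?_
      gcongr
      refine (ContinuousLinearMap.le_opNorm _ _).trans ?_
      gcongr
      refine (h.lip x hx y hy).trans ?_
      gcongr
      have : x - y = -((s * η) • X) := by rw [hxy]; abel
      rw [this, norm_neg, norm_smul, Real.norm_eq_abs, abs_of_nonneg hsη]
      gcongr
    rw [h1, pow_two]
    linarith
  have b2 : inner ℝ X p * inner ℝ (A x g) p ≤ Λ * ℓ ^ 2 * ‖g‖ * ‖p‖ ^ 2 := by
    have h1 : inner ℝ (A x g) p = inner ℝ ((A x - A x₀) g) p + c * inner ℝ X p := by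
      have : A x g = (A x - A x₀) g + c • X := by
        rw [sub_apply]
        have : A x₀ g = c • X := by rw [hg, map_smul, hQ.apply_apply]
        rw [this]; abel
      rw [this, inner_add_left, real_inner_smul_left]
    have h2 : |inner ℝ ((A x - A x₀) g) p| ≤ Λ * ℓ * ‖g‖ * ‖p‖ := by
      refine (abs_real_inner_le_norm _ _).trans ?_
      gcongr
      refine (ContinuousLinearMap.le_opNorm _ _).trans ?_
      gcongr
      exact (h.lip x hx x₀ hx₀).trans (by gcongr)
    rw [h1, mul_add]
    have h3 : inner ℝ X p * inner ℝ ((A x - A x₀) g) p ≤ (ℓ * ‖p‖) * (Λ * ℓ * ‖g‖ * ‖p‖) := by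
      refine (le_abs_self _).trans ?_
      rw [abs_mul]
      gcongr
    have h4 : inner ℝ X p * (c * inner ℝ X p) ≤ 0 := by
      rw [mul_left_comm, ← pow_two]
      exact mul_nonpos_of_nonpos_of_nonneg hc (sq_nonneg _)
    calc _ ≤ ℓ * ‖p‖ * (Λ * ℓ * ‖g‖ * ‖p‖) + 0 := add_le_add h3 h4
      _ = _ := by ring
  have b3 : inner ℝ X p ^ 2 * inner ℝ (A x g) g ≤ (ℓ * ‖p‖) ^ 2 * (Λ * ‖g‖ ^ 2) := by
    have h1 : inner ℝ (A x g) g ≤ Λ * ‖g‖ ^ 2 := by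
      refine (real_inner_le_norm _ _).trans ?_
      rw [pow_two, ← mul_assoc]
      gcongr
      exact (ContinuousLinearMap.le_opNorm _ _).trans (by gcongr; exact h.norm_le x hx)
    have h2 : inner ℝ X p ^ 2 ≤ (ℓ * ‖p‖) ^ 2 := sq_le_sq' (abs_le.1 hXp).1 (abs_le.1 hXp).2
    have := h.inner_nonneg hx g
    gcongr
  have hG := norm_nonneg g
  have t1 : l ^ 2 * inner ℝ (A x p) p ≤ l ^ 2 * (1 + s * (Λ ^ 2 * ℓ * η)) * N := by
    have : inner ℝ (A x p) p ≤ (1 + s * (Λ ^ 2 * ℓ * η)) * N := by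
      refine b1.trans ?_
      have : Λ * (s * η * ℓ) * ‖p‖ ^ 2 ≤ Λ * (s * η * ℓ) * (Λ * N) := by gcongr
      calc _ ≤ N + Λ * (s * η * ℓ) * (Λ * N) := add_le_add_right this _
        _ = _ := by ring
    rw [mul_assoc]
    gcongr
  have t2 : 2 * s * l * inner ℝ X p * inner ℝ (A x g) p ≤
      l ^ 2 * (s * (2 * Λ ^ 2 * ℓ ^ 2 * ‖g‖)) * N := by
    calc 2 * s * l * inner ℝ X p * inner ℝ (A x g) p
        = 2 * s * l * (inner ℝ X p * inner ℝ (A x g) p) := by ring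
      _ ≤ 2 * s * l * (Λ * ℓ ^ 2 * ‖g‖ * ‖p‖ ^ 2) := by gcongr
      _ ≤ 2 * s * l * (Λ * ℓ ^ 2 * ‖g‖ * (Λ * N)) := by gcongr
      _ ≤ 2 * s * l ^ 2 * (Λ * ℓ ^ 2 * ‖g‖ * (Λ * N)) := by
          gcongr
          exact le_self_pow₀ hl1 two_ne_zero
      _ = _ := by ring
  have t3 : s ^ 2 * inner ℝ X p ^ 2 * inner ℝ (A x g) g ≤
      l ^ 2 * (s ^ 2 * (Λ ^ 2 * ℓ ^ 2 * ‖g‖ ^ 2)) * N := by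
    calc s ^ 2 * inner ℝ X p ^ 2 * inner ℝ (A x g) g
        = s ^ 2 * (inner ℝ X p ^ 2 * inner ℝ (A x g) g) := by ring
      _ ≤ s ^ 2 * ((ℓ * ‖p‖) ^ 2 * (Λ * ‖g‖ ^ 2)) := by gcongr
      _ = s ^ 2 * (ℓ ^ 2 * (Λ * ‖g‖ ^ 2)) * ‖p‖ ^ 2 := by ring
      _ ≤ s ^ 2 * (ℓ ^ 2 * (Λ * ‖g‖ ^ 2)) * (Λ * N) := by gcongr
      _ = 1 * (s ^ 2 * (Λ ^ 2 * ℓ ^ 2 * ‖g‖ ^ 2)) * N := by ring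
      _ ≤ _ := by
          gcongr
          exact one_le_pow₀ hl1
  calc _ ≤ _ := add_le_add (add_le_add t1 t2) t3
    _ = _ := by ring

end Coeff

/-! ### The first variation inequality for radial fields -/

section EllipForm

variable {m : ℕ} {D : Set (Eu m)} {A : Eu m → Eu m →L[ℝ] Eu m} {Λ : ℝ}
  {Q : Eu m →L[ℝ] Eu m} {x₀ : Eu m} {r : ℝ}

/-- The quadratic form of `Q` at `y - x₀`, in units of `r²`. -/
def ellipForm (Q : Eu m →L[ℝ] Eu m) (x₀ : Eu m) (r : ℝ) (y : Eu m) : ℝ :=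
  inner ℝ (Q (y - x₀)) (y - x₀) / r ^ 2

/-- The radial field `y - x₀`, cut off outside of the ellipsoid `ellipForm Q x₀ r ≤ 1`. -/
def radialField (Q : Eu m →L[ℝ] Eu m) (x₀ : Eu m) (r : ℝ) (y : Eu m) : Eu m :=
  cutoff (ellipForm Q x₀ r y) • (y - x₀)

lemma contDiff_ellipForm : ContDiff ℝ ∞ (ellipForm Q x₀ r) := by
  unfold ellipForm
  exact ((Q.contDiff.comp (contDiff_id.sub contDiff_const)).inner ℝ
    (contDiff_id.sub contDiff_const)).div_const _

lemma contDiff_radialField : ContDiff ℝ ∞ (radialField Q x₀ r) :=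
  ContDiff.fun_smul (contDiff_cutoff.comp contDiff_ellipForm) (contDiff_id.sub contDiff_const)

lemma hasFDerivAt_ellipForm {B : Eu m →L[ℝ] Eu m} (hQ : IsSymmInverse B Q) (y : Eu m) :
    HasFDerivAt (ellipForm Q x₀ r) ((2 / r ^ 2) • innerSL ℝ (Q (y - x₀))) y := by
  have h1 : HasFDerivAt (fun y => y - x₀) (ContinuousLinearMap.id ℝ (Eu m)) y :=
    (hasFDerivAt_id y).sub_const x₀
  have h2 : HasFDerivAt (fun y => Q (y - x₀)) (Q.comp (ContinuousLinearMap.id ℝ (Eu m))) y :=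
    Q.hasFDerivAt.comp y h1
  have h3 := (h2.inner ℝ h1).mul_const (r ^ 2)⁻¹
  refine (h3.congr_fderiv ?_).congr_of_eventuallyEq (Filter.Eventually.of_forall fun z => ?_)
  · ext w
    simp only [smul_apply, ContinuousLinearMap.comp_apply, ContinuousLinearMap.prod_apply,
      ContinuousLinearMap.coe_id', id, fderivInnerCLM_apply, hQ.symm w, innerSL_apply_apply,
      smul_eq_mul, real_inner_comm w]
    ring
  · rw [ellipForm, div_eq_mul_inv]

lemma IsEllipticOn.sq_norm_le_ellipForm (h : IsEllipticOn D A Λ) (hx : x₀ ∈ D)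
    (hQ : IsSymmInverse (A x₀) Q) (hr : 0 < r) (y : Eu m) :
    ‖y - x₀‖ ^ 2 ≤ Λ ^ 3 * r ^ 2 * ellipForm Q x₀ r y := by
  have := h.sq_norm_le_symmInverse hx hQ (y - x₀)
  rw [ellipForm]
  field_simp
  exact this

lemma IsEllipticOn.ellipForm_nonneg (h : IsEllipticOn D A Λ) (hx : x₀ ∈ D)
    (hQ : IsSymmInverse (A x₀) Q) (hr : 0 < r) (y : Eu m) : 0 ≤ ellipForm Q x₀ r y := by
  have h1 := h.sq_norm_le_ellipForm hx hQ hr y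
  have h2 : 0 < Λ ^ 3 * r ^ 2 := by have := h.one_le; positivity
  by_contra h3
  push Not at h3
  nlinarith [sq_nonneg ‖y - x₀‖]

lemma IsEllipticOn.norm_le_of_ellipForm_le (h : IsEllipticOn D A Λ) (hx : x₀ ∈ D)
    (hQ : IsSymmInverse (A x₀) Q) (hr : 0 < r) {y : Eu m} (hy : ellipForm Q x₀ r y ≤ 1) :
    ‖y - x₀‖ ≤ Λ ^ 2 * r := by
  have h1 := h.sq_norm_le_ellipForm hx hQ hr y
  have hΛ := h.one_le
  refine le_of_sq_le_sq (α := ℝ) ?_ (by positivity)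
  calc ‖y - x₀‖ ^ 2 ≤ Λ ^ 3 * r ^ 2 * 1 := h1.trans (by gcongr)
    _ ≤ Λ ^ 4 * r ^ 2 := by
      rw [mul_one]; gcongr
      norm_num
    _ = _ := by ring

lemma IsEllipticOn.ellipForm_le_of_norm_le (h : IsEllipticOn D A Λ) (hx : x₀ ∈ D)
    (hQ : IsSymmInverse (A x₀) Q) (hr : 0 < r) {y : Eu m} {c : ℝ}
    (hy : Λ * ‖y - x₀‖ ≤ c * r) : ellipForm Q x₀ r y ≤ c ^ 2 := by
  have hΛ := h.one_le
  rw [ellipForm, div_le_iff₀ (by positivity)]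
  calc _ ≤ Λ * ‖y - x₀‖ ^ 2 := h.symmInverse_le hx hQ _
    _ ≤ Λ ^ 2 * ‖y - x₀‖ ^ 2 := by
      gcongr
      exact le_self_pow₀ hΛ two_ne_zero
    _ = (Λ * ‖y - x₀‖) ^ 2 := by ring
    _ ≤ (c * r) ^ 2 := by gcongr
    _ = _ := by ring

lemma IsEllipticOn.isCompact_ellipsoid (h : IsEllipticOn D A Λ) (hx : x₀ ∈ D)
    (hQ : IsSymmInverse (A x₀) Q) (hr : 0 < r) : IsCompact {y | ellipForm Q x₀ r y ≤ 1} := by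
  refine Metric.isCompact_of_isClosed_isBounded
    (isClosed_le contDiff_ellipForm.continuous continuous_const) ?_
  refine (Metric.isBounded_closedBall (x := x₀) (r := Λ ^ 2 * r)).subset fun y hy => ?_
  rw [mem_closedBall, dist_eq_norm]
  exact h.norm_le_of_ellipForm_le hx hQ hr hy

lemma radialField_eq_zero {y : Eu m} (hy : y ∉ {y | ellipForm Q x₀ r y ≤ 1}) :
    radialField Q x₀ r y = 0 := by
  simp only [mem_ofPred_eq, not_le] at hy
  rw [radialField, cutoff_eq_zero hy.le, zero_smul]

lemma hasFDerivAt_radial_variation {B : Eu m →L[ℝ] Eu m} (hQ : IsSymmInverse B Q) (s : ℝ)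
    (x : Eu m) :
    HasFDerivAt (fun y => y + s • radialField Q x₀ r y)
      ((1 + s * cutoff (ellipForm Q x₀ r x)) • ContinuousLinearMap.id ℝ (Eu m) +
        s • (innerSL ℝ ((2 * deriv cutoff (ellipForm Q x₀ r x) / r ^ 2) • Q (x - x₀))).smulRight
          (x - x₀)) x := by
  have h1 : HasFDerivAt (fun y => cutoff (ellipForm Q x₀ r y)) _ x :=
    (differentiable_cutoff (ellipForm Q x₀ r x)).hasDerivAt.comp_hasFDerivAt x
      (hasFDerivAt_ellipForm hQ x)
  have h2 : HasFDerivAt (fun y => y - x₀) (ContinuousLinearMap.id ℝ (Eu m)) x :=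
    (hasFDerivAt_id x).sub_const x₀
  have h3 := (hasFDerivAt_id x).add ((h1.smul h2).const_smul s)
  refine h3.congr_fderiv ?_
  ext w i
  simp
  ring

/-- The determinant of a rank one perturbation of a multiple of the identity. -/
lemma det_smul_id_add_smulRight {l s : ℝ} (hl : l ≠ 0) (g X : Eu m) :
    (l • ContinuousLinearMap.id ℝ (Eu m) + s • (innerSL ℝ g).smulRight X).det =
      l ^ m * (1 + s * inner ℝ g X / l) := by
  have h : ((l • ContinuousLinearMap.id ℝ (Eu m) + s • (innerSL ℝ g).smulRight X :
      Eu m →L[ℝ] Eu m) : Eu m →ₗ[ℝ] Eu m) =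
      l • LinearMap.transvection ((innerSL ℝ g : Eu m →L[ℝ] ℝ) : Eu m →ₗ[ℝ] ℝ) ((s / l) • X) := by
    ext w i
    simp [LinearMap.transvection.apply]
    field_simp
  rw [ContinuousLinearMap.det, h, LinearMap.det_smul, LinearMap.transvection.det,
    finrank_euclideanSpace, Fintype.card_fin]
  change l ^ m * (1 + innerSL ℝ g ((s / l) • X)) = _
  rw [map_smul, innerSL_apply_apply, smul_eq_mul]
  ring

end EllipForm

section Energy

variable {m n : ℕ}

/-- The quadratic form of the operator `B`, summed over the components of the gradient `P` of an
`ℝⁿ`-valued map. -/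
def coeffEnergy (B : Eu m →L[ℝ] Eu m) (P : Fin m → Eu n) : ℝ :=
  ∑ k : Fin n, inner ℝ (B (WithLp.toLp 2 fun i => P i k)) (WithLp.toLp 2 fun i => P i k)

variable {D : Set (Eu m)} {A : Eu m → Eu m →L[ℝ] Eu m} {Λ : ℝ}
  {Q : Eu m →L[ℝ] Eu m} {x₀ : Eu m} {r : ℝ}

/-- The integrand of the first variation of the energy along a radial field, as a multiple of the
energy density: `-a φ(q) - (2 + c) q φ'(q)` with the cutoff `φ` and `q = ellipForm Q x₀ r y`. In the
Euclidean model `a` is the dimension minus two plus the exponent of the weight and `c = 0`; both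
deviate from this by `O(r)` for variable coefficients. -/
def variationWeight (Q : Eu m →L[ℝ] Eu m) (x₀ : Eu m) (r a c : ℝ) (y : Eu m) : ℝ :=
  -a * cutoff (ellipForm Q x₀ r y) -
    (2 + c) * (ellipForm Q x₀ r y * deriv cutoff (ellipForm Q x₀ r y))

lemma contDiff_variationWeight {a c : ℝ} : ContDiff ℝ ∞ (variationWeight Q x₀ r a c) := by
  unfold variationWeight
  exact (contDiff_const.mul (contDiff_cutoff.comp contDiff_ellipForm)).sub
    (contDiff_const.mul (contDiff_ellipForm.mul (contDiff_deriv_cutoff.comp contDiff_ellipForm)))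

lemma IsEllipticOn.hasCompactSupport_variationWeight (h : IsEllipticOn D A Λ) (hx : x₀ ∈ D)
    (hQ : IsSymmInverse (A x₀) Q) (hr : 0 < r) {a c : ℝ} :
    HasCompactSupport (variationWeight Q x₀ r a c) := by
  refine HasCompactSupport.intro (h.isCompact_ellipsoid hx hQ hr) fun y hy => ?_
  simp only [mem_ofPred_eq, not_le] at hy
  rw [variationWeight, cutoff_eq_zero hy.le, deriv_cutoff_eq_zero_of_ge hy.le]
  ring

lemma IsEllipticOn.coeffEnergy_nonneg (h : IsEllipticOn D A Λ) {x : Eu m} (hx : x ∈ D)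
    (P : Fin m → Eu n) : 0 ≤ coeffEnergy (A x) P :=
  Finset.sum_nonneg fun _ _ => h.inner_nonneg hx _

set_option maxHeartbeats 1000000 in
/-- Pointwise comparison of the energy density of a radial inner variation with the energy density
of the original map, up to second order in the parameter. The hypothesis `hw` says that the weight
grows along rays from the centre at least with exponent `-κ`. -/
lemma IsEllipticOn.exists_pointwise_variation_le (h : IsEllipticOn D A Λ) (hx₀ : x₀ ∈ D)
    (hQ : IsSymmInverse (A x₀) Q) (hr : 0 < r) {S : Set (Eu m)}
    (hSZ : S ⊆ {y | ellipForm Q x₀ r y ≤ 1}) (hSD : S ⊆ D) {w : Eu m → ℝ} (hw0 : ∀ x ∈ S, 0 ≤ w x)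
    {κ C₀ : ℝ} (hC₀ : 0 ≤ C₀)
    (hw : ∀ x ∈ S, ∀ l : ℝ, 1 ≤ l → l ≤ 2 → x₀ + l • (x - x₀) ∈ S →
      w x ≤ w (x₀ + l • (x - x₀)) * Real.exp (κ * (l - 1) + C₀ * (l - 1) ^ 2)) :
    ∃ s₀ > 0, ∃ C ≥ 0, ∀ s, 0 ≤ s → s ≤ s₀ → ∀ x ∈ S, x + s • radialField Q x₀ r x ∈ S →
      ∀ P : Fin m → Eu n,
      w x * coeffEnergy (A x) (fun i => ∑ j,
          (fderiv ℝ (fun y => y + s • radialField Q x₀ r y) x (stdVec i)) j • P j) ≤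
        |(fderiv ℝ (fun y => y + s • radialField Q x₀ r y) x).det| *
        (w (x + s • radialField Q x₀ r x) * coeffEnergy (A (x + s • radialField Q x₀ r x)) P *
          (1 + s * variationWeight Q x₀ r (m - 2 - κ - Λ ^ 4 * r) (16 * Λ ^ 9 * r)
            (x + s • radialField Q x₀ r x) + C * s ^ 2)) := by
  have hΛ := h.one_le
  obtain ⟨K, hK, hKb⟩ := exists_deriv_cutoff_bound
  obtain ⟨s₀, hs₀, C, hC, hs₀1, hdist⟩ := exists_distortion_bound m (K := K) (κ := κ) (C₀ := C₀)
    (c₁ := Λ ^ 4 * r) (c₂ := 16 * Λ ^ 9 * r) (c₃ := 4 * Λ ^ 12 * K ^ 2) hK.le hC₀ (by positivity)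
    (by positivity) (by positivity)
  obtain ⟨Lb, hLb⟩ := ContDiff.lipschitzWith_of_hasCompactSupport
    (h.hasCompactSupport_variationWeight hx₀ hQ hr (a := m - 2 - κ - Λ ^ 4 * r)
      (c := 16 * Λ ^ 9 * r)) contDiff_variationWeight (by simp)
  refine ⟨s₀, hs₀, C + Lb * (Λ ^ 2 * r), by positivity, fun s hs hss x hx hy P => ?_⟩
  set q := ellipForm Q x₀ r x with hq
  set η := cutoff q with hη
  set g : Eu m := (2 * deriv cutoff q / r ^ 2) • Q (x - x₀) with hg
  set y := x + s • radialField Q x₀ r x with hyd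
  have hη0 : 0 ≤ η := cutoff_nonneg q
  have hη1 : η ≤ 1 := cutoff_le_one q
  have hq0 : 0 ≤ q := h.ellipForm_nonneg hx₀ hQ hr x
  have hq1 : q ≤ 1 := hSZ hx
  have hd0 := deriv_cutoff_nonpos q
  have hd0' : 0 ≤ -deriv cutoff q := by linarith
  set τ : ℝ := -(q * deriv cutoff q) with hτ
  have hτ0 : 0 ≤ τ := by rw [hτ, ← mul_neg]; exact mul_nonneg hq0 (by linarith)
  have hτK : τ ≤ K := by
    rw [hτ, ← mul_neg, ← one_mul K]
    have := hKb q
    rw [abs_of_nonpos hd0] at this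
    gcongr
  -- the derivative of the cutoff vanishes for `q < 1/4`
  have hdτ : -deriv cutoff q ≤ 4 * τ := by
    rcases le_total q (1 / 4) with hq4 | hq4
    · rw [hτ, deriv_cutoff_eq_zero_of_le hq4]; simp
    · rw [hτ]; nlinarith
  have hsη : 0 ≤ s * η := mul_nonneg hs hη0
  have hl0 : 1 + s * η ≠ 0 := by linarith
  have hX : ‖x - x₀‖ ≤ Λ ^ 2 * r := h.norm_le_of_ellipForm_le hx₀ hQ hr hq1
  have hgn : ‖g‖ ≤ 2 * Λ ^ 3 * (-deriv cutoff q) / r := by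
    rw [hg, norm_smul, Real.norm_eq_abs, abs_div, abs_mul, abs_of_nonpos hd0,
      abs_of_pos (by positivity : 0 < r ^ 2), abs_two]
    have h1 : ‖Q (x - x₀)‖ ≤ Λ * (Λ ^ 2 * r) :=
      (h.norm_symmInverse_le hx₀ hQ _).trans (by gcongr)
    calc _ ≤ 2 * (-deriv cutoff q) / r ^ 2 * (Λ * (Λ ^ 2 * r)) := by
          gcongr
      _ = _ := by field_simp
  have hyx : y = x + (s * η) • (x - x₀) := by
    rw [hyd, radialField, smul_smul]
  have hyl : y = x₀ + (1 + s * η) • (x - x₀) := by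
    rw [hyx, add_smul, one_smul]; abel
  -- the differential and its determinant
  have hF := (hasFDerivAt_radial_variation (x₀ := x₀) (r := r) hQ s x).fderiv
  rw [← hq, ← hη, ← hg] at hF
  have hgX : inner ℝ g (x - x₀) = -(2 * τ) := by
    rw [hg, real_inner_smul_left, hτ, hq, ellipForm]
    field_simp
  have hdet : (fderiv ℝ (fun y => y + s • radialField Q x₀ r y) x).det =
      (1 + s * η) ^ m * (1 - 2 * s * τ / (1 + s * η)) := by
    rw [hF, det_smul_id_add_smulRight hl0, hgX]
    ring
  obtain ⟨hpos, hmain⟩ := hdist s η τ hs hss hη0 hη1 hτ0 hτK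
  rw [hdet, abs_of_nonneg (by positivity)]
  -- the quadratic form
  set J : ℝ := (1 + s * η) ^ 2 * (1 + s * (Λ ^ 4 * r * η + 16 * Λ ^ 9 * r * τ) +
    4 * Λ ^ 12 * K ^ 2 * s ^ 2) with hJ
  have hen : coeffEnergy (A x) (fun i => ∑ j,
      (fderiv ℝ (fun y => y + s • radialField Q x₀ r y) x (stdVec i)) j • P j) ≤
      J * coeffEnergy (A y) P := by
    rw [coeffEnergy, coeffEnergy, Finset.mul_sum]
    refine Finset.sum_le_sum fun k _ => ?_
    set p : Eu m := WithLp.toLp 2 fun i => P i k with hp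
    have hp' : (WithLp.toLp 2 fun i => (∑ j,
        (fderiv ℝ (fun y => y + s • radialField Q x₀ r y) x (stdVec i)) j • P j) k : Eu m) =
        (1 + s * η) • p + (s * inner ℝ (x - x₀) p) • g := by
      ext i
      have h1 : (∑ j, (fderiv ℝ (fun y => y + s • radialField Q x₀ r y) x (stdVec i)) j • P j) k =
          inner ℝ p (fderiv ℝ (fun y => y + s • radialField Q x₀ r y) x (stdVec i)) := by
        simp [hp, PiLp.inner_apply]
      rw [PiLp.toLp_apply, h1, hF]
      have h2 : inner ℝ g (stdVec i) = g i := by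
        rw [EuclideanSpace.inner_single_right]; simp
      have h3 : inner ℝ p (stdVec i) = p i := by
        rw [EuclideanSpace.inner_single_right]; simp
      simp only [add_apply, smul_apply, ContinuousLinearMap.coe_id', id,
        ContinuousLinearMap.smulRight_apply, innerSL_apply_apply, inner_add_right,
        real_inner_smul_right, h2, h3, PiLp.add_apply, PiLp.smul_apply, smul_eq_mul,
        real_inner_comm p (x - x₀)]
      ring
    rw [hp']
    refine (h.variation_le hx₀ (hSD hx) (hSD hy) hQ hs hη0 (c := 2 * deriv cutoff q / r ^ 2)
      (div_nonpos_of_nonpos_of_nonneg (by linarith) (by positivity)) hX hyx hg p).trans ?_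
    have hN := h.inner_nonneg (hSD hy) p
    refine mul_le_mul_of_nonneg_right ?_ hN
    rw [hJ]
    refine mul_le_mul_of_nonneg_left ?_ (by positivity)
    have t1 : 2 * Λ ^ 2 * (Λ ^ 2 * r) ^ 2 * ‖g‖ ≤ 16 * Λ ^ 9 * r * τ := by
      calc _ ≤ 2 * Λ ^ 2 * (Λ ^ 2 * r) ^ 2 * (2 * Λ ^ 3 * (-deriv cutoff q) / r) := by gcongr
        _ = 4 * Λ ^ 9 * r * (-deriv cutoff q) := by field_simp; ring
        _ ≤ 4 * Λ ^ 9 * r * (4 * τ) := by gcongr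
        _ = _ := by ring
    have t2 : Λ ^ 2 * (Λ ^ 2 * r) ^ 2 * ‖g‖ ^ 2 ≤ 4 * Λ ^ 12 * K ^ 2 := by
      have hgK : ‖g‖ ≤ 2 * Λ ^ 3 * K / r := hgn.trans (by
        have := hKb q
        rw [abs_of_nonpos hd0] at this
        gcongr)
      calc _ ≤ Λ ^ 2 * (Λ ^ 2 * r) ^ 2 * (2 * Λ ^ 3 * K / r) ^ 2 := by gcongr
        _ = _ := by field_simp; ring
    have t3 : Λ ^ 2 * (Λ ^ 2 * r) * η = Λ ^ 4 * r * η := by ring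
    rw [t3, mul_comm (4 * Λ ^ 12 * K ^ 2)]
    gcongr
  have hwx := hw x hx (1 + s * η) (by linarith)
    (by nlinarith [mul_le_one₀ (hss.trans hs₀1) hη0 hη1]) (hyl ▸ hy)
  rw [← hyl] at hwx
  have hC₀s : C₀ * (1 + s * η - 1) ^ 2 ≤ C₀ * s ^ 2 := by
    rw [add_sub_cancel_left]
    have : s * η ≤ s := mul_le_of_le_one_right hs hη1
    gcongr
  have hwx' : w x ≤ w y * Real.exp (κ * (s * η) + C₀ * s ^ 2) := by
    refine hwx.trans (mul_le_mul_of_nonneg_left (Real.exp_le_exp.2 ?_) (hw0 y hy))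
    rw [add_sub_cancel_left] at hC₀s ⊢
    linarith
  have hE0 := h.coeffEnergy_nonneg (hSD hy) P
  have hJ0 : 0 ≤ J := by positivity
  have hbx : -(m - 2 - κ - Λ ^ 4 * r) * η + (2 + 16 * Λ ^ 9 * r) * τ =
      variationWeight Q x₀ r (m - 2 - κ - Λ ^ 4 * r) (16 * Λ ^ 9 * r) x := by
    rw [variationWeight, ← hq, ← hη, hτ]
    ring
  -- replacing `x` by its image `y` in the weight costs another term of second order
  have hby : variationWeight Q x₀ r (m - 2 - κ - Λ ^ 4 * r) (16 * Λ ^ 9 * r) x ≤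
      variationWeight Q x₀ r (m - 2 - κ - Λ ^ 4 * r) (16 * Λ ^ 9 * r) y +
        Lb * (Λ ^ 2 * r) * s := by
    have h1 := hLb.dist_le_mul x y
    rw [Real.dist_eq, dist_eq_norm] at h1
    have h2 : ‖x - y‖ ≤ s * (Λ ^ 2 * r) := by
      have : x - y = -((s * η) • (x - x₀)) := by rw [hyx]; abel
      rw [this, norm_neg, norm_smul, Real.norm_eq_abs, abs_of_nonneg hsη]
      have : s * η ≤ s := mul_le_of_le_one_right hs hη1
      gcongr
    have h3 := (abs_le.1 h1).2
    have h4 : (Lb : ℝ) * ‖x - y‖ ≤ Lb * (s * (Λ ^ 2 * r)) := by gcongr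
    linarith
  rw [hbx] at hmain
  have hwy := hw0 y hy
  have hwx0 := hw0 x hx
  calc _ ≤ (w y * Real.exp (κ * (s * η) + C₀ * s ^ 2)) * (J * coeffEnergy (A y) P) := by
        have := h.coeffEnergy_nonneg (hSD hx) (fun i => ∑ j,
          (fderiv ℝ (fun y => y + s • radialField Q x₀ r y) x (stdVec i)) j • P j)
        gcongr
    _ = (Real.exp (κ * (s * η) + C₀ * s ^ 2) * J) * (w y * coeffEnergy (A y) P) := by ring
    _ ≤ ((1 + s * η) ^ m * (1 - 2 * s * τ / (1 + s * η)) *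
          (1 + s * variationWeight Q x₀ r (m - 2 - κ - Λ ^ 4 * r) (16 * Λ ^ 9 * r) x +
            C * s ^ 2)) * (w y * coeffEnergy (A y) P) := by gcongr
    _ ≤ ((1 + s * η) ^ m * (1 - 2 * s * τ / (1 + s * η)) *
          (1 + s * variationWeight Q x₀ r (m - 2 - κ - Λ ^ 4 * r) (16 * Λ ^ 9 * r) y +
            (C + Lb * (Λ ^ 2 * r)) * s ^ 2)) * (w y * coeffEnergy (A y) P) := by
        refine mul_le_mul_of_nonneg_right (mul_le_mul_of_nonneg_left ?_ (by positivity))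
          (by positivity)
        have := mul_le_mul_of_nonneg_left hby hs
        have e : s * (variationWeight Q x₀ r (m - 2 - κ - Λ ^ 4 * r) (16 * Λ ^ 9 * r) y +
          Lb * (Λ ^ 2 * r) * s) = s * variationWeight Q x₀ r (m - 2 - κ - Λ ^ 4 * r)
            (16 * Λ ^ 9 * r) y + Lb * (Λ ^ 2 * r) * s ^ 2 := by ring
        rw [e] at this
        rw [add_mul C]
        linarith
    _ = _ := by ring

/-- The first variation inequality in integrated form. No measurability of the varied energy density
is needed, since only an upper bound for its integral is claimed. -/
lemma IsEllipticOn.exists_integral_variation_le (h : IsEllipticOn D A Λ) (hx₀ : x₀ ∈ D)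
    (hQ : IsSymmInverse (A x₀) Q) (hr : 0 < r) {S : Set (Eu m)} (hSm : MeasurableSet S)
    (hSZ : S ⊆ {y | ellipForm Q x₀ r y ≤ 1}) (hSD : S ⊆ D) {w : Eu m → ℝ} (hw0 : ∀ x ∈ S, 0 ≤ w x)
    {κ C₀ : ℝ} (hC₀ : 0 ≤ C₀)
    (hw : ∀ x ∈ S, ∀ l : ℝ, 1 ≤ l → l ≤ 2 → x₀ + l • (x - x₀) ∈ S →
      w x ≤ w (x₀ + l • (x - x₀)) * Real.exp (κ * (l - 1) + C₀ * (l - 1) ^ 2))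
    {P : Fin m → Eu m → Eu n}
    (hf : IntegrableOn (fun y => w y * coeffEnergy (A y) (fun i => P i y)) S) :
    ∃ s₀ > 0, ∃ C ≥ 0, ∀ s, 0 ≤ s → s ≤ s₀ →
      Function.Injective (fun y => y + s • radialField Q x₀ r y) →
      (fun y => y + s • radialField Q x₀ r y) '' S = S →
      ∫ x in S, w x * coeffEnergy (A x) (fun i => ∑ j,
          (fderiv ℝ (fun y => y + s • radialField Q x₀ r y) x (stdVec i)) j •
            P j (x + s • radialField Q x₀ r x)) ≤
        (∫ y in S, w y * coeffEnergy (A y) (fun i => P i y)) +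
          s * (∫ y in S, w y * coeffEnergy (A y) (fun i => P i y) *
            variationWeight Q x₀ r (m - 2 - κ - Λ ^ 4 * r) (16 * Λ ^ 9 * r) y) + C * s ^ 2 := by
  obtain ⟨s₀, hs₀, C, hC, hpt⟩ := h.exists_pointwise_variation_le (n := n) hx₀ hQ hr hSZ hSD hw0
    hC₀ hw
  set f : Eu m → ℝ := fun y => w y * coeffEnergy (A y) (fun i => P i y) with hfd
  set b := variationWeight Q x₀ r (m - 2 - κ - Λ ^ 4 * r) (16 * Λ ^ 9 * r) with hb
  have hf0 : ∀ y ∈ S, 0 ≤ f y := fun y hy =>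
    mul_nonneg (hw0 y hy) (h.coeffEnergy_nonneg (hSD hy) _)
  have hbc : Continuous b := contDiff_variationWeight.continuous
  obtain ⟨K, hK⟩ := (h.hasCompactSupport_variationWeight hx₀ hQ hr (a := m - 2 - κ - Λ ^ 4 * r)
      (c := 16 * Λ ^ 9 * r)).exists_bound_of_continuous hbc
  have hfb : IntegrableOn (fun y => f y * b y) S :=
    Integrable.mul_bdd hf hbc.aestronglyMeasurable (Filter.Eventually.of_forall hK)
  refine ⟨s₀, hs₀, C * ∫ y in S, f y, mul_nonneg hC (setIntegral_nonneg hSm hf0), ?_⟩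
  intro s hs hss hinj himg
  set F : Eu m → Eu m := fun y => y + s • radialField Q x₀ r y with hF
  have hFd : ∀ x ∈ S, HasFDerivWithinAt F (fderiv ℝ F x) S x := fun x _ =>
    ((hasFDerivAt_radial_variation (x₀ := x₀) (r := r) hQ s
      x).differentiableAt.hasFDerivAt).hasFDerivWithinAt
  set H : Eu m → ℝ := fun y => f y * (1 + s * b y + C * s ^ 2) with hH
  have hHe : H = fun y => f y + s * (f y * b y) + C * s ^ 2 * f y := by
    ext y; simp only [hH]; ring
  have hHi : IntegrableOn H S := by
    rw [hHe]
    exact (hf.add (hfb.const_mul s)).add (hf.const_mul _)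
  have hHi' : IntegrableOn H (F '' S) := by rw [himg]; exact hHi
  rw [integrableOn_image_iff_integrableOn_abs_det_fderiv_smul volume hSm hFd hinj.injOn] at hHi'
  have hmap : ∀ x ∈ S, F x ∈ S := fun x hx => himg ▸ mem_image_of_mem F hx
  calc _ ≤ ∫ x in S, |(fderiv ℝ F x).det| • H (F x) := by
        refine integral_mono_of_nonneg ?_ hHi' ?_
        · filter_upwards [ae_restrict_mem hSm] with x hx
          exact mul_nonneg (hw0 x hx) (h.coeffEnergy_nonneg (hSD hx) _)
        · filter_upwards [ae_restrict_mem hSm] with x hx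
          exact hpt s hs hss x hx (hmap x hx) fun i => P i (F x)
    _ = ∫ y in F '' S, H y :=
        (integral_image_eq_integral_abs_det_fderiv_smul volume hSm hFd hinj.injOn H).symm
    _ = ∫ y in S, H y := by rw [himg]
    _ = _ := by
        have h1 : ∫ y in S, f y + s * (f y * b y) + C * s ^ 2 * f y =
            (∫ y in S, f y + s * (f y * b y)) + ∫ y in S, C * s ^ 2 * f y :=
          integral_add (hf.add (hfb.const_mul s)) (hf.const_mul _)
        have h2 : ∫ y in S, f y + s * (f y * b y) =
            (∫ y in S, f y) + ∫ y in S, s * (f y * b y) := integral_add hf (hfb.const_mul s)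
        rw [hHe, h1, h2, integral_const_mul, integral_const_mul]
        ring

end Energy

/-! ### The energy in a chart -/

section MatrixOp

variable {m n : ℕ}

/-- The operator of `ℝᵐ` with matrix `G`. -/
def matrixOp (G : Matrix (Fin m) (Fin m) ℝ) : Eu m →L[ℝ] Eu m :=
  ∑ i, ∑ j, G i j • (innerSL ℝ (stdVec j)).smulRight (stdVec i)

lemma inner_matrixOp (G : Matrix (Fin m) (Fin m) ℝ) (u w : Eu m) :
    inner ℝ (matrixOp G u) w = ∑ i, ∑ j, G i j * (u j * w i) := by
  simp only [matrixOp, sum_apply, sum_inner, smul_apply,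
    ContinuousLinearMap.smulRight_apply, innerSL_apply_apply, real_inner_smul_left]
  refine Finset.sum_congr rfl fun i _ => Finset.sum_congr rfl fun j _ => ?_
  rw [EuclideanSpace.inner_single_left, EuclideanSpace.inner_single_left]
  simp

lemma inner_matrixOp_self_pos {G : Matrix (Fin m) (Fin m) ℝ} (hG : G.PosDef) {u : Eu m}
    (hu : u ≠ 0) : 0 < inner ℝ (matrixOp G u) u := by
  have hu' : u.ofLp ≠ 0 := fun h => hu (by ext i; simp [h])
  have := hG.dotProduct_mulVec_pos hu'
  rw [inner_matrixOp]
  convert! this using 1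
  simp only [dotProduct, Matrix.mulVec, Finset.mul_sum]
  refine Finset.sum_congr rfl fun i _ => Finset.sum_congr rfl fun j _ => ?_
  simp
  ring

lemma matrixOp_symm {G : Matrix (Fin m) (Fin m) ℝ} (hG : G.PosDef) (u w : Eu m) :
    inner ℝ (matrixOp G u) w = inner ℝ u (matrixOp G w) := by
  rw [real_inner_comm _ u, inner_matrixOp, inner_matrixOp, Finset.sum_comm]
  refine Finset.sum_congr rfl fun i _ => Finset.sum_congr rfl fun j _ => ?_
  have := hG.isHermitian.apply i j
  simp only [star_trivial] at this
  rw [this]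
  ring

lemma coeffEnergy_matrixOp (G : Matrix (Fin m) (Fin m) ℝ) (P : Fin m → Eu n) :
    coeffEnergy (matrixOp G) P = ∑ i, ∑ j, G i j * inner ℝ (P i) (P j) := by
  rw [coeffEnergy]
  simp only [inner_matrixOp]
  simp only [PiLp.inner_apply, Finset.mul_sum]
  rw [Finset.sum_comm]
  refine Finset.sum_congr rfl fun i _ => ?_
  rw [Finset.sum_comm]
  refine Finset.sum_congr rfl fun j _ => Finset.sum_congr rfl fun k _ => ?_
  simp

lemma contDiffOn_matrixOp {G : Eu m → Matrix (Fin m) (Fin m) ℝ} {T : Set (Eu m)}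
    (h : ∀ i j, ContDiffOn ℝ ∞ (fun y => G y i j) T) :
    ContDiffOn ℝ ∞ (fun y => matrixOp (G y)) T := by
  unfold matrixOp
  exact ContDiffOn.sum fun i _ => ContDiffOn.sum fun j _ => (h i j).smul contDiffOn_const

/-- A continuous field of positive operators on a compact set is uniformly elliptic. -/
lemma exists_ellipticity_bounds {D : Set (Eu m)} (hD : IsCompact D) {A : Eu m → Eu m →L[ℝ] Eu m}
    (hA : ContinuousOn A D) (hpos : ∀ y ∈ D, ∀ u ≠ 0, 0 < inner ℝ (A y u) u) :
    ∃ Λ : ℝ, 1 ≤ Λ ∧ (∀ y ∈ D, ∀ u, ‖u‖ ^ 2 ≤ Λ * inner ℝ (A y u) u) ∧ ∀ y ∈ D, ‖A y‖ ≤ Λ := by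
  obtain ⟨C, hC⟩ := hD.exists_bound_of_continuousOn hA
  have hcomp : IsCompact (D ×ˢ sphere (0 : Eu m) 1) := hD.prod (isCompact_sphere 0 1)
  have hcont : ContinuousOn (fun p : Eu m × Eu m => inner ℝ (A p.1 p.2) p.2)
      (D ×ˢ sphere (0 : Eu m) 1) := by
    refine ContinuousOn.inner ?_ continuousOn_snd
    exact (hA.comp continuousOn_fst (fun p hp => hp.1)).clm_apply continuousOn_snd
  obtain ⟨c, hc, hcb⟩ := hcomp.exists_forall_le' hcont (a := 0) (fun p hp =>
    hpos p.1 hp.1 p.2 (by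
      intro h
      have := hp.2
      simp [h] at this))
  refine ⟨max 1 (max C c⁻¹), le_max_left _ _, fun y hy u => ?_,
    fun y hy => (hC y hy).trans ((le_max_left _ _).trans (le_max_right _ _))⟩
  rcases eq_or_ne u 0 with rfl | hu
  · simp
  have hn : 0 < ‖u‖ := norm_pos_iff.2 hu
  have h1 := hcb (y, ‖u‖⁻¹ • u) ⟨hy, by simp [norm_smul, hn.ne']⟩
  simp only [map_smul, real_inner_smul_left, real_inner_smul_right] at h1
  have h2 : c * ‖u‖ ^ 2 ≤ inner ℝ (A y u) u := by
    calc c * ‖u‖ ^ 2 ≤ (‖u‖⁻¹ * (‖u‖⁻¹ * inner ℝ (A y u) u)) * ‖u‖ ^ 2 := by gcongr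
      _ = _ := by field_simp
  calc ‖u‖ ^ 2 = c⁻¹ * (c * ‖u‖ ^ 2) := by field_simp
    _ ≤ c⁻¹ * inner ℝ (A y u) u := by gcongr
    _ ≤ _ := by
      refine mul_le_mul_of_nonneg_right ((le_max_right _ _).trans (le_max_right _ _))
        (hpos y hy u hu).le

end MatrixOp

section ChartEnergy

variable {m n : ℕ} [NeZero m] {M : Type*} [EMetricSpace M] [ChartedSpace (EuclideanHalfSpace m) M]
  [IsManifold (𝓡∂ m) ∞ M] [RiemannianBundle (fun x : M => TangentSpace (𝓡∂ m) x)]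
  [IsContMDiffRiemannianBundle (𝓡∂ m) ∞ (EuclideanSpace ℝ (Fin m))
      (fun x : M => TangentSpace (𝓡∂ m) x)]
  [MeasurableSpace M] [BorelSpace M] [SecondCountableTopology M]

attribute [local instance] isManifold_one

/-- The coefficient operator `√det g · g⁻¹` of the energy in the chart around `c`. -/
def coeffOp (c : M) (y : Eu m) : Eu m →L[ℝ] Eu m :=
  matrixOp (volDensity (m := m) c y • (gram (m := m) c ((extChartAt (𝓡∂ m) c).symm y))⁻¹)

lemma posDef_coeff (c : M) {y : Eu m} (hy : y ∈ (extChartAt (𝓡∂ m) c).target) :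
    (volDensity (m := m) c y • (gram (m := m) c ((extChartAt (𝓡∂ m) c).symm y))⁻¹).PosDef :=
  (gram_posDef ((extChartAt (𝓡∂ m) c).map_target hy)).inv.smul (volDensity_pos c hy)

lemma contDiffOn_gram_inv (c : M) (i j : Fin m) :
    ContDiffOn ℝ ∞ (fun y => (gram (m := m) c ((extChartAt (𝓡∂ m) c).symm y))⁻¹ i j)
      (extChartAt (𝓡∂ m) c).target := by
  have h : (fun y => (gram (m := m) c ((extChartAt (𝓡∂ m) c).symm y))⁻¹ i j) = fun y =>
      ((gram (m := m) c ((extChartAt (𝓡∂ m) c).symm y)).det)⁻¹ *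
      ((gram (m := m) c ((extChartAt (𝓡∂ m) c).symm y)).updateRow j (Pi.single i 1)).det := by
    ext y
    rw [Matrix.inv_def, Matrix.smul_apply, Matrix.adjugate_apply, Ring.inverse_eq_inv, smul_eq_mul]
  rw [h]
  refine ((contDiffOn_det_gram c).inv fun y hy => (det_gram_pos c hy).ne').mul ?_
  simp only [Matrix.det_apply]
  refine ContDiffOn.sum fun σ _ => ContDiffOn.const_smul _ (contDiffOn_prod fun k _ => ?_)
  simp only [Matrix.updateRow_apply]
  split_ifs
  · exact contDiffOn_const
  · exact contDiffOn_gram c _ _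

lemma contDiffOn_coeffOp (c : M) :
    ContDiffOn ℝ ∞ (coeffOp (m := m) c) (extChartAt (𝓡∂ m) c).target :=
  contDiffOn_matrixOp fun i j => (contDiffOn_volDensity c).mul (contDiffOn_gram_inv c i j)

/-- The energy density in the chart around `c`, with respect to Lebesgue measure. -/
def chartEnergyDensity (β : ℝ) (v : M → EuclideanSpace ℝ (Fin n)) (c : M) (y : Eu m) : ℝ :=
  bdryDist m ((extChartAt (𝓡∂ m) c).symm y) ^ β * coeffEnergy (coeffOp (m := m) c y)
    (fun i => weakDifferential v ((extChartAt (𝓡∂ m) c).symm y)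
      (partialVec (m := m) c ((extChartAt (𝓡∂ m) c).symm y) i))

lemma volDensity_mul_energyDensity {β : ℝ} {v : M → EuclideanSpace ℝ (Fin n)} {c : M} {y : Eu m}
    (hy : y ∈ (extChartAt (𝓡∂ m) c).target) :
    volDensity (m := m) c y * energyDensity m β v ((extChartAt (𝓡∂ m) c).symm y) =
      chartEnergyDensity β v c y := by
  rw [energyDensity, chartEnergyDensity, coeffOp, coeffEnergy_matrixOp,
    normSqDiff_eq_sum ((extChartAt (𝓡∂ m) c).map_target hy)]
  simp only [Matrix.smul_apply, smul_eq_mul, mul_assoc, ← Finset.mul_sum]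
  ring

lemma chartEnergyDensity_nonneg {β : ℝ} {v : M → EuclideanSpace ℝ (Fin n)} {c : M} {y : Eu m}
    (hy : y ∈ (extChartAt (𝓡∂ m) c).target) : 0 ≤ chartEnergyDensity β v c y := by
  refine mul_nonneg (Real.rpow_nonneg ENNReal.toReal_nonneg _) (Finset.sum_nonneg fun k _ => ?_)
  rcases eq_or_ne (WithLp.toLp 2 fun i => weakDifferential v ((extChartAt (𝓡∂ m) c).symm y)
      (partialVec (m := m) c ((extChartAt (𝓡∂ m) c).symm y) i) k : Eu m) 0 with h | h
  · rw [h]; simp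
  · exact (inner_matrixOp_self_pos (posDef_coeff c hy) h).le

/-- The closed ball about `x` intersected with the half space; `x` need not lie on the boundary
hyperplane, so this may be a full ball. -/
def halfBall (x : Eu m) (κ : ℝ) : Set (Eu m) := closedBall x κ ∩ {y | 0 ≤ y 0}

lemma isCompact_halfBall (x : Eu m) (κ : ℝ) : IsCompact (halfBall x κ) :=
  (isCompact_closedBall x κ).inter_right
    (isClosed_le continuous_const (EuclideanSpace.proj (𝕜 := ℝ) (0 : Fin m)).continuous)

lemma halfBall_mono {x : Eu m} {κ κ' : ℝ} (h : κ ≤ κ') : halfBall x κ ⊆ halfBall x κ' :=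
  inter_subset_inter_left _ (closedBall_subset_closedBall h)

lemma convex_halfBall (x : Eu m) (κ : ℝ) : Convex ℝ (halfBall x κ) := by
  refine (convex_closedBall x κ).inter ?_
  have : {y : Eu m | 0 ≤ y 0} =
      (EuclideanSpace.proj (𝕜 := ℝ) (0 : Fin m) : Eu m →L[ℝ] ℝ) ⁻¹' Ici 0 := rfl
  rw [this]
  exact (convex_Ici 0).is_linear_preimage
    (EuclideanSpace.proj (𝕜 := ℝ) (0 : Fin m) : Eu m →L[ℝ] ℝ).toLinearMap.isLinear

lemma exists_halfBall_subset {q : M} {t : Set (Eu m)}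
    (ht : t ∈ 𝓝[range (𝓡∂ m)] (extChartAt (𝓡∂ m) q q)) :
    ∃ κ > 0, halfBall (extChartAt (𝓡∂ m) q q) κ ⊆ t := by
  rw [range_modelHalfSpace] at ht
  obtain ⟨ε, hε, h⟩ := Metric.mem_nhdsWithin_iff.1 ht
  refine ⟨ε / 2, by positivity, fun y hy => h ⟨?_, hy.2⟩⟩
  exact closedBall_subset_ball (by linarith) hy.1

/-- Near the centre of a chart a smooth field of positive symmetric operators is uniformly elliptic
and Lipschitz. The Lipschitz bound holds up to the boundary of the half space, which is convex. -/
lemma exists_isEllipticOn_halfBall (q : M) {A : Eu m → Eu m →L[ℝ] Eu m}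
    (hA : ContDiffOn ℝ ∞ A (extChartAt (𝓡∂ m) q).target)
    (hsymm : ∀ y ∈ (extChartAt (𝓡∂ m) q).target, ∀ u w, inner ℝ (A y u) w = inner ℝ u (A y w))
    (hpos : ∀ y ∈ (extChartAt (𝓡∂ m) q).target, ∀ u ≠ 0, 0 < inner ℝ (A y u) u) :
    ∃ κ > 0, ∃ Λ : ℝ, halfBall (extChartAt (𝓡∂ m) q q) κ ⊆ (extChartAt (𝓡∂ m) q).target ∧
      IsEllipticOn (halfBall (extChartAt (𝓡∂ m) q q) κ) A Λ := by
  set T := (extChartAt (𝓡∂ m) q).target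
  set x := extChartAt (𝓡∂ m) q q
  have hT : T ∈ 𝓝[range (𝓡∂ m)] x := extChartAt_target_mem_nhdsWithin q
  have hxT : x ∈ T := mem_extChartAt_target q
  have hcd : ContDiffWithinAt ℝ 1 A (range (𝓡∂ m)) x :=
    ((hA x hxT).mono_of_mem_nhdsWithin hT).of_le (by simp)
  obtain ⟨K, t, ht, hLip⟩ := hcd.exists_lipschitzOnWith (𝓡∂ m).convex_range
  obtain ⟨κ, hκ, hsub⟩ := exists_halfBall_subset (Filter.inter_mem hT ht)
  obtain ⟨Λ, hΛ1, hlow, hup⟩ := exists_ellipticity_bounds (isCompact_halfBall x κ)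
    (hA.continuousOn.mono fun y hy => (hsub hy).1)
    (fun y hy u hu => hpos y (hsub hy).1 u hu)
  refine ⟨κ, hκ, max Λ K, fun y hy => (hsub hy).1, hΛ1.trans (le_max_left _ _), ?_, ?_, ?_, ?_⟩
  · exact fun y hy u w => hsymm y (hsub hy).1 u w
  · intro y hy u
    refine (hlow y hy u).trans (mul_le_mul_of_nonneg_right (le_max_left _ _) ?_)
    by_contra h
    push Not at h
    have := hlow y hy u
    nlinarith [sq_nonneg ‖u‖]
  · exact fun y hy => (hup y hy).trans (le_max_left _ _)
  · intro y hy z hz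
    have := hLip.dist_le_mul y (hsub hy).2 z (hsub hz).2
    rw [dist_eq_norm, dist_eq_norm] at this
    exact this.trans (by gcongr; exact le_max_right _ _)

end ChartEnergy

/-! ### Stationarity tested with radial fields -/

lemma nonneg_of_hasDerivAt_of_eventually_nonneg {g : ℝ → ℝ} {g' : ℝ} (hg : HasDerivAt g g' 0)
    (h0 : g 0 = 0) (h : ∀ᶠ t in 𝓝[>] (0 : ℝ), 0 ≤ g t) : 0 ≤ g' := by
  refine ge_of_tendsto hg.tendsto_slope_zero_right ?_
  filter_upwards [h, self_mem_nhdsWithin] with t ht ht0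
  rw [zero_add, h0, sub_zero, smul_eq_mul]
  exact mul_nonneg (inv_nonneg.2 (le_of_lt ht0)) ht

section FirstVariation

variable {m n : ℕ} [NeZero m] {M : Type*} [EMetricSpace M] [ChartedSpace (EuclideanHalfSpace m) M]
  [IsManifold (𝓡∂ m) ∞ M] [RiemannianBundle (fun x : M => TangentSpace (𝓡∂ m) x)]
  [IsContMDiffRiemannianBundle (𝓡∂ m) ∞ (EuclideanSpace ℝ (Fin m))
      (fun x : M => TangentSpace (𝓡∂ m) x)]
  [MeasurableSpace M] [BorelSpace M] [SecondCountableTopology M]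

attribute [local instance] isManifold_one

lemma target_inter_preimage_image {q : M} {S : Set (Eu m)}
    (hS : S ⊆ (extChartAt (𝓡∂ m) q).target) :
    (extChartAt (𝓡∂ m) q).target ∩
      (extChartAt (𝓡∂ m) q).symm ⁻¹' ((extChartAt (𝓡∂ m) q).symm '' S) = S := by
  ext y
  constructor
  · rintro ⟨hy, z, hz, hzy⟩
    have := (extChartAt (𝓡∂ m) q).symm.injOn (by simpa using hS hz) (by simpa using hy) hzy
    exact this ▸ hz
  · exact fun hy => ⟨hS hy, mem_image_of_mem _ hy⟩

/-- The energy of a subset of a chart domain, as an integral against Lebesgue measure. -/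
lemma energy_image_symm {β : ℝ} {v : M → EuclideanSpace ℝ (Fin n)} {q : M} {S : Set (Eu m)}
    (hSc : IsCompact S) (hS : S ⊆ (extChartAt (𝓡∂ m) q).target) :
    energy m β ((extChartAt (𝓡∂ m) q).symm '' S) v =
      (1 / 2) * ∫ y in S, chartEnergyDensity β v q y := by
  have hK : IsCompact ((extChartAt (𝓡∂ m) q).symm '' S) :=
    hSc.image_of_continuousOn ((continuousOn_extChartAt_symm q).mono hS)
  rw [energy, setIntegral_riemVolume q hK.measurableSet, target_inter_preimage_image hS]
  · congr 1
    exact setIntegral_congr_fun hSc.measurableSet fun y hy => volDensity_mul_energyDensity (hS hy)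
  · rintro _ ⟨y, hy, rfl⟩
    exact (extChartAt (𝓡∂ m) q).map_target (hS hy)

lemma integrableOn_chartEnergyDensity {β : ℝ} {v : M → EuclideanSpace ℝ (Fin n)} {q : M}
    {S : Set (Eu m)} (hSc : IsCompact S) (hS : S ⊆ (extChartAt (𝓡∂ m) q).target)
    (hint : ∀ K : Set M, IsCompact K → IntegrableOn (energyDensity m β v) K (riemVolume m M)) :
    IntegrableOn (chartEnergyDensity β v q) S := by
  have hK : IsCompact ((extChartAt (𝓡∂ m) q).symm '' S) :=
    hSc.image_of_continuousOn ((continuousOn_extChartAt_symm q).mono hS)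
  have := (integrableOn_riemVolume_iff q hK.measurableSet (by
    rintro _ ⟨y, hy, rfl⟩
    exact (extChartAt (𝓡∂ m) q).map_target (hS hy)) _).1 (hint _ hK)
  rw [target_inter_preimage_image hS] at this
  exact this.congr_fun (fun y hy => volDensity_mul_energyDensity (hS hy)) hSc.measurableSet

/-- The energy density in a chart of `v ∘ Φ`, for a diffeomorphism `Φ` which is `F` in the chart.
The weight is evaluated at the original point, the differential of `v` at its image. -/
lemma chartEnergyDensity_comp_ae {β : ℝ} {v : M → EuclideanSpace ℝ (Fin n)}
    (hv : ∃ Dv, HasWeakDifferential (m := m) v Dv) (q : M) (Φ : M ≃ₘ^∞⟮𝓡∂ m, 𝓡∂ m⟯ M)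
    {F : Eu m → Eu m} (hF : ∀ y ∈ (extChartAt (𝓡∂ m) q).target,
      F y ∈ (extChartAt (𝓡∂ m) q).target ∧
        Φ ((extChartAt (𝓡∂ m) q).symm y) = (extChartAt (𝓡∂ m) q).symm (F y)) :
    ∀ᵐ y, y ∈ (extChartAt (𝓡∂ m) q).target →
      chartEnergyDensity β (fun x => v (Φ x)) q y =
        bdryDist m ((extChartAt (𝓡∂ m) q).symm y) ^ β * coeffEnergy (coeffOp (m := m) q y)
          (fun i => ∑ j, (fderiv ℝ F y (stdVec i)) j •
            weakDifferential v ((extChartAt (𝓡∂ m) q).symm (F y))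
              (partialVec (m := m) q ((extChartAt (𝓡∂ m) q).symm (F y)) j)) := by
  have h1 := fun i => weakDifferential_comp_ae hv Φ q i
  filter_upwards [ae_all_iff.2 h1, ae_mem_interior_target q] with y hy hyi hyT
  have hyI := hyi hyT
  have hΦs : Φ ((extChartAt (𝓡∂ m) q).symm y) ∈ (extChartAt (𝓡∂ m) q).source := by
    rw [(hF y hyT).2]
    exact (extChartAt (𝓡∂ m) q).map_target (hF y hyT).1
  have hfd : fderivWithin ℝ (fun z => extChartAt (𝓡∂ m) q (Φ ((extChartAt (𝓡∂ m) q).symm z)))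
      (range (𝓡∂ m)) y = fderiv ℝ F y := by
    rw [fderivWithin_of_mem_nhds (range_mem_nhds_of_mem_interior_target hyI)]
    refine Filter.EventuallyEq.fderiv_eq ?_
    filter_upwards [mem_interior_iff_mem_nhds.1 hyI] with z hz
    rw [(hF z hz).2, (extChartAt (𝓡∂ m) q).right_inv (hF z hz).1]
  have e : ∀ x, x = (extChartAt (𝓡∂ m) q).symm (F y) → ∀ j,
      weakDifferential v x (partialVec (m := m) q x j) =
        weakDifferential v ((extChartAt (𝓡∂ m) q).symm (F y))
          (partialVec (m := m) q ((extChartAt (𝓡∂ m) q).symm (F y)) j) := by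
    rintro x rfl j
    rfl
  rw [chartEnergyDensity]
  congr 2
  ext1 i
  rw [hy i hyT hΦs, hfd]
  exact Finset.sum_congr rfl fun j _ => by rw [e _ (hF y hyT).2]

/-- Stationarity tested with a radial field. The weight enters only through its growth along rays
issuing from the centre. By `hcase` the field is either tangent to the boundary or supported away
from it. -/
lemma IsInnerStationaryFree.integral_variationWeight_nonneg {β : ℝ}
    {v : M → EuclideanSpace ℝ (Fin n)} (hst : IsInnerStationaryFree m β v)
    (hv : ∃ Dv, HasWeakDifferential (m := m) v Dv)
    (hint : ∀ K : Set M, IsCompact K → IntegrableOn (energyDensity m β v) K (riemVolume m M))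
    {q : M} {D : Set (Eu m)} {Λ : ℝ} (hD : D ⊆ (extChartAt (𝓡∂ m) q).target)
    (hE : IsEllipticOn D (coeffOp (m := m) q) Λ) {x₀ : Eu m} (hx₀ : x₀ ∈ D)
    {Q : Eu m →L[ℝ] Eu m} (hQ : IsSymmInverse (coeffOp (m := m) q x₀) Q) {r : ℝ} (hr : 0 < r)
    (hZD : {y | ellipForm Q x₀ r y ≤ 1} ∩ {y | 0 ≤ y 0} ⊆ D)
    (hcase : x₀ 0 = 0 ∨ {y | ellipForm Q x₀ r y ≤ 1} ⊆ {y | 0 ≤ y 0})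
    {κ C₀ : ℝ} (hC₀ : 0 ≤ C₀)
    (hw : ∀ x ∈ {y | ellipForm Q x₀ r y ≤ 1} ∩ {y | 0 ≤ y 0}, ∀ l : ℝ, 1 ≤ l → l ≤ 2 →
      x₀ + l • (x - x₀) ∈ {y | ellipForm Q x₀ r y ≤ 1} ∩ {y | 0 ≤ y 0} →
      bdryDist m ((extChartAt (𝓡∂ m) q).symm x) ^ β ≤
        bdryDist m ((extChartAt (𝓡∂ m) q).symm (x₀ + l • (x - x₀))) ^ β *
          Real.exp (κ * (l - 1) + C₀ * (l - 1) ^ 2)) :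
    0 ≤ ∫ y in {y | ellipForm Q x₀ r y ≤ 1} ∩ {y | 0 ≤ y 0}, chartEnergyDensity β v q y *
      variationWeight Q x₀ r (m - 2 - κ - Λ ^ 4 * r) (16 * Λ ^ 9 * r) y := by
  set Z := {y | ellipForm Q x₀ r y ≤ 1} with hZ
  set S := Z ∩ {y | 0 ≤ y 0} with hS
  have hZc : IsCompact Z := hE.isCompact_ellipsoid hx₀ hQ hr
  have hSc : IsCompact S := hZc.inter_right
    (isClosed_le continuous_const (EuclideanSpace.proj (𝕜 := ℝ) (0 : Fin m)).continuous)
  have hST : S ⊆ (extChartAt (𝓡∂ m) q).target := hZD.trans hD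
  have hint' := integrableOn_chartEnergyDensity hSc hST hint
  obtain ⟨s₀, hs₀, C, hC, hvar⟩ := hE.exists_integral_variation_le (n := n) hx₀ hQ hr
    hSc.measurableSet inter_subset_left hZD
    (w := fun y => bdryDist m ((extChartAt (𝓡∂ m) q).symm y) ^ β)
    (fun x _ => Real.rpow_nonneg ENNReal.toReal_nonneg _) hC₀ hw
    (P := fun i y => weakDifferential v ((extChartAt (𝓡∂ m) q).symm y)
      (partialVec (m := m) q ((extChartAt (𝓡∂ m) q).symm y) i)) hint'
  have hpres : (∃ ε > 0, ∀ σ : ℝ, |σ| ≤ ε → ∀ y ∈ Z,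
      0 ≤ (y + σ • radialField Q x₀ r y) 0 ↔ 0 ≤ y 0) ∨ Z ⊆ {y | 0 ≤ y 0} := by
    refine hcase.imp (fun h0 => ⟨1 / 2, by norm_num, fun σ hσ y _ => ?_⟩) id
    have h1 : (y + σ • radialField Q x₀ r y) 0 =
        (1 + σ * cutoff (ellipForm Q x₀ r y)) * y 0 := by
      simp [radialField, h0]
      ring
    have h2 : 0 < 1 + σ * cutoff (ellipForm Q x₀ r y) := by
      have := cutoff_nonneg (ellipForm Q x₀ r y)
      have := cutoff_le_one (ellipForm Q x₀ r y)
      have := abs_le.1 hσ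
      nlinarith
    rw [h1]
    exact mul_nonneg_iff_of_pos_left h2
  obtain ⟨Φ, σ, hΦ, hΦ0, hΦid, hσ, hσ0, hΦF, hinj, himg⟩ := exists_diffeomorph_family hZc hST
    contDiff_radialField (fun y hy => radialField_eq_zero hy) hpres
  have hK : IsCompact ((extChartAt (𝓡∂ m) q).symm '' S) :=
    hSc.image_of_continuousOn ((continuousOn_extChartAt_symm q).mono hST)
  have hder := hst _ Φ hK hΦ hΦ0 hΦid
  set B := ∫ y in S, chartEnergyDensity β v q y *
      variationWeight Q x₀ r (m - 2 - κ - Λ ^ 4 * r) (16 * Λ ^ 9 * r) y with hB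
  -- the energy of the variation is below a differentiable function that touches it at `t = 0`
  have hle : ∀ t, 0 ≤ σ t → σ t ≤ s₀ →
      energy m β ((extChartAt (𝓡∂ m) q).symm '' S) (fun x => v (Φ t x)) ≤
      energy m β ((extChartAt (𝓡∂ m) q).symm '' S) v + (1 / 2) * (σ t * B + C * σ t ^ 2) := by
    intro t ht hts
    rw [energy_image_symm hSc hST, energy_image_symm hSc hST]
    have h1 := hvar (σ t) ht hts (hinj t) (himg t)
    have h2 : ∫ y in S, chartEnergyDensity β (fun x => v (Φ t x)) q y = _ :=
      setIntegral_congr_ae hSc.measurableSet (by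
        filter_upwards [chartEnergyDensity_comp_ae (β := β) hv q (Φ t) (hΦF t)] with y hy hyS
        exact hy (hST hyS))
    rw [h2]
    have h3 : ∫ y in S, chartEnergyDensity β v q y = _ := rfl
    refine (mul_le_mul_of_nonneg_left h1 (by norm_num : (0 : ℝ) ≤ 1 / 2)).trans (le_of_eq ?_)
    rw [hB]
    simp only [chartEnergyDensity]
    ring
  have hE0 : energy m β ((extChartAt (𝓡∂ m) q).symm '' S) (fun x => v (Φ 0 x)) =
      energy m β ((extChartAt (𝓡∂ m) q).symm '' S) v := by
    simp only [hΦ0]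
  have hg : HasDerivAt (fun t => energy m β ((extChartAt (𝓡∂ m) q).symm '' S) v +
      (1 / 2) * (σ t * B + C * σ t ^ 2) -
      energy m β ((extChartAt (𝓡∂ m) q).symm '' S) (fun x => v (Φ t x))) ((1 / 2) * B) 0 := by
    have h1 := ((((hσ.mul_const B).add ((hσ.pow 2).const_mul C)).const_mul (1 / 2)).const_add
      (energy m β ((extChartAt (𝓡∂ m) q).symm '' S) v)).sub hder
    refine h1.congr_deriv ?_
    simp [hσ0]
  have hpos : ∀ᶠ t in 𝓝[>] (0 : ℝ), 0 ≤ σ t ∧ σ t ≤ s₀ := by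
    have h1 : ∀ᶠ t in 𝓝[>] (0 : ℝ), 0 < t⁻¹ • (σ (0 + t) - σ 0) :=
      hσ.tendsto_slope_zero_right.eventually (lt_mem_nhds one_pos)
    have h2 : ∀ᶠ t in 𝓝[>] (0 : ℝ), σ t < s₀ :=
      nhdsWithin_le_nhds (hσ.continuousAt.eventually (gt_mem_nhds (by rwa [hσ0])))
    filter_upwards [h1, h2, self_mem_nhdsWithin] with t ht1 ht2 ht0
    refine ⟨?_, ht2.le⟩
    rw [zero_add, hσ0, sub_zero, smul_eq_mul] at ht1
    exact (pos_of_mul_pos_right ht1 (inv_nonneg.2 (le_of_lt ht0))).le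
  have := nonneg_of_hasDerivAt_of_eventually_nonneg hg (by rw [hE0, hσ0]; ring) (by
    filter_upwards [hpos] with t ht
    linarith [hle t ht.1 ht.2])
  linarith

end FirstVariation

/-! ### Growth of the energy of ellipsoids -/

section Growth

variable {m : ℕ} {Q : Eu m →L[ℝ] Eu m} {x₀ : Eu m} {S : Set (Eu m)} {f : Eu m → ℝ}

lemma ellipForm_eq (r : ℝ) (y : Eu m) : ellipForm Q x₀ r y = ellipForm Q x₀ 1 y / r ^ 2 := by
  simp [ellipForm]

/-- The energy localized to an ellipsoid by the smooth cutoff. -/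
def smoothedEnergy (f : Eu m → ℝ) (S : Set (Eu m)) (Q : Eu m →L[ℝ] Eu m) (x₀ : Eu m) (r : ℝ) : ℝ :=
  ∫ y in S, f y * cutoff (ellipForm Q x₀ r y)

lemma integrableOn_mul_cutoff (hf : IntegrableOn f S) (r : ℝ) :
    IntegrableOn (fun y => f y * cutoff (ellipForm Q x₀ r y)) S :=
  Integrable.mul_bdd (c := 1) hf
    (contDiff_cutoff.continuous.comp contDiff_ellipForm.continuous).aestronglyMeasurable
    (Filter.Eventually.of_forall fun y => by
      simpa [abs_of_nonneg (cutoff_nonneg _)] using cutoff_le_one _)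

lemma exists_mul_deriv_cutoff_bound : ∃ K > 0, ∀ τ, 0 ≤ τ → |τ * deriv cutoff τ| ≤ K := by
  obtain ⟨K, hK, h⟩ := exists_deriv_cutoff_bound
  refine ⟨K, hK, fun τ hτ => ?_⟩
  rcases le_total 1 τ with h1 | h1
  · rw [deriv_cutoff_eq_zero_of_ge h1]; simpa using hK.le
  · rw [abs_mul, abs_of_nonneg hτ, ← one_mul K]
    exact mul_le_mul h1 (h τ) (abs_nonneg _) zero_le_one

lemma integrableOn_mul_deriv_cutoff (hf : IntegrableOn f S)
    (hq : ∀ y, 0 ≤ ellipForm Q x₀ 1 y) (r : ℝ) :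
    IntegrableOn (fun y => f y * (ellipForm Q x₀ r y * deriv cutoff (ellipForm Q x₀ r y))) S := by
  obtain ⟨K, hK, h⟩ := exists_mul_deriv_cutoff_bound
  refine Integrable.mul_bdd (c := K) hf (contDiff_ellipForm.continuous.mul
    (contDiff_deriv_cutoff.continuous.comp contDiff_ellipForm.continuous)).aestronglyMeasurable
    (Filter.Eventually.of_forall fun y => ?_)
  exact h _ (by rw [ellipForm_eq]; exact div_nonneg (hq y) (sq_nonneg _))

/-- Differentiation under the integral: `r ∂_r` acts on functions of `ellipForm Q x₀ r y` as
`-2 q ∂_q`, so the derivative of the smoothed energy is the second term of the first variation. -/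
lemma hasDerivAt_smoothedEnergy (hf : IntegrableOn f S)
    (hq : ∀ y, 0 ≤ ellipForm Q x₀ 1 y) {r : ℝ} (hr : 0 < r) :
    HasDerivAt (smoothedEnergy f S Q x₀)
      (-(2 / r) * ∫ y in S, f y * (ellipForm Q x₀ r y * deriv cutoff (ellipForm Q x₀ r y))) r := by
  obtain ⟨K, hK, h⟩ := exists_mul_deriv_cutoff_bound
  have hd : ∀ y, ∀ s : ℝ, 0 < s → HasDerivAt (fun s => f y * cutoff (ellipForm Q x₀ s y))
      (f y * (-(2 / s) * (ellipForm Q x₀ s y * deriv cutoff (ellipForm Q x₀ s y)))) s := by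
    intro y s hs
    have h1 : HasDerivAt (fun s => ellipForm Q x₀ s y) (-(2 / s) * ellipForm Q x₀ s y) s := by
      have h2 : HasDerivAt (fun s => ellipForm Q x₀ 1 y / s ^ 2)
          ((0 * s ^ 2 - ellipForm Q x₀ 1 y * (2 * s)) / (s ^ 2) ^ 2) s := by
        refine ((hasDerivAt_const s (ellipForm Q x₀ 1 y)).div (hasDerivAt_pow 2 s)
          (pow_ne_zero 2 hs.ne')).congr_deriv ?_
        simp
      have h3 : (fun s => ellipForm Q x₀ s y) = fun s => ellipForm Q x₀ 1 y / s ^ 2 := by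
        ext s; exact ellipForm_eq s y
      rw [h3]
      refine h2.congr_deriv ?_
      rw [ellipForm_eq s]
      field_simp
      ring
    have h4 := ((differentiable_cutoff (ellipForm Q x₀ s y)).hasDerivAt.comp s h1).const_mul (f y)
    refine h4.congr_deriv ?_
    ring
  have key := hasDerivAt_integral_of_dominated_loc_of_deriv_le (μ := volume.restrict S)
    (F := fun s y => f y * cutoff (ellipForm Q x₀ s y))
    (F' := fun s y => f y * (-(2 / s) * (ellipForm Q x₀ s y * deriv cutoff (ellipForm Q x₀ s y))))
    (x₀ := r) (s := Ioi (r / 2)) (bound := fun y => ‖f y‖ * (4 / r * K))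
    (Ioi_mem_nhds (by linarith))
    (Filter.Eventually.of_forall fun s => (integrableOn_mul_cutoff hf s).aestronglyMeasurable)
    (integrableOn_mul_cutoff hf r) ?_ ?_ (hf.norm.mul_const _) ?_
  · refine key.2.congr_deriv ?_
    rw [← integral_const_mul]
    congr 1
    ext y
    ring
  · have := ((integrableOn_mul_deriv_cutoff hf hq r).const_mul (-(2 / r))).aestronglyMeasurable
    refine this.congr (Filter.Eventually.of_forall fun y => ?_)
    simp only
    ring
  · refine Filter.Eventually.of_forall fun y s hs => ?_
    have hs0 : 0 < s := lt_trans (by positivity) hs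
    rw [norm_mul, norm_mul]
    refine mul_le_mul_of_nonneg_left ?_ (norm_nonneg _)
    refine mul_le_mul ?_ (h _ (by rw [ellipForm_eq]; exact div_nonneg (hq y) (sq_nonneg _)))
      (norm_nonneg _) (by positivity)
    rw [norm_neg, Real.norm_eq_abs, abs_of_pos (by positivity), div_le_div_iff₀ hs0 hr]
    have : r / 2 < s := hs
    linarith
  · exact Filter.Eventually.of_forall fun y s hs => hd y s (lt_trans (by positivity) hs)

lemma smoothedEnergy_nonneg (hS : MeasurableSet S) (hf0 : ∀ y ∈ S, 0 ≤ f y) (r : ℝ) :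
    0 ≤ smoothedEnergy f S Q x₀ r :=
  setIntegral_nonneg hS fun y hy => mul_nonneg (hf0 y hy) (cutoff_nonneg _)

/-- Integration of the differential inequality `(a - c r) I ≤ (1 + c r / 2) r I'` for the smoothed
energy, which the first variation inequality amounts to. -/
lemma smoothedEnergy_le (hS : MeasurableSet S) (hf : IntegrableOn f S) (hf0 : ∀ y ∈ S, 0 ≤ f y)
    (hq : ∀ y, 0 ≤ ellipForm Q x₀ 1 y) {a c r₁ : ℝ} (ha : 0 ≤ a) (hc : 0 ≤ c)
    (hvar : ∀ r, 0 < r → r ≤ r₁ → ∃ a' c', a - c * r ≤ a' ∧ c' ≤ c * r ∧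
      0 ≤ ∫ y in S, f y * variationWeight Q x₀ r a' c' y)
    {t r : ℝ} (ht : 0 < t) (htr : t ≤ r) (hr : r ≤ r₁) :
    smoothedEnergy f S Q x₀ t ≤
      Real.exp (c * (1 + a / 2) * r) * (t / r) ^ a * smoothedEnergy f S Q x₀ r := by
  -- `I` is the smoothed energy, and its derivative is `-2 J / r`
  set I := smoothedEnergy f S Q x₀ with hI
  have hI0 : ∀ s, 0 ≤ I s := smoothedEnergy_nonneg hS hf0
  set J : ℝ → ℝ := fun s =>
    ∫ y in S, f y * (ellipForm Q x₀ s y * deriv cutoff (ellipForm Q x₀ s y)) with hJ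
  have hJ0 : ∀ s, J s ≤ 0 := fun s => by
    have : ∀ y ∈ S, 0 ≤ -(f y * (ellipForm Q x₀ s y * deriv cutoff (ellipForm Q x₀ s y))) := by
      intro y hy
      have h1 : 0 ≤ ellipForm Q x₀ s y := by
        rw [ellipForm_eq]; exact div_nonneg (hq y) (sq_nonneg _)
      rw [neg_nonneg]
      exact mul_nonpos_of_nonneg_of_nonpos (hf0 y hy)
        (mul_nonpos_of_nonneg_of_nonpos h1 (deriv_cutoff_nonpos _))
    have := setIntegral_nonneg (μ := volume) hS this
    rw [integral_neg] at this
    exact neg_nonneg.1 this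
  have hder : ∀ s, 0 < s → HasDerivAt I (-(2 / s) * J s) s := fun s hs =>
    hasDerivAt_smoothedEnergy hf hq hs
  set c' := c * (1 + a / 2) with hc'
  -- the differential inequality `(a - c' s) I(s) ≤ -2 J(s)`
  have hineq : ∀ s, 0 < s → s ≤ r₁ → (a - c' * s) * I s ≤ -2 * J s := by
    intro s hs hs1
    obtain ⟨a₁, c₁, ha₁, hc₁, h0⟩ := hvar s hs hs1
    have e : ∫ y in S, f y * variationWeight Q x₀ s a₁ c₁ y = -a₁ * I s - (2 + c₁) * J s := by
      rw [hI, smoothedEnergy, hJ, ← integral_const_mul, ← integral_const_mul, ← integral_sub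
        ((integrableOn_mul_cutoff hf s).const_mul _)
        ((integrableOn_mul_deriv_cutoff hf hq s).const_mul _)]
      congr 1
      ext y
      rw [variationWeight]
      ring
    rw [e] at h0
    have h1 : (a - c * s) * I s ≤ (1 + c * s / 2) * (-2 * J s) := by
      have h2 : (a - c * s) * I s ≤ a₁ * I s := mul_le_mul_of_nonneg_right ha₁ (hI0 s)
      have h3 : c₁ * (-J s) ≤ c * s * (-J s) :=
        mul_le_mul_of_nonneg_right hc₁ (neg_nonneg.2 (hJ0 s))
      linarith
    have hcs : 0 ≤ c * s := by positivity
    have h4 : (1 + c * s / 2) * ((a - c' * s) * I s) ≤ (a - c * s) * I s := by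
      rw [← mul_assoc]
      refine mul_le_mul_of_nonneg_right ?_ (hI0 s)
      rw [hc']
      nlinarith [mul_nonneg hcs hcs, mul_nonneg ha (mul_nonneg hcs hcs)]
    exact le_of_mul_le_mul_left (h4.trans h1) (by positivity)
  -- hence `exp (c' s) s ^ (-a) I(s)` is nondecreasing
  have hr0 : 0 < r := ht.trans_le htr
  have hG : ∀ s, 0 < s → HasDerivAt (fun s => Real.exp (c' * s) * s ^ (-a) * I s)
      ((Real.exp (c' * s) * c' * s ^ (-a) + Real.exp (c' * s) * (-a * s ^ (-a - 1))) * I s +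
        Real.exp (c' * s) * s ^ (-a) * (-(2 / s) * J s)) s := by
    intro s hs
    have h1 : HasDerivAt (fun s => Real.exp (c' * s)) (Real.exp (c' * s) * c') s := by
      simpa using ((hasDerivAt_id s).const_mul c').exp
    have h2 : HasDerivAt (fun s : ℝ => s ^ (-a)) (-a * s ^ (-a - 1)) s :=
      Real.hasDerivAt_rpow_const (Or.inl hs.ne')
    exact (h1.mul h2).mul (hder s hs)
  have hmono : MonotoneOn (fun s => Real.exp (c' * s) * s ^ (-a) * I s) (Icc t r) := by
    refine monotoneOn_of_deriv_nonneg (convex_Icc t r) ?_ ?_ ?_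
    · exact fun s hs => (hG s (ht.trans_le hs.1)).continuousAt.continuousWithinAt
    · rw [interior_Icc]
      exact fun s hs => (hG s (ht.trans hs.1)).differentiableAt.differentiableWithinAt
    · rw [interior_Icc]
      intro s hs
      have hs0 := ht.trans hs.1
      rw [(hG s hs0).deriv]
      have h1 : s ^ (-a - 1) = s ^ (-a) / s := by rw [Real.rpow_sub_one hs0.ne']
      rw [h1]
      have h2 : (Real.exp (c' * s) * c' * s ^ (-a) +
          Real.exp (c' * s) * (-a * (s ^ (-a) / s))) * I s +
          Real.exp (c' * s) * s ^ (-a) * (-(2 / s) * J s) =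
          Real.exp (c' * s) * s ^ (-a) / s * (-2 * J s - (a - c' * s) * I s) := by
        field_simp
        ring
      rw [h2]
      have h3 := hineq s hs0 (hs.2.le.trans hr)
      exact mul_nonneg (by positivity) (by linarith)
  have h1 := hmono ⟨le_rfl, htr⟩ ⟨htr, le_rfl⟩ htr
  simp only at h1
  have h2 : 1 ≤ Real.exp (c' * t) := Real.one_le_exp (by positivity)
  have h3 : t ^ (-a) * I t ≤ Real.exp (c' * r) * r ^ (-a) * I r := by
    refine le_trans ?_ h1
    rw [mul_assoc]
    exact le_mul_of_one_le_left (mul_nonneg (Real.rpow_nonneg ht.le _) (hI0 t)) h2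
  have h4 : (t / r) ^ a = t ^ a * r ^ (-a) := by
    rw [Real.div_rpow ht.le hr0.le, Real.rpow_neg hr0.le, div_eq_mul_inv]
  have h5 : t ^ a * t ^ (-a) = 1 := by
    rw [← Real.rpow_add ht, add_neg_cancel, Real.rpow_zero]
  calc I t = t ^ a * (t ^ (-a) * I t) := by rw [← mul_assoc, h5, one_mul]
    _ ≤ t ^ a * (Real.exp (c' * r) * r ^ (-a) * I r) := by gcongr
    _ = _ := by rw [h4]; ring

/-- Growth of the energy of the ellipsoids themselves. -/
lemma setIntegral_ellipsoid_le (hS : MeasurableSet S) (hf : IntegrableOn f S)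
    (hf0 : ∀ y ∈ S, 0 ≤ f y)
    (hq : ∀ y, 0 ≤ ellipForm Q x₀ 1 y) {a c r₁ : ℝ} (ha : 0 ≤ a) (hc : 0 ≤ c)
    (hvar : ∀ r, 0 < r → r ≤ r₁ → ∃ a' c', a - c * r ≤ a' ∧ c' ≤ c * r ∧
      0 ≤ ∫ y in S, f y * variationWeight Q x₀ r a' c' y)
    {t r : ℝ} (ht : 0 < t) (htr : t ≤ r) (hr : r ≤ r₁) :
    ∫ y in S ∩ {y | ellipForm Q x₀ t y ≤ 1 / 4}, f y ≤
      Real.exp (c * (1 + a / 2) * r) * (t / r) ^ a *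
        ∫ y in S ∩ {y | ellipForm Q x₀ r y ≤ 1}, f y := by
  have hm : ∀ r b, MeasurableSet (S ∩ {y | ellipForm Q x₀ r y ≤ b}) := fun r b =>
    hS.inter (isClosed_le contDiff_ellipForm.continuous continuous_const).measurableSet
  have h1 : ∫ y in S ∩ {y | ellipForm Q x₀ t y ≤ 1 / 4}, f y ≤ smoothedEnergy f S Q x₀ t := by
    calc _ = ∫ y in S ∩ {y | ellipForm Q x₀ t y ≤ 1 / 4}, f y * cutoff (ellipForm Q x₀ t y) :=
          setIntegral_congr_fun (hm _ _) fun y hy => by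
            rw [cutoff_eq_one hy.2, mul_one]
      _ ≤ _ := by
          refine setIntegral_mono_set (integrableOn_mul_cutoff hf t) ?_
            (Filter.Eventually.of_forall inter_subset_left)
          filter_upwards [ae_restrict_mem hS] with y hy
          exact mul_nonneg (hf0 y hy) (cutoff_nonneg _)
  have h2 : smoothedEnergy f S Q x₀ r ≤ ∫ y in S ∩ {y | ellipForm Q x₀ r y ≤ 1}, f y := by
    have e : smoothedEnergy f S Q x₀ r =
        ∫ y in S ∩ {y | ellipForm Q x₀ r y ≤ 1}, f y * cutoff (ellipForm Q x₀ r y) := by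
      refine setIntegral_eq_of_subset_of_forall_sdiff_eq_zero hS inter_subset_left fun y hy => ?_
      have : ¬ ellipForm Q x₀ r y ≤ 1 := fun h => hy.2 ⟨hy.1, h⟩
      rw [cutoff_eq_zero (not_le.1 this).le, mul_zero]
    rw [e]
    refine setIntegral_mono_on ((integrableOn_mul_cutoff hf r).mono_set inter_subset_left)
      (hf.mono_set inter_subset_left) (hm _ _) fun y hy => ?_
    exact mul_le_of_le_one_right (hf0 y hy.1) (cutoff_le_one _)
  refine h1.trans ((smoothedEnergy_le hS hf hf0 hq ha hc hvar ht htr hr).trans ?_)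
  have : 0 < r := ht.trans_le htr
  gcongr

end Growth

/-! ### Riemannian distances in a chart -/

section Distance

variable {m : ℕ} [NeZero m] {M : Type*} [EMetricSpace M] [ChartedSpace (EuclideanHalfSpace m) M]
  [IsManifold (𝓡∂ m) ∞ M] [RiemannianBundle (fun x : M => TangentSpace (𝓡∂ m) x)]

attribute [local instance] isManifold_one

/-- The Riemannian length of a curve which is given in a chart, over the interval `[0, 1]`. -/
def chartLength (q : M) (g : ℝ → Eu m) : ℝ≥0∞ :=
  ∫⁻ t in Icc (0 : ℝ) 1, ‖coordVec q ((extChartAt (𝓡∂ m) q).symm (g t))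
    (derivWithin g (Icc 0 1) t)‖ₑ

lemma pathELength_symm_comp {q : M} {g : ℝ → Eu m} (hg : ContDiffOn ℝ 1 g (Icc 0 1))
    (hT : MapsTo g (Icc 0 1) (extChartAt (𝓡∂ m) q).target) :
    pathELength (𝓡∂ m) (fun t => (extChartAt (𝓡∂ m) q).symm (g t)) 0 1 = chartLength q g := by
  rw [pathELength_eq_lintegral_mfderivWithin_Icc, chartLength]
  refine setLIntegral_congr_fun measurableSet_Icc fun t ht => ?_
  have h1 := mdifferentiableWithinAt_extChartAt_symm (I := 𝓡∂ m) (hT ht)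
  have h2 : MDifferentiableWithinAt 𝓘(ℝ, ℝ) 𝓘(ℝ, Eu m) g (Icc 0 1) t :=
    ((hg t ht).differentiableWithinAt (by simp)).mdifferentiableWithinAt
  have hu : UniqueMDiffWithinAt 𝓘(ℝ, ℝ) (Icc (0 : ℝ) 1) t :=
    uniqueMDiffWithinAt_iff_uniqueDiffWithinAt.2 (uniqueDiffOn_Icc zero_lt_one t ht)
  have h3 : mfderivWithin 𝓘(ℝ, ℝ) (𝓡∂ m) ((extChartAt (𝓡∂ m) q).symm ∘ g) (Icc 0 1) t =
      (mfderivWithin 𝓘(ℝ, Eu m) (𝓡∂ m) (extChartAt (𝓡∂ m) q).symm (range (𝓡∂ m)) (g t)).comp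
        (mfderivWithin 𝓘(ℝ, ℝ) 𝓘(ℝ, Eu m) g (Icc 0 1) t) :=
    mfderivWithin_comp t h1 h2
      (fun s hs => extChartAt_target_subset_range q (hT hs)) hu
  have e3 : ∀ w : Eu m, coordVec q ((extChartAt (𝓡∂ m) q).symm (g t)) w =
      mfderivWithin 𝓘(ℝ, Eu m) (𝓡∂ m) (extChartAt (𝓡∂ m) q).symm (range (𝓡∂ m)) (g t) w := by
    intro w
    rw [coordVec, (extChartAt (𝓡∂ m) q).right_inv (hT ht)]
  rw [e3]
  have h4 := congrArg (fun L => L 1) h3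
  rw [mfderivWithin_eq_fderivWithin] at h4
  rw [← fderivWithin_derivWithin]
  exact congrArg (fun w : TangentSpace (𝓡∂ m) ((extChartAt (𝓡∂ m) q).symm (g t)) => ‖w‖ₑ) h4

variable [IsRiemannianManifold (𝓡∂ m) M]

lemma edist_le_chartLength {q : M} {g : ℝ → Eu m} (hg : ContDiffOn ℝ 1 g (Icc 0 1))
    (hT : MapsTo g (Icc 0 1) (extChartAt (𝓡∂ m) q).target) :
    edist ((extChartAt (𝓡∂ m) q).symm (g 0)) ((extChartAt (𝓡∂ m) q).symm (g 1)) ≤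
      chartLength q g := by
  rw [IsRiemannianManifold.out (I := 𝓡∂ m), ← pathELength_symm_comp hg hT]
  refine riemannianEDist_le_pathELength ?_ rfl rfl zero_le_one
  exact (contMDiffOn_extChartAt_symm q).comp hg.contMDiffOn hT

/-- A chart around `q` in which the metric is comparable to the Euclidean one on the half ball of
radius `κ`, with Lipschitz coefficients, all constants being controlled by `μ`; this half ball
contains the Riemannian ball of radius `4ρ` about `q`. Around an interior point the half ball stays
away from the boundary. -/
structure IsGoodChart [MeasurableSpace M] (q : M) (κ μ ρ : ℝ) : Prop where
  κ_pos : 0 < κ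
  ρ_pos : 0 < ρ
  one_le : 1 ≤ μ
  subset_target : halfBall (extChartAt (𝓡∂ m) q q) κ ⊆ (extChartAt (𝓡∂ m) q).target
  elliptic : IsEllipticOn (halfBall (extChartAt (𝓡∂ m) q q) κ) (coeffOp (m := m) q) μ
  norm_coordVec_le : ∀ y ∈ halfBall (extChartAt (𝓡∂ m) q q) κ, ∀ w : Eu m,
    ‖coordVec q ((extChartAt (𝓡∂ m) q).symm y) w‖ ≤ μ * ‖w‖
  norm_le_coordVec : ∀ y ∈ halfBall (extChartAt (𝓡∂ m) q q) κ, ∀ w : Eu m,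
    ‖w‖ ≤ μ * ‖coordVec q ((extChartAt (𝓡∂ m) q).symm y) w‖
  norm_coordVec_le_norm_coordVec : ∀ y ∈ halfBall (extChartAt (𝓡∂ m) q q) κ,
    ∀ z ∈ halfBall (extChartAt (𝓡∂ m) q q) κ, ∀ w : Eu m,
    ‖coordVec q ((extChartAt (𝓡∂ m) q).symm z) w‖ ≤
      (1 + μ * ‖z - y‖) * ‖coordVec q ((extChartAt (𝓡∂ m) q).symm y) w‖
  volDensity_le : ∀ y ∈ halfBall (extChartAt (𝓡∂ m) q q) κ, volDensity (m := m) q y ≤ μ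
  le_volDensity : ∀ y ∈ halfBall (extChartAt (𝓡∂ m) q q) κ, 1 ≤ μ * volDensity (m := m) q y
  eball_subset : ∀ x ∈ eball q (ENNReal.ofReal (4 * ρ)), x ∈ (extChartAt (𝓡∂ m) q).source ∧
    extChartAt (𝓡∂ m) q x ∈ halfBall (extChartAt (𝓡∂ m) q q) κ
  zero_or_pos : extChartAt (𝓡∂ m) q q 0 = 0 ∨
    ∀ y ∈ halfBall (extChartAt (𝓡∂ m) q q) κ, extChartAt (𝓡∂ m) q q 0 / 2 ≤ y 0

variable [MeasurableSpace M] {q : M} {κ μ ρ : ℝ}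

/-- Short curves starting near the centre of a good chart stay in the chart. -/
lemma IsGoodChart.exists_chart_curve (h : IsGoodChart (m := m) q κ μ ρ) {x x' : M}
    (hx : x ∈ eball q (ENNReal.ofReal (2 * ρ))) {ℓ : ℝ≥0∞} (hℓ : ℓ ≤ ENNReal.ofReal (2 * ρ))
    (hxx' : edist x x' < ℓ) :
    ∃ g : ℝ → Eu m, ContDiffOn ℝ 1 g (Icc 0 1) ∧ g 0 = extChartAt (𝓡∂ m) q x ∧
      g 1 = extChartAt (𝓡∂ m) q x' ∧
      MapsTo g (Icc 0 1) (halfBall (extChartAt (𝓡∂ m) q q) κ) ∧ chartLength q g < ℓ := by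
  rw [IsRiemannianManifold.out (I := 𝓡∂ m)] at hxx'
  obtain ⟨γ, h0, h1, hγ, hlen⟩ := exists_lt_of_riemannianEDist_lt hxx'
  have hball : ∀ t ∈ Icc (0 : ℝ) 1, γ t ∈ eball q (ENNReal.ofReal (4 * ρ)) := by
    intro t ht
    have h2 : edist x (γ t) < ENNReal.ofReal (2 * ρ) := by
      rw [IsRiemannianManifold.out (I := 𝓡∂ m)]
      refine lt_of_le_of_lt (riemannianEDist_le_pathELength
        (hγ.mono (Icc_subset_Icc le_rfl ht.2)) h0 rfl ht.1) ?_
      exact lt_of_le_of_lt (pathELength_mono le_rfl ht.2) (hlen.trans_le hℓ)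
    have h3 : ENNReal.ofReal (4 * ρ) = ENNReal.ofReal (2 * ρ) + ENNReal.ofReal (2 * ρ) := by
      have := h.ρ_pos
      rw [← ENNReal.ofReal_add (by positivity) (by positivity)]
      congr 1; ring
    rw [mem_eball, h3]
    refine lt_of_le_of_lt (edist_triangle _ x _) ?_
    rw [edist_comm (γ t)]
    exact ENNReal.add_lt_add h2 hx
  have hsrc : ∀ t ∈ Icc (0 : ℝ) 1, γ t ∈ (extChartAt (𝓡∂ m) q).source := fun t ht =>
    (h.eball_subset _ (hball t ht)).1
  have hmaps : MapsTo (fun t => extChartAt (𝓡∂ m) q (γ t)) (Icc 0 1)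
      (halfBall (extChartAt (𝓡∂ m) q q) κ) := fun t ht => (h.eball_subset _ (hball t ht)).2
  have hcd : ContDiffOn ℝ 1 (fun t => extChartAt (𝓡∂ m) q (γ t)) (Icc 0 1) := by
    rw [← contMDiffOn_iff_contDiffOn]
    exact (contMDiffOn_extChartAt (I := 𝓡∂ m) (n := 1) (x := q)).comp hγ
      (fun t ht => by simpa using hsrc t ht)
  refine ⟨_, hcd, by rw [h0], by rw [h1], hmaps, ?_⟩
  rw [← pathELength_symm_comp hcd fun t ht => h.subset_target (hmaps ht)]
  rw [pathELength_congr (γ' := γ) fun t ht => (extChartAt (𝓡∂ m) q).left_inv (hsrc t ht)]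
  exact hlen

lemma enorm_le_of_norm_le_mul {E F : Type*} [SeminormedAddCommGroup E] [SeminormedAddCommGroup F]
    {a : E} {b : F} {c : ℝ} (hc : 0 ≤ c) (h : ‖a‖ ≤ c * ‖b‖) : ‖a‖ₑ ≤ ENNReal.ofReal c * ‖b‖ₑ := by
  rw [← ofReal_norm, ← ofReal_norm, ← ENNReal.ofReal_mul hc]
  exact ENNReal.ofReal_le_ofReal h

lemma IsGoodChart.enorm_sub_le_chartLength (h : IsGoodChart (m := m) q κ μ ρ) {g : ℝ → Eu m}
    (hg : ContDiffOn ℝ 1 g (Icc 0 1))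
    (hD : MapsTo g (Icc 0 1) (halfBall (extChartAt (𝓡∂ m) q q) κ)) {t : ℝ}
    (ht : t ∈ Icc (0 : ℝ) 1) :
    ‖g t - g 0‖ₑ ≤ ENNReal.ofReal μ * chartLength q g := by
  have hμ : 0 ≤ μ := zero_le_one.trans h.one_le
  have hsub : Icc 0 t ⊆ Icc (0 : ℝ) 1 := Icc_subset_Icc le_rfl ht.2
  refine (enorm_sub_le_lintegral_deriv_of_contDiffOn_Icc (hg.mono hsub) ht.1).trans ?_
  calc ∫⁻ s in Icc 0 t, ‖deriv g s‖ₑ ≤ ∫⁻ s in Icc (0 : ℝ) 1, ‖deriv g s‖ₑ :=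
        lintegral_mono_set hsub
    _ = ∫⁻ s in Ioo (0 : ℝ) 1, ‖derivWithin g (Icc 0 1) s‖ₑ := by
        rw [← restrict_Ioo_eq_restrict_Icc]
        refine setLIntegral_congr_fun measurableSet_Ioo fun s hs => ?_
        simp only [derivWithin_of_mem_nhds (Icc_mem_nhds hs.1 hs.2)]
    _ = ∫⁻ s in Icc (0 : ℝ) 1, ‖derivWithin g (Icc 0 1) s‖ₑ := by rw [restrict_Ioo_eq_restrict_Icc]
    _ ≤ ∫⁻ s in Icc (0 : ℝ) 1, ENNReal.ofReal μ * ‖coordVec q ((extChartAt (𝓡∂ m) q).symm (g s))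
          (derivWithin g (Icc 0 1) s)‖ₑ :=
        setLIntegral_mono' measurableSet_Icc fun s hs =>
          enorm_le_of_norm_le_mul hμ (h.norm_le_coordVec _ (hD hs) _)
    _ = _ := lintegral_const_mul' _ _ ENNReal.ofReal_ne_top

/-- Coordinate differences are bounded by the Riemannian distance, which is an infimum over curves
in `M`: nearly minimal ones stay in the chart. -/
lemma IsGoodChart.enorm_sub_le_edist (h : IsGoodChart (m := m) q κ μ ρ) {x x' : M}
    (hx : x ∈ eball q (ENNReal.ofReal (2 * ρ))) (hxx' : edist x x' < ENNReal.ofReal (2 * ρ)) :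
    ‖extChartAt (𝓡∂ m) q x' - extChartAt (𝓡∂ m) q x‖ₑ ≤ ENNReal.ofReal μ * edist x x' := by
  have hμ : 0 < μ := zero_lt_one.trans_le h.one_le
  have hμ0 : ENNReal.ofReal μ ≠ 0 := by simpa using hμ
  by_contra hcon
  push Not at hcon
  have h1 : edist x x' < min (ENNReal.ofReal (2 * ρ))
      (‖extChartAt (𝓡∂ m) q x' - extChartAt (𝓡∂ m) q x‖ₑ / ENNReal.ofReal μ) := by
    refine lt_min hxx' ?_
    rw [ENNReal.lt_div_iff_mul_lt (Or.inl hμ0) (Or.inl ENNReal.ofReal_ne_top), mul_comm]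
    exact hcon
  obtain ⟨g, hg, g0, g1, hD, hlen⟩ := h.exists_chart_curve hx (min_le_left _ _) h1
  have h2 := h.enorm_sub_le_chartLength hg hD (t := 1) (by simp)
  rw [g0, g1] at h2
  have h3 : ENNReal.ofReal μ * chartLength q g <
      ‖extChartAt (𝓡∂ m) q x' - extChartAt (𝓡∂ m) q x‖ₑ := by
    have := hlen.trans_le (min_le_right _ _)
    rw [ENNReal.lt_div_iff_mul_lt (Or.inl hμ0) (Or.inl ENNReal.ofReal_ne_top), mul_comm] at this
    exact this
  exact absurd h2 (not_le.2 h3)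

/-- The Riemannian distance is bounded by coordinate differences, by the length of the segment in
the chart. -/
lemma IsGoodChart.edist_symm_le (h : IsGoodChart (m := m) q κ μ ρ) {y z : Eu m}
    (hy : y ∈ halfBall (extChartAt (𝓡∂ m) q q) κ) (hz : z ∈ halfBall (extChartAt (𝓡∂ m) q q) κ) :
    edist ((extChartAt (𝓡∂ m) q).symm y) ((extChartAt (𝓡∂ m) q).symm z) ≤
      ENNReal.ofReal (μ * ‖z - y‖) := by
  have hμ : 0 ≤ μ := zero_le_one.trans h.one_le
  let g : ℝ → Eu m := fun t => y + t • (z - y)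
  have hgc : ContDiff ℝ 1 g := contDiff_const.add (contDiff_id.smul contDiff_const)
  have hg : ContDiffOn ℝ 1 g (Icc 0 1) := hgc.contDiffOn
  have hD : MapsTo g (Icc 0 1) (halfBall (extChartAt (𝓡∂ m) q q) κ) := fun t ht => by
    exact (convex_halfBall _ κ).add_smul_sub_mem hy hz ht
  have h1 := edist_le_chartLength hg fun t ht => h.subset_target (hD ht)
  have e0 : g 0 = y := by simp [g]
  have e1 : g 1 = z := by simp [g]
  rw [e0, e1] at h1
  refine h1.trans ?_
  have hd : ∀ t ∈ Icc (0 : ℝ) 1, derivWithin g (Icc 0 1) t = z - y := fun t ht => by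
    have : HasDerivAt g (z - y) t := by
      have := ((hasDerivAt_id t).smul_const (z - y)).const_add y
      simpa [g] using this
    exact this.hasDerivWithinAt.derivWithin (uniqueDiffOn_Icc zero_lt_one t ht)
  calc chartLength q g ≤ ∫⁻ t in Icc (0 : ℝ) 1, ENNReal.ofReal (μ * ‖z - y‖) := by
        refine setLIntegral_mono' measurableSet_Icc fun t ht => ?_
        rw [← ofReal_norm]
        refine ENNReal.ofReal_le_ofReal ((h.norm_coordVec_le _ (hD ht) _).trans ?_)
        rw [hd t ht]
    _ = _ := by simp

end Distance

/-! ### Existence of good charts, and the distance to the boundary -/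

lemma IsEllipticOn.mono {m : ℕ} {D D' : Set (Eu m)} {A : Eu m → Eu m →L[ℝ] Eu m} {Λ Λ' : ℝ}
    (h : IsEllipticOn D A Λ) (hD : D' ⊆ D) (hΛ : Λ ≤ Λ') : IsEllipticOn D' A Λ' where
  one_le := h.one_le.trans hΛ
  symm x hx := h.symm x (hD hx)
  lower x hx u := (h.lower x (hD hx) u).trans
    (mul_le_mul_of_nonneg_right hΛ (h.inner_nonneg (hD hx) u))
  norm_le x hx := (h.norm_le x (hD hx)).trans hΛ
  lip x hx y hy := (h.lip x (hD hx) y (hD hy)).trans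
    (mul_le_mul_of_nonneg_right hΛ (norm_nonneg _))

/-- Comparison of powers of comparable numbers, for exponents of either sign. By the two-sided
comparison `a` and `b` vanish together, so the value of `0 ^ β` does not matter. -/
lemma rpow_le_rpow_mul_exp {a b c₁ c₂ c β : ℝ} (ha : 0 ≤ a) (hb : 0 ≤ b)
    (hab : a ≤ b * Real.exp c₁) (hba : b ≤ a * Real.exp c₂) (h₁ : 0 ≤ β → β * c₁ ≤ c)
    (h₂ : β ≤ 0 → -β * c₂ ≤ c) : a ^ β ≤ b ^ β * Real.exp c := by
  have key : ∀ {a b γ c₀ : ℝ}, 0 ≤ a → 0 ≤ b → a ≤ b * Real.exp c₀ → 0 ≤ γ → γ * c₀ ≤ c →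
      a ^ γ ≤ b ^ γ * Real.exp c := by
    intro a b γ c₀ ha hb hab hγ hc
    calc a ^ γ ≤ (b * Real.exp c₀) ^ γ := Real.rpow_le_rpow ha hab hγ
      _ = b ^ γ * Real.exp (γ * c₀) := by
        rw [Real.mul_rpow hb (Real.exp_pos _).le, ← Real.exp_mul, mul_comm c₀]
      _ ≤ _ := by gcongr
  rcases le_total 0 β with hβ | hβ
  · exact key ha hb hab hβ (h₁ hβ)
  · rcases ha.eq_or_lt with h0 | h0
    · have : b = 0 := le_antisymm (by simpa [← h0] using hba) hb
      rw [← h0, this]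
      rcases hβ.eq_or_lt with h1 | h1
      · have := h₂ hβ
        rw [h1, neg_zero, zero_mul] at this
        simpa [h1] using this
      · simp [Real.zero_rpow h1.ne]
    · have hb0 : 0 < b := by
        by_contra hcon
        have : b = 0 := le_antisymm (not_lt.1 hcon) hb
        rw [this, zero_mul] at hab
        exact absurd hab (not_le.2 h0)
      have := key hb ha hba (neg_nonneg.2 hβ) (h₂ hβ)
      have hbβ : 0 < b ^ (-β) := Real.rpow_pos_of_pos hb0 _
      have haβ : 0 < a ^ (-β) := Real.rpow_pos_of_pos h0 _
      have e1 : a ^ β = (a ^ (-β))⁻¹ := by rw [Real.rpow_neg ha, inv_inv]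
      have e2 : b ^ β = (b ^ (-β))⁻¹ := by rw [Real.rpow_neg hb, inv_inv]
      rw [e1, e2, inv_eq_one_div, div_le_iff₀ haβ]
      calc 1 = (b ^ (-β))⁻¹ * b ^ (-β) := (inv_mul_cancel₀ hbβ.ne').symm
        _ ≤ (b ^ (-β))⁻¹ * (a ^ (-β) * Real.exp c) := by gcongr
        _ = _ := by ring

section GoodChart

variable {m : ℕ} [NeZero m] {M : Type*} [EMetricSpace M] [ChartedSpace (EuclideanHalfSpace m) M]
  [IsManifold (𝓡∂ m) ∞ M] [RiemannianBundle (fun x : M => TangentSpace (𝓡∂ m) x)]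
  [IsContMDiffRiemannianBundle (𝓡∂ m) ∞ (EuclideanSpace ℝ (Fin m))
      (fun x : M => TangentSpace (𝓡∂ m) x)]
  [MeasurableSpace M] [BorelSpace M] [SecondCountableTopology M]

attribute [local instance] isManifold_one

lemma coord_nonneg_of_mem_target {q : M} {y : Eu m} (hy : y ∈ (extChartAt (𝓡∂ m) q).target) :
    0 ≤ y 0 := by
  have := extChartAt_target_subset_range q hy
  rwa [range_modelHalfSpace] at this

/-- The boundary is the zero set of the first coordinate in any chart, not only in the preferred
chart of the point. -/
lemma mem_boundary_iff {q x : M} (hx : x ∈ (extChartAt (𝓡∂ m) q).source) :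
    x ∈ (𝓡∂ m).boundary M ↔ extChartAt (𝓡∂ m) q x 0 = 0 := by
  have hT := (extChartAt (𝓡∂ m) q).map_source hx
  rw [← (𝓡∂ m).compl_interior, mem_compl_iff]
  have h1 : x ∈ (𝓡∂ m).interior M ↔ 0 < extChartAt (𝓡∂ m) q x 0 := by
    refine (isInteriorPoint_iff_mem_interior_target hx).trans ⟨fun h => ?_,
      mem_interior_target_of_pos hT⟩
    have h2 := interior_mono (extChartAt_target_subset_range q) h
    rw [range_modelHalfSpace] at h2
    have := interior_halfSpace 2 (0 : ℝ) (0 : Fin m)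
    exact this.subset h2
  rw [h1, not_lt]
  exact ⟨fun h => le_antisymm h (coord_nonneg_of_mem_target hT), fun h => h.le⟩

lemma inner_gramOp (q : M) {y : Eu m} (hy : y ∈ (extChartAt (𝓡∂ m) q).target) (w : Eu m) :
    inner ℝ (matrixOp (gram (m := m) q ((extChartAt (𝓡∂ m) q).symm y)) w) w =
      ‖coordVec q ((extChartAt (𝓡∂ m) q).symm y) w‖ ^ 2 := by
  rw [← real_inner_self_eq_norm_sq, inner_coordVec ((extChartAt (𝓡∂ m) q).map_target hy),
    inner_matrixOp]
  refine Finset.sum_congr rfl fun i _ => Finset.sum_congr rfl fun j _ => ?_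
  ring

lemma abs_coord_le_norm (y : Eu m) (i : Fin m) : |y i| ≤ ‖y‖ := by
  simpa using PiLp.norm_apply_le y i

/-- The projection of a point of the half space to its boundary hyperplane. -/
def bdryProj (y : Eu m) : Eu m := y - y 0 • stdVec 0

lemma bdryProj_zero (y : Eu m) : bdryProj y 0 = 0 := by simp [bdryProj]

lemma norm_bdryProj_sub_self {y : Eu m} (hy : 0 ≤ y 0) : ‖bdryProj y - y‖ = y 0 := by
  have : bdryProj y - y = -(y 0 • stdVec 0) := by rw [bdryProj]; abel
  rw [this, norm_neg, norm_smul, Real.norm_eq_abs, abs_of_nonneg hy]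
  simp

lemma norm_bdryProj_sub_le {x : Eu m} (hx : x 0 = 0) (y : Eu m) :
    ‖bdryProj y - x‖ ≤ ‖y - x‖ := by
  rw [EuclideanSpace.norm_eq, EuclideanSpace.norm_eq]
  refine Real.sqrt_le_sqrt (Finset.sum_le_sum fun i _ => ?_)
  by_cases hi : i = 0
  · subst hi
    rw [PiLp.sub_apply, bdryProj_zero, hx, sub_zero, norm_zero, zero_pow two_ne_zero]
    exact sq_nonneg _
  · have : bdryProj y i = y i := by simp [bdryProj, hi]
    rw [PiLp.sub_apply, PiLp.sub_apply, this]

/-- Good charts exist around every point. The bounds on the metric follow from ellipticity and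
Lipschitz continuity of the operator field with matrix `(g_ij)`. -/
lemma exists_isGoodChart (q : M) : ∃ κ μ ρ : ℝ, IsGoodChart (m := m) q κ μ ρ := by
  set x := extChartAt (𝓡∂ m) q q with hx
  obtain ⟨κ₁, hκ₁, Λ₁, hT₁, hE₁⟩ := exists_isEllipticOn_halfBall q (contDiffOn_coeffOp (m := m) q)
    (fun y hy u w => matrixOp_symm (posDef_coeff q hy) u w)
    (fun y hy u hu => inner_matrixOp_self_pos (posDef_coeff q hy) hu)
  obtain ⟨κ₂, hκ₂, Λ₂, hT₂, hE₂⟩ := exists_isEllipticOn_halfBall q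
    (A := fun y => matrixOp (gram (m := m) q ((extChartAt (𝓡∂ m) q).symm y)))
    (contDiffOn_matrixOp fun i j => contDiffOn_gram q i j)
    (fun y hy u w => matrixOp_symm (gram_posDef ((extChartAt (𝓡∂ m) q).map_target hy)) u w)
    (fun y hy u hu => inner_matrixOp_self_pos
      (gram_posDef ((extChartAt (𝓡∂ m) q).map_target hy)) hu)
  -- the half ball stays away from the boundary if `q` is an interior point
  have hx0 : 0 ≤ x 0 := coord_nonneg_of_mem_target (mem_extChartAt_target q)
  obtain ⟨κ₃, hκ₃, hκ₃x⟩ : ∃ κ₃ > 0, x 0 = 0 ∨ κ₃ ≤ x 0 / 2 := by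
    rcases hx0.eq_or_lt with h | h
    · exact ⟨1, one_pos, Or.inl h.symm⟩
    · exact ⟨x 0 / 2, by positivity, Or.inr le_rfl⟩
  set κ := min κ₁ (min κ₂ κ₃) with hκ
  have hκ0 : 0 < κ := lt_min hκ₁ (lt_min hκ₂ hκ₃)
  have hs1 : halfBall x κ ⊆ halfBall x κ₁ := halfBall_mono (min_le_left _ _)
  have hs2 : halfBall x κ ⊆ halfBall x κ₂ :=
    halfBall_mono ((min_le_right _ _).trans (min_le_left _ _))
  have hκ3 : κ ≤ κ₃ := (min_le_right _ _).trans (min_le_right _ _)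
  have hT : halfBall x κ ⊆ (extChartAt (𝓡∂ m) q).target := hs1.trans hT₁
  have hvc : ContinuousOn (volDensity (m := m) q) (halfBall x κ) :=
    (contDiffOn_volDensity q).continuousOn.mono hT
  obtain ⟨V, hV⟩ := (isCompact_halfBall x κ).exists_bound_of_continuousOn hvc
  obtain ⟨v, hv, hvl⟩ := (isCompact_halfBall x κ).exists_forall_le' hvc (a := 0)
    fun y hy => volDensity_pos q (hT hy)
  obtain ⟨ε, hε, hεs⟩ : ∃ ε > 0, eball q (ENNReal.ofReal ε) ⊆
      (extChartAt (𝓡∂ m) q).source ∩ extChartAt (𝓡∂ m) q ⁻¹' ball x κ := by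
    have hO : IsOpen ((extChartAt (𝓡∂ m) q).source ∩ extChartAt (𝓡∂ m) q ⁻¹' ball x κ) :=
      (continuousOn_extChartAt q).isOpen_inter_preimage (isOpen_extChartAt_source q) isOpen_ball
    have hmem : q ∈ (extChartAt (𝓡∂ m) q).source ∩ extChartAt (𝓡∂ m) q ⁻¹' ball x κ :=
      ⟨mem_extChartAt_source q, mem_ball_self hκ0⟩
    obtain ⟨ε, hε, h⟩ := EMetric.mem_nhds_iff.1 (hO.mem_nhds hmem)
    obtain ⟨ε', hε', h'⟩ := ENNReal.lt_iff_exists_real_btwn.1 hε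
    refine ⟨ε', ?_, (eball_subset_eball h'.2.le).trans h⟩
    simpa using h'.1
  -- `Λ₁`, `Λ₂` bound the coefficients and the metric, `v` and `V` the volume density
  set μ := max (max Λ₁ (Λ₂ * Λ₂)) (max V v⁻¹) with hμ
  have hμ1 : Λ₁ ≤ μ := (le_max_left _ _).trans (le_max_left _ _)
  have hμ2 : Λ₂ * Λ₂ ≤ μ := (le_max_right _ _).trans (le_max_left _ _)
  have hΛ₂ := hE₂.one_le
  have hμ2' : Λ₂ ≤ μ := le_trans (by nlinarith) hμ2
  refine ⟨κ, μ, ε / 4, hκ0, by positivity, hE₁.one_le.trans hμ1, hT, hE₁.mono hs1 hμ1, ?_, ?_, ?_,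
    ?_, ?_, ?_, ?_⟩
  · intro y hy w
    have h1 := inner_gramOp q (hT hy) w
    have h2 := real_inner_le_norm (matrixOp (gram (m := m) q ((extChartAt (𝓡∂ m) q).symm y)) w) w
    have h3 := ContinuousLinearMap.le_of_opNorm_le _ (hE₂.norm_le y (hs2 hy)) w
    refine le_trans ?_ (mul_le_mul_of_nonneg_right hμ2' (norm_nonneg w))
    refine le_of_sq_le_sq (α := ℝ) ?_ (by positivity)
    rw [← h1]
    calc _ ≤ Λ₂ * ‖w‖ * ‖w‖ := h2.trans (mul_le_mul_of_nonneg_right h3 (norm_nonneg w))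
      _ = Λ₂ * ‖w‖ ^ 2 := by ring
      _ ≤ Λ₂ ^ 2 * ‖w‖ ^ 2 := by
        gcongr
        exact le_self_pow₀ hΛ₂ two_ne_zero
      _ = _ := by ring
  · intro y hy w
    have h1 := inner_gramOp q (hT hy) w
    have h2 := hE₂.lower y (hs2 hy) w
    rw [h1] at h2
    refine le_trans ?_ (mul_le_mul_of_nonneg_right hμ2' (norm_nonneg _))
    refine le_of_sq_le_sq (α := ℝ) ?_ (by positivity)
    nlinarith [sq_nonneg ‖coordVec q ((extChartAt (𝓡∂ m) q).symm y) w‖]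
  · intro y hy z hz w
    have h1 := inner_gramOp q (hT hy) w
    have h2 := inner_gramOp q (hT hz) w
    have h3 := hE₂.lower y (hs2 hy) w
    rw [h1] at h3
    have h4 := hE₂.lip z (hs2 hz) y (hs2 hy)
    set Gy := matrixOp (gram (m := m) q ((extChartAt (𝓡∂ m) q).symm y))
    set Gz := matrixOp (gram (m := m) q ((extChartAt (𝓡∂ m) q).symm z))
    set N := ‖coordVec q ((extChartAt (𝓡∂ m) q).symm y) w‖
    have h5 : inner ℝ ((Gz - Gy) w) w ≤ Λ₂ * ‖z - y‖ * ‖w‖ * ‖w‖ := by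
      refine (real_inner_le_norm _ _).trans ?_
      gcongr
      exact ContinuousLinearMap.le_of_opNorm_le _ h4 w
    have h6 : inner ℝ (Gz w) w = inner ℝ (Gy w) w + inner ℝ ((Gz - Gy) w) w := by
      rw [sub_apply, inner_sub_left]; ring
    refine le_of_sq_le_sq (α := ℝ) ?_ (by positivity)
    have hd : 0 ≤ Λ₂ * ‖z - y‖ := by positivity
    calc ‖coordVec q ((extChartAt (𝓡∂ m) q).symm z) w‖ ^ 2
        ≤ N ^ 2 + Λ₂ * ‖z - y‖ * ‖w‖ ^ 2 := by rw [← h2, h6, h1]; linarith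
      _ ≤ N ^ 2 + Λ₂ * ‖z - y‖ * (Λ₂ * N ^ 2) := by gcongr
      _ = (1 + Λ₂ * Λ₂ * ‖z - y‖) * N ^ 2 := by ring
      _ ≤ (1 + μ * ‖z - y‖) * N ^ 2 := by gcongr
      _ ≤ (1 + μ * ‖z - y‖) ^ 2 * N ^ 2 := by
          gcongr
          refine le_self_pow₀ ?_ two_ne_zero
          have : 0 ≤ μ * ‖z - y‖ :=
            mul_nonneg (zero_le_one.trans (hE₁.one_le.trans hμ1)) (norm_nonneg _)
          linarith
      _ = _ := by ring
  · intro y hy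
    exact (le_abs_self _).trans ((hV y hy).trans ((le_max_left _ _).trans (le_max_right _ _)))
  · intro y hy
    calc 1 = v⁻¹ * v := (inv_mul_cancel₀ hv.ne').symm
      _ ≤ μ * volDensity (m := m) q y := by
        refine mul_le_mul ((le_max_right _ _).trans (le_max_right _ _)) (hvl y hy) hv.le ?_
        exact zero_le_one.trans (hE₁.one_le.trans hμ1)
  · intro z hz
    have h4 : 4 * (ε / 4) = ε := by ring
    rw [h4] at hz
    have h5 := hεs hz
    exact ⟨h5.1, ball_subset_closedBall h5.2,
      coord_nonneg_of_mem_target ((extChartAt (𝓡∂ m) q).map_source h5.1)⟩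
  · refine hκ₃x.imp id fun h3 y hy => ?_
    have h1 : ‖y - x‖ ≤ κ := by rw [← dist_eq_norm]; exact hy.1
    have h2 := (abs_coord_le_norm (y - x) 0).trans h1
    have h4 := (abs_le.1 h2).1
    simp only [PiLp.sub_apply] at h4
    linarith

end GoodChart

section BoundaryDistance

variable {m : ℕ} [NeZero m] {M : Type*} [EMetricSpace M] [ChartedSpace (EuclideanHalfSpace m) M]

/-- The distance to the boundary is finite: the ball of infinite radius about `p` is open and
closed, so it contains the connected component of `p`, which meets the boundary. -/
lemma infEDist_boundary_ne_top
    (hbdry : ∀ p : M, (connectedComponent p ∩ (𝓡∂ m).boundary M).Nonempty) (p : M) :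
    infEDist p ((𝓡∂ m).boundary M) ≠ ⊤ := by
  obtain ⟨b, hb, hbM⟩ := hbdry p
  have hc : IsClopen (eball p (⊤ : ℝ≥0∞)) := ⟨isClosed_eball_top, isOpen_eball⟩
  have h1 : b ∈ eball p (⊤ : ℝ≥0∞) :=
    hc.connectedComponent_subset (mem_eball_self (by simp)) hb
  rw [mem_eball, edist_comm] at h1
  exact ((infEDist_le_edist_of_mem hbM).trans_lt h1).ne

lemma bdryDist_nonneg (p : M) : 0 ≤ bdryDist m p := ENNReal.toReal_nonneg

lemma ofReal_bdryDist (hbdry : ∀ p : M, (connectedComponent p ∩ (𝓡∂ m).boundary M).Nonempty)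
    (p : M) : ENNReal.ofReal (bdryDist m p) = infEDist p ((𝓡∂ m).boundary M) :=
  ENNReal.ofReal_toReal (infEDist_boundary_ne_top hbdry p)

lemma bdryDist_le_add (hbdry : ∀ p : M, (connectedComponent p ∩ (𝓡∂ m).boundary M).Nonempty)
    {p p' : M} {c : ℝ} (hc : 0 ≤ c) (h : edist p p' ≤ ENNReal.ofReal c) :
    bdryDist m p ≤ bdryDist m p' + c := by
  have h1 : infEDist p ((𝓡∂ m).boundary M) ≤ infEDist p' ((𝓡∂ m).boundary M) + edist p p' :=
    infEDist_le_infEDist_add_edist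
  rw [← ofReal_bdryDist hbdry, ← ofReal_bdryDist hbdry] at h1
  have h2 := h1.trans (add_le_add_right h _)
  rw [← ENNReal.ofReal_add (bdryDist_nonneg _) hc] at h2
  exact (ENNReal.ofReal_le_ofReal_iff (add_nonneg (bdryDist_nonneg _) hc)).1 h2

variable [IsManifold (𝓡∂ m) ∞ M] [RiemannianBundle (fun x : M => TangentSpace (𝓡∂ m) x)]
  [IsContMDiffRiemannianBundle (𝓡∂ m) ∞ (EuclideanSpace ℝ (Fin m))
      (fun x : M => TangentSpace (𝓡∂ m) x)]
  [MeasurableSpace M] [BorelSpace M] [SecondCountableTopology M] [IsRiemannianManifold (𝓡∂ m) M]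

attribute [local instance] isManifold_one

variable {q : M} {κ μ ρ : ℝ}

lemma IsGoodChart.bdryDist_le_bdryDist_add (h : IsGoodChart (m := m) q κ μ ρ)
    (hbdry : ∀ p : M, (connectedComponent p ∩ (𝓡∂ m).boundary M).Nonempty) {y z : Eu m}
    (hy : y ∈ halfBall (extChartAt (𝓡∂ m) q q) κ) (hz : z ∈ halfBall (extChartAt (𝓡∂ m) q q) κ) :
    bdryDist m ((extChartAt (𝓡∂ m) q).symm y) ≤
      bdryDist m ((extChartAt (𝓡∂ m) q).symm z) + μ * ‖z - y‖ :=
  bdryDist_le_add hbdry (mul_nonneg (zero_le_one.trans h.one_le) (norm_nonneg _))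
    (h.edist_symm_le hy hz)

lemma IsGoodChart.center_mem (h : IsGoodChart (m := m) q κ μ ρ) :
    extChartAt (𝓡∂ m) q q ∈ halfBall (extChartAt (𝓡∂ m) q q) κ :=
  ⟨mem_closedBall_self h.κ_pos.le, coord_nonneg_of_mem_target (mem_extChartAt_target q)⟩

lemma IsGoodChart.symm_mem_eball (h : IsGoodChart (m := m) q κ μ ρ) {y : Eu m}
    (hy : y ∈ halfBall (extChartAt (𝓡∂ m) q q) κ) {r : ℝ}
    (hyr : μ * ‖y - extChartAt (𝓡∂ m) q q‖ < r) :
    (extChartAt (𝓡∂ m) q).symm y ∈ eball q (ENNReal.ofReal r) := by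
  have h1 := h.edist_symm_le h.center_mem hy
  rw [(extChartAt (𝓡∂ m) q).left_inv (mem_extChartAt_source q)] at h1
  rw [mem_eball, edist_comm]
  refine h1.trans_lt ((ENNReal.ofReal_lt_ofReal_iff_of_nonneg ?_).2 hyr)
  exact mul_nonneg (zero_le_one.trans h.one_le) (norm_nonneg _)

/-- Near a boundary point, the segment to the boundary hyperplane bounds the distance to the
boundary by the first coordinate. -/
lemma IsGoodChart.bdryDist_le_mul_coord (h : IsGoodChart (m := m) q κ μ ρ)
    (hbdry : ∀ p : M, (connectedComponent p ∩ (𝓡∂ m).boundary M).Nonempty)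
    (h0 : extChartAt (𝓡∂ m) q q 0 = 0) {y : Eu m}
    (hy : y ∈ halfBall (extChartAt (𝓡∂ m) q q) κ) :
    bdryDist m ((extChartAt (𝓡∂ m) q).symm y) ≤ μ * y 0 := by
  set z : Eu m := bdryProj y with hz
  have hz0 : z 0 = 0 := bdryProj_zero y
  have hzy : ‖z - y‖ = y 0 := norm_bdryProj_sub_self hy.2
  have hzD : z ∈ halfBall (extChartAt (𝓡∂ m) q q) κ := by
    refine ⟨?_, hz0.ge⟩
    rw [mem_closedBall, dist_eq_norm]
    exact (norm_bdryProj_sub_le h0 y).trans (by rw [← dist_eq_norm]; exact hy.1)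
  have hzT := h.subset_target hzD
  have hb : (extChartAt (𝓡∂ m) q).symm z ∈ (𝓡∂ m).boundary M := by
    rw [mem_boundary_iff ((extChartAt (𝓡∂ m) q).map_target hzT),
      (extChartAt (𝓡∂ m) q).right_inv hzT]
    exact hz0
  have h1 := h.bdryDist_le_bdryDist_add hbdry hy hzD
  have h2 : bdryDist m ((extChartAt (𝓡∂ m) q).symm z) = 0 := by
    rw [bdryDist, infEDist_zero_of_mem hb, ENNReal.toReal_zero]
  rwa [h2, zero_add, hzy] at h1

/-- Near a boundary point, the first coordinate is bounded by the distance to the boundary. The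
restriction to `eball q ρ` makes sure that nearly closest boundary points lie in the chart. -/
lemma IsGoodChart.coord_le_mul_bdryDist (h : IsGoodChart (m := m) q κ μ ρ)
    (hbdry : ∀ p : M, (connectedComponent p ∩ (𝓡∂ m).boundary M).Nonempty)
    (h0 : extChartAt (𝓡∂ m) q q 0 = 0) {y : Eu m}
    (hy : y ∈ halfBall (extChartAt (𝓡∂ m) q q) κ)
    (hyρ : (extChartAt (𝓡∂ m) q).symm y ∈ eball q (ENNReal.ofReal ρ)) :
    y 0 ≤ μ * bdryDist m ((extChartAt (𝓡∂ m) q).symm y) := by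
  have hρ := h.ρ_pos
  have hμ : 0 < μ := zero_lt_one.trans_le h.one_le
  have hyT := h.subset_target hy
  set x := (extChartAt (𝓡∂ m) q).symm y with hx
  have hqb : q ∈ (𝓡∂ m).boundary M := (mem_boundary_iff (mem_extChartAt_source q)).2 h0
  have hdρ : infEDist x ((𝓡∂ m).boundary M) < ENNReal.ofReal ρ :=
    (infEDist_le_edist_of_mem hqb).trans_lt hyρ
  refine le_of_forall_gt fun c hc => ?_
  have h1 : infEDist x ((𝓡∂ m).boundary M) < min (ENNReal.ofReal ρ) (ENNReal.ofReal (c / μ)) := by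
    refine lt_min hdρ ?_
    rw [← ofReal_bdryDist hbdry, ENNReal.ofReal_lt_ofReal_iff_of_nonneg (bdryDist_nonneg _),
      lt_div_iff₀ hμ, mul_comm]
    exact hc
  obtain ⟨b, hb, hxb⟩ := infEDist_lt_iff.1 h1
  have hxb1 : edist x b < ENNReal.ofReal ρ := hxb.trans_le (min_le_left _ _)
  have hxb2 : edist x b < ENNReal.ofReal (c / μ) := hxb.trans_le (min_le_right _ _)
  have hle : ENNReal.ofReal ρ ≤ ENNReal.ofReal (2 * ρ) := ENNReal.ofReal_le_ofReal (by linarith)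
  have hbS : b ∈ (extChartAt (𝓡∂ m) q).source := by
    refine (h.eball_subset b ?_).1
    rw [mem_eball]
    refine (edist_triangle b x q).trans_lt ?_
    rw [edist_comm b]
    refine (ENNReal.add_lt_add hxb1 hyρ).trans_le ?_
    rw [← ENNReal.ofReal_add hρ.le hρ.le]
    exact ENNReal.ofReal_le_ofReal (by linarith)
  have h2 := h.enorm_sub_le_edist (eball_subset_eball hle hyρ) (hxb1.trans_le hle)
  rw [hx, (extChartAt (𝓡∂ m) q).right_inv hyT, ← hx] at h2
  have h3 : y 0 ≤ ‖extChartAt (𝓡∂ m) q b - y‖ := by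
    have h4 := abs_coord_le_norm (extChartAt (𝓡∂ m) q b - y) 0
    rw [PiLp.sub_apply, (mem_boundary_iff hbS).1 hb, zero_sub, abs_neg] at h4
    exact (le_abs_self _).trans h4
  have h5 : ENNReal.ofReal ‖extChartAt (𝓡∂ m) q b - y‖ < ENNReal.ofReal c := by
    rw [ofReal_norm]
    refine h2.trans_lt ?_
    have e : ENNReal.ofReal c = ENNReal.ofReal μ * ENNReal.ofReal (c / μ) := by
      rw [← ENNReal.ofReal_mul hμ.le]
      congr 1
      field_simp
    rw [e]
    exact ENNReal.mul_lt_mul_right (by simpa using hμ) ENNReal.ofReal_ne_top hxb2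
  exact h3.trans_lt ((ENNReal.ofReal_lt_ofReal_iff_of_nonneg (norm_nonneg _)).1 h5)

/-- In a good chart, the distance to the boundary is comparable to the first coordinate. Around an
interior point both are bounded above and below. -/
lemma IsGoodChart.exists_bdryDist_comparable (h : IsGoodChart (m := m) q κ μ ρ)
    (hbdry : ∀ p : M, (connectedComponent p ∩ (𝓡∂ m).boundary M).Nonempty) :
    ∃ ν : ℝ, 1 ≤ ν ∧ ∀ y ∈ halfBall (extChartAt (𝓡∂ m) q q) κ,
      (extChartAt (𝓡∂ m) q).symm y ∈ eball q (ENNReal.ofReal ρ) →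
      bdryDist m ((extChartAt (𝓡∂ m) q).symm y) ≤ ν * y 0 ∧
      y 0 ≤ ν * bdryDist m ((extChartAt (𝓡∂ m) q).symm y) := by
  have hρ := h.ρ_pos
  have hκ := h.κ_pos
  have hμ : 0 < μ := zero_lt_one.trans_le h.one_le
  by_cases h0 : extChartAt (𝓡∂ m) q q 0 = 0
  · exact ⟨μ, h.one_le, fun y hy hyρ => ⟨h.bdryDist_le_mul_coord hbdry h0 hy,
      h.coord_le_mul_bdryDist hbdry h0 hy hyρ⟩⟩
  set x := extChartAt (𝓡∂ m) q q with hx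
  have hx0 : 0 < x 0 := lt_of_le_of_ne
    (coord_nonneg_of_mem_target (mem_extChartAt_target q)) (Ne.symm h0)
  have hpos := h.zero_or_pos.resolve_left h0
  -- boundary points have distance at least `4ρ` from the centre
  have hlow : ∀ y ∈ halfBall x κ, (extChartAt (𝓡∂ m) q).symm y ∈ eball q (ENNReal.ofReal ρ) →
      ρ ≤ bdryDist m ((extChartAt (𝓡∂ m) q).symm y) := by
    intro y hy hyρ
    have h1 : ENNReal.ofReal ρ ≤ infEDist ((extChartAt (𝓡∂ m) q).symm y) ((𝓡∂ m).boundary M) := by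
      rw [le_infEDist]
      intro b hb
      by_contra hcon
      push Not at hcon
      have h2 : b ∈ eball q (ENNReal.ofReal (4 * ρ)) := by
        rw [mem_eball]
        refine (edist_triangle b ((extChartAt (𝓡∂ m) q).symm y) q).trans_lt ?_
        rw [edist_comm b]
        refine (ENNReal.add_lt_add hcon hyρ).trans_le ?_
        rw [← ENNReal.ofReal_add hρ.le hρ.le]
        exact ENNReal.ofReal_le_ofReal (by linarith)
      have h3 := h.eball_subset b h2
      have h4 := hpos _ h3.2
      rw [(mem_boundary_iff h3.1).1 hb] at h4
      linarith
    rw [← ofReal_bdryDist hbdry] at h1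
    exact (ENNReal.ofReal_le_ofReal_iff (bdryDist_nonneg _)).1 h1
  set B := bdryDist m ((extChartAt (𝓡∂ m) q).symm x) + μ * κ with hB
  have hB0 : 0 ≤ B := add_nonneg (bdryDist_nonneg _) (by positivity)
  refine ⟨max 1 (max (2 * B / x 0) ((x 0 + κ) / ρ)), le_max_left _ _, fun y hy hyρ => ⟨?_, ?_⟩⟩
  · have h1 := h.bdryDist_le_bdryDist_add hbdry hy h.center_mem
    have h2 : ‖x - y‖ ≤ κ := by rw [← dist_eq_norm, dist_comm]; exact hy.1
    have h3 := hpos y hy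
    calc _ ≤ B := h1.trans (by rw [hB]; gcongr)
      _ = (2 * B / x 0) * (x 0 / 2) := by field_simp
      _ ≤ _ := by
        gcongr
        exact (le_max_left _ _).trans (le_max_right _ _)
  · have h1 := hlow y hy hyρ
    have h2 : ‖y - x‖ ≤ κ := by rw [← dist_eq_norm]; exact hy.1
    have h3 := (abs_le.1 ((abs_coord_le_norm (y - x) 0).trans h2)).2
    rw [PiLp.sub_apply] at h3
    calc y 0 ≤ x 0 + κ := by linarith
      _ = (x 0 + κ) / ρ * ρ := by field_simp
      _ ≤ _ := by
        gcongr
        exact (le_max_right _ _).trans (le_max_right _ _)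

end BoundaryDistance

/-! ### Growth of the weight along rays -/

section Weight

variable {m : ℕ} [NeZero m] {M : Type*} [EMetricSpace M] [ChartedSpace (EuclideanHalfSpace m) M]
  [IsManifold (𝓡∂ m) ∞ M] [RiemannianBundle (fun x : M => TangentSpace (𝓡∂ m) x)]
  [IsContMDiffRiemannianBundle (𝓡∂ m) ∞ (EuclideanSpace ℝ (Fin m))
      (fun x : M => TangentSpace (𝓡∂ m) x)]
  [MeasurableSpace M] [BorelSpace M] [SecondCountableTopology M] [IsRiemannianManifold (𝓡∂ m) M]

attribute [local instance] isManifold_one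

variable {q : M} {κ μ ρ : ℝ}

lemma norm_coordVec_smul (c x : M) (l : ℝ) (w : Eu m) :
    ‖coordVec c x (l • w)‖ = |l| * ‖coordVec c x w‖ := by
  have h8 : coordVec c x (l • w) = l • coordVec c x w :=
    (mfderivWithin 𝓘(ℝ, EuclideanSpace ℝ (Fin m)) (𝓡∂ m) (extChartAt (𝓡∂ m) c).symm
      (range (𝓡∂ m)) (extChartAt (𝓡∂ m) c x)).map_smul l w
  rw [h8, norm_smul, Real.norm_eq_abs]

/-- Scaling about a boundary point of a good chart multiplies the distance to the boundary by
almost the scaling factor: a short curve to the boundary is scaled to a curve to the boundary, and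
its length changes by that factor up to the oscillation of the metric. -/
lemma IsGoodChart.bdryDist_scale_le (h : IsGoodChart (m := m) q κ μ ρ)
    (hbdry : ∀ p : M, (connectedComponent p ∩ (𝓡∂ m).boundary M).Nonempty)
    (h0 : extChartAt (𝓡∂ m) q q 0 = 0) {x₀ y : Eu m} (hx₀ : x₀ 0 = 0)
    (hx₀q : ‖x₀ - extChartAt (𝓡∂ m) q q‖ ≤ κ / 2)
    (hy : y ∈ halfBall (extChartAt (𝓡∂ m) q q) κ)
    (hyρ : (extChartAt (𝓡∂ m) q).symm y ∈ eball q (ENNReal.ofReal ρ)) {s : ℝ}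
    (hys : ‖y - x₀‖ ≤ s) (hs : 2 * (1 + 2 * μ ^ 2) * s ≤ κ / 2) {l : ℝ} (hl : 0 < l) (hl2 : l ≤ 2) :
    bdryDist m ((extChartAt (𝓡∂ m) q).symm (x₀ + l • (y - x₀))) ≤
      l * (1 + μ * (1 + 2 * μ ^ 2) * s * |l - 1|) * bdryDist m ((extChartAt (𝓡∂ m) q).symm y) := by
  have hμ1 := h.one_le
  have hμ : 0 < μ := zero_lt_one.trans_le hμ1
  have hρ := h.ρ_pos
  have hs0 : 0 ≤ s := (norm_nonneg _).trans hys
  set F := l * (1 + μ * (1 + 2 * μ ^ 2) * s * |l - 1|) with hF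
  have hF0 : 0 < F := mul_pos hl (by positivity)
  set b := bdryDist m ((extChartAt (𝓡∂ m) q).symm y) with hb
  have hb0 : 0 ≤ b := bdryDist_nonneg _
  have hscale : ∀ z : Eu m, (x₀ + l • (z - x₀)) 0 = l * z 0 := fun z => by simp [hx₀]
  have hD : ∀ z : Eu m, 0 ≤ z 0 → ‖z - x₀‖ ≤ (1 + 2 * μ ^ 2) * s →
      x₀ + l • (z - x₀) ∈ halfBall (extChartAt (𝓡∂ m) q q) κ := by
    intro z hz0 hz
    refine ⟨?_, ?_⟩
    · rw [mem_closedBall, dist_eq_norm]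
      calc ‖x₀ + l • (z - x₀) - extChartAt (𝓡∂ m) q q‖
          = ‖(x₀ - extChartAt (𝓡∂ m) q q) + l • (z - x₀)‖ := by congr 1; abel
        _ ≤ κ / 2 + l * ‖z - x₀‖ := by
          refine (norm_add_le _ _).trans ?_
          rw [norm_smul, Real.norm_eq_abs, abs_of_pos hl]
          gcongr
        _ ≤ κ / 2 + 2 * ((1 + 2 * μ ^ 2) * s) := by gcongr
        _ ≤ κ := by linarith
    · change 0 ≤ (x₀ + l • (z - x₀)) 0
      rw [hscale]
      exact mul_nonneg hl.le hz0
  have hbd : ∀ z : Eu m, z 0 = 0 → z ∈ (extChartAt (𝓡∂ m) q).target →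
      (extChartAt (𝓡∂ m) q).symm z ∈ (𝓡∂ m).boundary M := fun z hz hzT => by
    rw [mem_boundary_iff ((extChartAt (𝓡∂ m) q).map_target hzT),
      (extChartAt (𝓡∂ m) q).right_inv hzT]
    exact hz
  rcases hb0.eq_or_lt with hb1 | hb1
  · -- `y` lies on the boundary
    have h1 : y 0 = 0 := by
      refine le_antisymm ?_ hy.2
      have := h.coord_le_mul_bdryDist hbdry h0 hy hyρ
      rwa [← hb, ← hb1, mul_zero] at this
    have h2 : x₀ + l • (y - x₀) ∈ halfBall (extChartAt (𝓡∂ m) q q) κ := by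
      refine hD y hy.2 (hys.trans ?_)
      nlinarith [mul_nonneg (sq_nonneg μ) hs0]
    rw [← hb1, mul_zero, bdryDist, infEDist_zero_of_mem
      (hbd _ (by rw [hscale, h1, mul_zero]) (h.subset_target h2)), ENNReal.toReal_zero]
  by_contra hcon
  push Not at hcon
  have hbρ : b < 2 * ρ := by
    have hqb : q ∈ (𝓡∂ m).boundary M := (mem_boundary_iff (mem_extChartAt_source q)).2 h0
    have h1 : infEDist ((extChartAt (𝓡∂ m) q).symm y) ((𝓡∂ m).boundary M) < ENNReal.ofReal ρ :=
      (infEDist_le_edist_of_mem hqb).trans_lt hyρ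
    rw [← ofReal_bdryDist hbdry, ENNReal.ofReal_lt_ofReal_iff_of_nonneg hb0] at h1
    linarith
  -- a curve to the boundary of length less than `ℓ`, with `ℓ` so close to `b` that `F ℓ` is less
  -- than the distance to the boundary of the scaled point
  obtain ⟨ℓ, hbℓ, hℓ⟩ := exists_between (lt_min (lt_min hbρ (by linarith : b < 2 * b))
    ((lt_div_iff₀ hF0).2 (by rwa [mul_comm] : b * F < _)))
  have hℓρ : ℓ ≤ 2 * ρ := (hℓ.le.trans (min_le_left _ _)).trans (min_le_left _ _)
  have hℓb : ℓ ≤ 2 * b := (hℓ.le.trans (min_le_left _ _)).trans (min_le_right _ _)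
  have hℓF : F * ℓ < bdryDist m ((extChartAt (𝓡∂ m) q).symm (x₀ + l • (y - x₀))) := by
    have := hℓ.trans_le (min_le_right _ _)
    rw [lt_div_iff₀ hF0] at this
    linarith
  have hℓ0 : 0 < ℓ := hb1.trans hbℓ
  have h1 : infEDist ((extChartAt (𝓡∂ m) q).symm y) ((𝓡∂ m).boundary M) < ENNReal.ofReal ℓ := by
    rw [← ofReal_bdryDist hbdry]
    exact (ENNReal.ofReal_lt_ofReal_iff hℓ0).2 hbℓ
  obtain ⟨z, hz, hyz⟩ := infEDist_lt_iff.1 h1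
  obtain ⟨g, hg, g0, g1, hgD, hlen⟩ := h.exists_chart_curve
    (eball_subset_eball (ENNReal.ofReal_le_ofReal (by linarith)) hyρ)
    (ENNReal.ofReal_le_ofReal hℓρ) hyz
  rw [(extChartAt (𝓡∂ m) q).right_inv (h.subset_target hy)] at g0
  -- the curve stays within distance `(1 + 2 μ²) s` of the centre
  have hnear : ∀ t ∈ Icc (0 : ℝ) 1, ‖g t - x₀‖ ≤ (1 + 2 * μ ^ 2) * s := by
    intro t ht
    have h2 := (h.enorm_sub_le_chartLength hg hgD ht).trans (mul_le_mul_right hlen.le _)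
    rw [← ENNReal.ofReal_mul hμ.le, ← ofReal_norm, ENNReal.ofReal_le_ofReal_iff (by positivity),
      g0] at h2
    have h3 : b ≤ μ * y 0 := h.bdryDist_le_mul_coord hbdry h0 hy
    have h4 : y 0 ≤ s := by
      have := (le_abs_self _).trans ((abs_coord_le_norm (y - x₀) 0).trans hys)
      rwa [PiLp.sub_apply, hx₀, sub_zero] at this
    calc ‖g t - x₀‖ = ‖(g t - y) + (y - x₀)‖ := by congr 1; abel
      _ ≤ μ * ℓ + s := (norm_add_le _ _).trans (add_le_add h2 hys)
      _ ≤ μ * (2 * (μ * s)) + s := by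
        gcongr
        exact hℓb.trans (by gcongr; exact h3.trans (by gcongr))
      _ = _ := by ring
  set g' : ℝ → Eu m := fun t => x₀ + l • (g t - x₀) with hg'
  have hg'D : MapsTo g' (Icc 0 1) (halfBall (extChartAt (𝓡∂ m) q q) κ) := fun t ht =>
    hD (g t) (hgD ht).2 (hnear t ht)
  have hg'c : ContDiffOn ℝ 1 g' (Icc 0 1) :=
    contDiffOn_const.add ((hg.sub contDiffOn_const).const_smul l)
  have hlen' : chartLength q g' ≤ ENNReal.ofReal F * chartLength q g := by
    rw [chartLength, chartLength, ← lintegral_const_mul' _ _ ENNReal.ofReal_ne_top]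
    refine setLIntegral_mono' measurableSet_Icc fun t ht => ?_
    have hd : derivWithin g' (Icc 0 1) t = l • derivWithin g (Icc 0 1) t := by
      have h2 : HasDerivWithinAt g (derivWithin g (Icc 0 1) t) (Icc 0 1) t :=
        ((hg t ht).differentiableWithinAt (by simp)).hasDerivWithinAt
      exact (((h2.sub_const x₀).const_smul l).const_add x₀).derivWithin
        (uniqueDiffOn_Icc zero_lt_one t ht)
    refine enorm_le_of_norm_le_mul hF0.le ?_
    rw [hd]
    have h3 := h.norm_coordVec_le_norm_coordVec _ (hgD ht) _ (hg'D ht)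
      (l • derivWithin g (Icc 0 1) t)
    have h4 : ‖coordVec q ((extChartAt (𝓡∂ m) q).symm (g t)) (l • derivWithin g (Icc 0 1) t)‖ =
        l * ‖coordVec q ((extChartAt (𝓡∂ m) q).symm (g t)) (derivWithin g (Icc 0 1) t)‖ := by
      rw [norm_coordVec_smul, abs_of_pos hl]
    have h5 : ‖g' t - g t‖ ≤ |l - 1| * ((1 + 2 * μ ^ 2) * s) := by
      have : g' t - g t = (l - 1) • (g t - x₀) := by
        rw [hg', sub_smul, one_smul]
        simp only
        abel
      rw [this, norm_smul, Real.norm_eq_abs]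
      exact mul_le_mul_of_nonneg_left (hnear t ht) (abs_nonneg _)
    refine h3.trans ?_
    rw [h4, hF, ← mul_assoc]
    refine mul_le_mul_of_nonneg_right ?_ (norm_nonneg _)
    rw [mul_comm]
    refine mul_le_mul_of_nonneg_left ?_ hl.le
    calc 1 + μ * ‖g' t - g t‖ ≤ 1 + μ * (|l - 1| * ((1 + 2 * μ ^ 2) * s)) := by gcongr
      _ = _ := by ring
  -- the scaled curve ends on the boundary
  have hend : (extChartAt (𝓡∂ m) q).symm (g' 1) ∈ (𝓡∂ m).boundary M := by
    refine hbd _ ?_ (h.subset_target (hg'D (by simp)))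
    have hzS : z ∈ (extChartAt (𝓡∂ m) q).source := by
      refine (h.eball_subset z ?_).1
      rw [mem_eball]
      refine (edist_triangle z ((extChartAt (𝓡∂ m) q).symm y) q).trans_lt ?_
      rw [edist_comm z]
      refine (ENNReal.add_lt_add hyz hyρ).trans_le ?_
      rw [← ENNReal.ofReal_add hℓ0.le hρ.le]
      exact ENNReal.ofReal_le_ofReal (by linarith)
    rw [hg', hscale, g1, (mem_boundary_iff hzS).1 hz, mul_zero]
  have h6 := edist_le_chartLength hg'c fun t ht => h.subset_target (hg'D ht)
  have h7 := (infEDist_le_edist_of_mem hend).trans (h6.trans (hlen'.trans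
    (mul_le_mul_right hlen.le _)))
  rw [← ofReal_bdryDist hbdry, ← ENNReal.ofReal_mul hF0.le,
    ENNReal.ofReal_le_ofReal_iff (by positivity)] at h7
  have e0 : g' 0 = x₀ + l • (y - x₀) := by rw [hg']; simp only [g0]
  rw [e0] at h7
  exact absurd h7 (not_le.2 hℓF)

/-- Growth of the weight along rays issuing from a boundary point, with exponent `β` up to `O(s)`.
Both signs of `β` occur, so the scaling estimate is used for the factors `l` and `l⁻¹`. -/
lemma IsGoodChart.bdryDist_rpow_le_of_boundary (h : IsGoodChart (m := m) q κ μ ρ)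
    (hbdry : ∀ p : M, (connectedComponent p ∩ (𝓡∂ m).boundary M).Nonempty)
    (h0 : extChartAt (𝓡∂ m) q q 0 = 0) {x₀ y : Eu m} (hx₀ : x₀ 0 = 0)
    (hx₀q : ‖x₀ - extChartAt (𝓡∂ m) q q‖ ≤ κ / 2) {s : ℝ} (hs : 2 * (1 + 2 * μ ^ 2) * s ≤ κ / 2)
    (hsρ : μ * (‖x₀ - extChartAt (𝓡∂ m) q q‖ + s) < ρ) (hy0 : 0 ≤ y 0) (hys : ‖y - x₀‖ ≤ s)
    {l : ℝ} (hl : 1 ≤ l) (hl2 : l ≤ 2) (hly : ‖x₀ + l • (y - x₀) - x₀‖ ≤ s) (β : ℝ) :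
    bdryDist m ((extChartAt (𝓡∂ m) q).symm y) ^ β ≤
      bdryDist m ((extChartAt (𝓡∂ m) q).symm (x₀ + l • (y - x₀))) ^ β *
        Real.exp ((-β + |β| * (μ * (1 + 2 * μ ^ 2) * s)) * (l - 1) + |β| * (l - 1) ^ 2) := by
  have hμ1 := h.one_le
  have hμ : 0 < μ := zero_lt_one.trans_le hμ1
  have hs0 : 0 ≤ s := (norm_nonneg _).trans hys
  have hsκ : s ≤ κ / 2 := by nlinarith [mul_nonneg (sq_nonneg μ) hs0]
  have hmem : ∀ z : Eu m, 0 ≤ z 0 → ‖z - x₀‖ ≤ s →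
      z ∈ halfBall (extChartAt (𝓡∂ m) q q) κ ∧
        (extChartAt (𝓡∂ m) q).symm z ∈ eball q (ENNReal.ofReal ρ) := by
    intro z hz hzs
    have h1 : ‖z - extChartAt (𝓡∂ m) q q‖ ≤ ‖x₀ - extChartAt (𝓡∂ m) q q‖ + s := by
      have : z - extChartAt (𝓡∂ m) q q = (x₀ - extChartAt (𝓡∂ m) q q) + (z - x₀) := by abel
      rw [this]
      exact (norm_add_le _ _).trans (by gcongr)
    have h2 : z ∈ halfBall (extChartAt (𝓡∂ m) q q) κ := by
      refine ⟨?_, hz⟩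
      rw [mem_closedBall, dist_eq_norm]
      linarith
    refine ⟨h2, h.symm_mem_eball h2 (lt_of_le_of_lt ?_ hsρ)⟩
    gcongr
  have hl0 : 0 < l := by linarith
  set z := x₀ + l • (y - x₀) with hz
  have hz0 : 0 ≤ z 0 := by
    have : z 0 = l * y 0 := by simp [hz, hx₀]
    rw [this]
    positivity
  have hback : x₀ + l⁻¹ • (z - x₀) = y := by
    rw [hz, add_sub_cancel_left, smul_smul, inv_mul_cancel₀ hl0.ne', one_smul]
    abel
  set a := μ * (1 + 2 * μ ^ 2) * s with ha
  have ha0 : 0 ≤ a := by positivity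
  have h1 := h.bdryDist_scale_le hbdry h0 hx₀ hx₀q (hmem y hy0 hys).1 (hmem y hy0 hys).2 hys hs
    hl0 hl2
  have h2 := h.bdryDist_scale_le hbdry h0 hx₀ hx₀q (hmem z hz0 hly).1 (hmem z hz0 hly).2 hly hs
    (inv_pos.2 hl0) ((inv_le_one_of_one_le₀ hl).trans one_le_two)
  rw [hback] at h2
  rw [← hz] at h1
  have hb1 := bdryDist_nonneg (m := m) ((extChartAt (𝓡∂ m) q).symm y)
  have hb2 := bdryDist_nonneg (m := m) ((extChartAt (𝓡∂ m) q).symm z)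
  have hu : 0 ≤ l - 1 := by linarith
  have hinv : |l⁻¹ - 1| ≤ l - 1 := by
    have h3 : l⁻¹ ≤ 1 := inv_le_one_of_one_le₀ hl
    rw [abs_of_nonpos (by linarith)]
    have h4 : l * l⁻¹ = 1 := mul_inv_cancel₀ hl0.ne'
    nlinarith
  have hinv2 : l⁻¹ ≤ Real.exp (-(l - 1) + (l - 1) ^ 2) := by
    refine le_trans ?_ (Real.add_one_le_exp _)
    rw [inv_eq_one_div, div_le_iff₀ hl0]
    nlinarith [mul_nonneg hu (sq_nonneg (l - 1))]
  refine rpow_le_rpow_mul_exp (c₁ := -(l - 1) + (l - 1) ^ 2 + a * (l - 1))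
    (c₂ := (l - 1) + a * (l - 1)) hb1 hb2 ?_ ?_ ?_ ?_
  · refine h2.trans ?_
    rw [mul_comm, Real.exp_add]
    refine mul_le_mul_of_nonneg_left ?_ hb2
    refine mul_le_mul hinv2 ?_ (by positivity) (Real.exp_pos _).le
    refine le_trans ?_ (Real.add_one_le_exp _)
    rw [add_comm]
    gcongr
  · refine h1.trans ?_
    rw [mul_comm, Real.exp_add]
    refine mul_le_mul_of_nonneg_left ?_ hb1
    refine mul_le_mul ?_ ?_ (by positivity) (Real.exp_pos _).le
    · have := Real.add_one_le_exp (l - 1)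
      linarith
    · refine le_trans ?_ (Real.add_one_le_exp _)
      rw [abs_of_nonneg hu, add_comm]
  · intro hβ
    rw [abs_of_nonneg hβ]
    linarith
  · intro hβ
    rw [abs_of_nonpos hβ]
    nlinarith [mul_nonneg (neg_nonneg.2 hβ) (sq_nonneg (l - 1))]

/-- Growth of the weight along short rays, away from the boundary. -/
lemma IsGoodChart.bdryDist_rpow_le_of_interior (h : IsGoodChart (m := m) q κ μ ρ)
    (hbdry : ∀ p : M, (connectedComponent p ∩ (𝓡∂ m).boundary M).Nonempty) {y z : Eu m}
    (hy : y ∈ halfBall (extChartAt (𝓡∂ m) q q) κ) (hz : z ∈ halfBall (extChartAt (𝓡∂ m) q q) κ)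
    {b d : ℝ} (hb : 0 < b) (hby : b ≤ bdryDist m ((extChartAt (𝓡∂ m) q).symm y))
    (hbz : b ≤ bdryDist m ((extChartAt (𝓡∂ m) q).symm z)) (hd : ‖z - y‖ ≤ d) (β : ℝ) :
    bdryDist m ((extChartAt (𝓡∂ m) q).symm y) ^ β ≤
      bdryDist m ((extChartAt (𝓡∂ m) q).symm z) ^ β * Real.exp (|β| * (μ * d / b)) := by
  have hμ : 0 < μ := zero_lt_one.trans_le h.one_le
  have hd0 : 0 ≤ d := (norm_nonneg _).trans hd
  have key : ∀ {u v : ℝ}, b ≤ v → u ≤ v + μ * d → u ≤ v * Real.exp (μ * d / b) := by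
    intro u v hbv huv
    calc u ≤ v + μ * d := huv
      _ = v + b * (μ * d / b) := by field_simp
      _ ≤ v + v * (μ * d / b) := by gcongr
      _ = v * (μ * d / b + 1) := by ring
      _ ≤ _ := by
        gcongr
        · exact hb.le.trans hbv
        · exact Real.add_one_le_exp _
  refine rpow_le_rpow_mul_exp (c₁ := μ * d / b) (c₂ := μ * d / b) (bdryDist_nonneg _)
    (bdryDist_nonneg _) (key hbz ?_) (key hby ?_) ?_ ?_
  · exact (h.bdryDist_le_bdryDist_add hbdry hy hz).trans (by gcongr)
  · refine (h.bdryDist_le_bdryDist_add hbdry hz hy).trans ?_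
    rw [norm_sub_rev]
    gcongr
  · exact fun hβ => by rw [abs_of_nonneg hβ]
  · exact fun hβ => by rw [abs_of_nonpos hβ]

end Weight

/-! ### Energy growth about interior points and about boundary points -/

section EnergyGrowth

variable {m n : ℕ} [NeZero m] {M : Type*} [EMetricSpace M] [ChartedSpace (EuclideanHalfSpace m) M]
  [IsManifold (𝓡∂ m) ∞ M] [RiemannianBundle (fun x : M => TangentSpace (𝓡∂ m) x)]
  [IsContMDiffRiemannianBundle (𝓡∂ m) ∞ (EuclideanSpace ℝ (Fin m))
      (fun x : M => TangentSpace (𝓡∂ m) x)]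
  [MeasurableSpace M] [BorelSpace M] [SecondCountableTopology M] [IsRiemannianManifold (𝓡∂ m) M]

attribute [local instance] isManifold_one

/-- The weighted energy on a half ball of a chart, up to the factor `1 / 2`. -/
def chartEnergy (β : ℝ) (v : M → EuclideanSpace ℝ (Fin n)) (q : M) (x : Eu m) (t : ℝ) : ℝ :=
  ∫ y in halfBall x t, chartEnergyDensity β v q y

variable {q : M} {κ μ ρ β : ℝ} {v : M → EuclideanSpace ℝ (Fin n)}

lemma IsGoodChart.chartEnergy_mono (h : IsGoodChart (m := m) q κ μ ρ)
    (hint : ∀ K : Set M, IsCompact K → IntegrableOn (energyDensity m β v) K (riemVolume m M))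
    {x x' : Eu m} {t t' : ℝ} (hsub : halfBall x t ⊆ halfBall x' t')
    (hD : halfBall x' t' ⊆ halfBall (extChartAt (𝓡∂ m) q q) κ) :
    chartEnergy β v q x t ≤ chartEnergy β v q x' t' := by
  refine setIntegral_mono_set (integrableOn_chartEnergyDensity (isCompact_halfBall _ _)
    (hD.trans h.subset_target) hint) ?_ (Filter.Eventually.of_forall hsub)
  filter_upwards [ae_restrict_mem (isCompact_halfBall x' t').measurableSet] with y hy
  exact chartEnergyDensity_nonneg (h.subset_target (hD hy))

lemma IsGoodChart.chartEnergy_nonneg (h : IsGoodChart (m := m) q κ μ ρ) {x : Eu m} {t : ℝ}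
    (hD : halfBall x t ⊆ halfBall (extChartAt (𝓡∂ m) q q) κ) : 0 ≤ chartEnergy β v q x t :=
  setIntegral_nonneg (isCompact_halfBall x t).measurableSet fun _ hy =>
    chartEnergyDensity_nonneg (h.subset_target (hD hy))

/-- Growth of the energy on half balls, in terms of the growth of the weight along rays. Half balls
are compared with ellipsoids: the ball of radius `t` lies in `ellipForm Q x₀ (2μt) ≤ 1/4`, and
`ellipForm Q x₀ (r/μ²) ≤ 1` lies in the ball of radius `r`. -/
lemma IsGoodChart.chartEnergy_le (h : IsGoodChart (m := m) q κ μ ρ)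
    (hst : IsInnerStationaryFree m β v) (hv : ∃ Dv, HasWeakDifferential (m := m) v Dv)
    (hint : ∀ K : Set M, IsCompact K → IntegrableOn (energyDensity m β v) K (riemVolume m M))
    {x₀ : Eu m} (hx₀ : x₀ ∈ halfBall (extChartAt (𝓡∂ m) q q) κ) {a c r₁ C₀ : ℝ} (ha : 0 ≤ a)
    (hc : 16 * μ ^ 9 ≤ c) (hC₀ : 0 ≤ C₀)
    (hZ : halfBall x₀ (μ ^ 2 * r₁) ⊆ halfBall (extChartAt (𝓡∂ m) q q) κ)
    (hcase : x₀ 0 = 0 ∨ μ ^ 2 * r₁ ≤ x₀ 0)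
    (hw : ∀ r, 0 < r → r ≤ r₁ → ∃ κ', a - c * r ≤ m - 2 - κ' - μ ^ 4 * r ∧
      ∀ x ∈ halfBall x₀ (μ ^ 2 * r), ∀ l : ℝ, 1 ≤ l → l ≤ 2 →
        x₀ + l • (x - x₀) ∈ halfBall x₀ (μ ^ 2 * r) →
        bdryDist m ((extChartAt (𝓡∂ m) q).symm x) ^ β ≤
          bdryDist m ((extChartAt (𝓡∂ m) q).symm (x₀ + l • (x - x₀))) ^ β *
            Real.exp (κ' * (l - 1) + C₀ * (l - 1) ^ 2))
    {t r : ℝ} (ht : 0 < t) (htr : t ≤ r) (hr : r ≤ r₁) :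
    chartEnergy β v q x₀ t ≤ Real.exp (c * (1 + a / 2) * r₁) * (2 * μ ^ 3) ^ a * (t / r) ^ a *
      chartEnergy β v q x₀ r := by
  have hμ1 := h.one_le
  have hμ : 0 < μ := zero_lt_one.trans_le hμ1
  have hr0 : 0 < r := ht.trans_le htr
  have hr1 : 0 < r₁ := hr0.trans_le hr
  have hc0 : 0 ≤ c := le_trans (by positivity) hc
  have hμ2 : 1 ≤ μ ^ 2 := one_le_pow₀ hμ1
  have hrD : halfBall x₀ r ⊆ halfBall (extChartAt (𝓡∂ m) q q) κ :=
    (halfBall_mono (by nlinarith)).trans hZ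
  have hP0 : 0 ≤ chartEnergy β v q x₀ r := h.chartEnergy_nonneg hrD
  have hexp : 1 ≤ Real.exp (c * (1 + a / 2) * r₁) := Real.one_le_exp (by positivity)
  -- if `r ≤ 2 μ³ t`, the bound follows from monotonicity in the radius
  rcases le_total r (2 * μ ^ 3 * t) with hrt | hrt
  · have h1 : 1 ≤ (2 * μ ^ 3) ^ a * (t / r) ^ a := by
      rw [← Real.mul_rpow (by positivity) (by positivity)]
      refine Real.one_le_rpow ?_ ha
      rw [← mul_div_assoc, one_le_div hr0]
      exact hrt
    refine (h.chartEnergy_mono hint (halfBall_mono htr) hrD).trans ?_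
    refine le_mul_of_one_le_left hP0 ?_
    rw [mul_assoc]
    exact one_le_mul_of_one_le_of_one_le hexp h1
  set D := halfBall (extChartAt (𝓡∂ m) q q) κ with hDdef
  obtain ⟨Q, hQ⟩ := h.elliptic.exists_symmInverse hx₀
  have hDc : IsCompact D := isCompact_halfBall _ _
  have hsubZ : ∀ r', 0 < r' → {y | ellipForm Q x₀ r' y ≤ 1} ⊆ closedBall x₀ (μ ^ 2 * r') := by
    intro r' hr' y hy
    rw [mem_closedBall, dist_eq_norm]
    exact h.elliptic.norm_le_of_ellipForm_le hx₀ hQ hr' hy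
  have hvar : ∀ r', 0 < r' → r' ≤ r₁ → ∃ a' c', a - c * r' ≤ a' ∧ c' ≤ c * r' ∧
      0 ≤ ∫ y in D, chartEnergyDensity β v q y * variationWeight Q x₀ r' a' c' y := by
    intro r' hr' hr'1
    obtain ⟨κ', hκ', hw'⟩ := hw r' hr' hr'1
    refine ⟨m - 2 - κ' - μ ^ 4 * r', 16 * μ ^ 9 * r', hκ', by gcongr, ?_⟩
    have hle : μ ^ 2 * r' ≤ μ ^ 2 * r₁ := by gcongr
    have hsub : {y | ellipForm Q x₀ r' y ≤ 1} ∩ {y | 0 ≤ y 0} ⊆ halfBall x₀ (μ ^ 2 * r') :=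
      inter_subset_inter_left _ (hsubZ r' hr')
    have hsubD : {y | ellipForm Q x₀ r' y ≤ 1} ∩ {y | 0 ≤ y 0} ⊆ D :=
      hsub.trans ((halfBall_mono hle).trans hZ)
    have h1 := hst.integral_variationWeight_nonneg hv hint h.subset_target h.elliptic hx₀ hQ hr'
      hsubD (hcase.imp id fun h0 y hy => ?_) hC₀
      (fun x hx l hl hl2 hlx => hw' x (hsub hx) l hl hl2 (hsub hlx))
    · rw [← setIntegral_eq_of_subset_of_forall_sdiff_eq_zero hDc.measurableSet hsubD] at h1
      · exact h1
      · intro y hy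
        have h2 : 1 ≤ ellipForm Q x₀ r' y := by
          by_contra hcon
          exact hy.2 ⟨(not_le.1 hcon).le, hy.1.2⟩
        rw [variationWeight, cutoff_eq_zero h2, deriv_cutoff_eq_zero_of_ge h2]
        ring
    · have h2 := hsubZ r' hr' hy
      rw [mem_closedBall, dist_eq_norm] at h2
      have h3 := (abs_le.1 ((abs_coord_le_norm (y - x₀) 0).trans h2)).1
      rw [PiLp.sub_apply] at h3
      change 0 ≤ y 0
      linarith
  have ht' : 0 < 2 * μ * t := by positivity
  have hr' : r / μ ^ 2 ≤ r₁ := (div_le_self hr0.le hμ2).trans hr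
  have htr' : 2 * μ * t ≤ r / μ ^ 2 := by
    rw [le_div_iff₀ (by positivity)]
    linarith
  have hr'0 : 0 < r / μ ^ 2 := by positivity
  have h1 := setIntegral_ellipsoid_le hDc.measurableSet
    (integrableOn_chartEnergyDensity hDc h.subset_target hint)
    (fun y hy => chartEnergyDensity_nonneg (h.subset_target hy))
    (h.elliptic.ellipForm_nonneg hx₀ hQ one_pos) ha hc0 hvar ht' htr' hr'
  have h2 : chartEnergy β v q x₀ t ≤
      ∫ y in D ∩ {y | ellipForm Q x₀ (2 * μ * t) y ≤ 1 / 4}, chartEnergyDensity β v q y := by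
    refine setIntegral_mono_set ((integrableOn_chartEnergyDensity hDc h.subset_target hint).mono_set
      inter_subset_left) ?_ (Filter.Eventually.of_forall fun y hy => ?_)
    · filter_upwards [ae_restrict_mem (hDc.measurableSet.inter
        (isClosed_le contDiff_ellipForm.continuous continuous_const).measurableSet)] with y hy
      exact chartEnergyDensity_nonneg (h.subset_target hy.1)
    · have hyD : y ∈ D := hrD (halfBall_mono htr hy)
      refine ⟨hyD, ?_⟩
      have h3 : ‖y - x₀‖ ≤ t := by rw [← dist_eq_norm]; exact hy.1
      have := h.elliptic.ellipForm_le_of_norm_le hx₀ hQ ht' (y := y) (c := 1 / 2) (by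
        calc μ * ‖y - x₀‖ ≤ μ * t := by gcongr
          _ = _ := by ring)
      change ellipForm Q x₀ (2 * μ * t) y ≤ 1 / 4
      linarith
  have h3 : ∫ y in D ∩ {y | ellipForm Q x₀ (r / μ ^ 2) y ≤ 1}, chartEnergyDensity β v q y ≤
      chartEnergy β v q x₀ r := by
    refine setIntegral_mono_set (integrableOn_chartEnergyDensity (isCompact_halfBall _ _)
      (hrD.trans h.subset_target) hint) ?_ (Filter.Eventually.of_forall fun y hy => ?_)
    · filter_upwards [ae_restrict_mem (isCompact_halfBall x₀ r).measurableSet] with y hy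
      exact chartEnergyDensity_nonneg (h.subset_target (hrD hy))
    · have h4 := hsubZ _ hr'0 hy.2
      rw [mul_div_cancel₀ _ (by positivity)] at h4
      exact ⟨h4, hy.1.2⟩
  have h4 : (2 * μ * t / (r / μ ^ 2)) ^ a = (2 * μ ^ 3) ^ a * (t / r) ^ a := by
    rw [← Real.mul_rpow (by positivity) (by positivity)]
    congr 1
    field_simp
  rw [h4] at h1
  calc chartEnergy β v q x₀ t ≤ _ := h2.trans h1
    _ ≤ Real.exp (c * (1 + a / 2) * r₁) * ((2 * μ ^ 3) ^ a * (t / r) ^ a) *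
        chartEnergy β v q x₀ r := by
      refine mul_le_mul (by gcongr) h3 ?_ (by positivity)
      exact setIntegral_nonneg (hDc.measurableSet.inter
        (isClosed_le contDiff_ellipForm.continuous continuous_const).measurableSet) fun y hy =>
        chartEnergyDensity_nonneg (h.subset_target hy.1)
    _ = _ := by ring

/-- Growth of the energy about a boundary point: the weight adds `β` to the dimension. -/
lemma IsGoodChart.exists_chartEnergy_le_of_boundary (h : IsGoodChart (m := m) q κ μ ρ)
    (hbdry : ∀ p : M, (connectedComponent p ∩ (𝓡∂ m).boundary M).Nonempty)
    (h0 : extChartAt (𝓡∂ m) q q 0 = 0) (hm : 3 ≤ m) (hβ : β ∈ Ioo (-1 : ℝ) 1) :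
    ∃ C > 0, ∃ η > 0, ∀ (n : ℕ) (v : M → EuclideanSpace ℝ (Fin n)), IsInnerStationaryFree m β v →
      (∃ Dv, HasWeakDifferential (m := m) v Dv) →
      (∀ K : Set M, IsCompact K → IntegrableOn (energyDensity m β v) K (riemVolume m M)) →
      ∀ x₀ : Eu m, x₀ 0 = 0 → ‖x₀ - extChartAt (𝓡∂ m) q q‖ ≤ η → ∀ t r : ℝ, 0 < t → t ≤ r →
      r ≤ η → chartEnergy β v q x₀ t ≤ C * (t / r) ^ (m - 2 + β : ℝ) * chartEnergy β v q x₀ r := by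
  have hμ1 := h.one_le
  have hμ : 0 < μ := zero_lt_one.trans_le hμ1
  have hρ := h.ρ_pos
  have hκ := h.κ_pos
  have hm' : (3 : ℝ) ≤ m := by exact_mod_cast hm
  have hμ2 : 1 ≤ μ ^ 2 := one_le_pow₀ hμ1
  set a : ℝ := m - 2 + β with ha
  have ha0 : 0 ≤ a := by linarith [hβ.1]
  set c : ℝ := μ * (1 + 2 * μ ^ 2) * μ ^ 2 + μ ^ 4 + 16 * μ ^ 9 with hc
  set η := min (κ / (4 * (1 + 2 * μ ^ 2) * μ ^ 2)) (ρ / (4 * μ ^ 3)) with hη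
  have hη0 : 0 < η := by positivity
  have hη1 : 4 * (1 + 2 * μ ^ 2) * μ ^ 2 * η ≤ κ := by
    have := min_le_left (κ / (4 * (1 + 2 * μ ^ 2) * μ ^ 2)) (ρ / (4 * μ ^ 3))
    rw [← hη, le_div_iff₀ (by positivity)] at this
    linarith
  have hη2 : 4 * μ ^ 3 * η ≤ ρ := by
    have := min_le_right (κ / (4 * (1 + 2 * μ ^ 2) * μ ^ 2)) (ρ / (4 * μ ^ 3))
    rw [← hη, le_div_iff₀ (by positivity)] at this
    linarith
  have hμη : μ ^ 2 * η ≤ κ / 12 := by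
    have : 0 ≤ (μ ^ 2 - 1) * (μ ^ 2 * η) := by
      have := sub_nonneg.2 hμ2
      positivity
    linarith
  have hηκ : η ≤ κ / 12 := le_trans (le_mul_of_one_le_left hη0.le hμ2) hμη
  refine ⟨Real.exp (c * (1 + a / 2) * η) * (2 * μ ^ 3) ^ a, by positivity, η, hη0,
    fun n v hst hv hint x₀ hx₀ hx₀q t r ht htr hr => ?_⟩
  have hx₀D : x₀ ∈ halfBall (extChartAt (𝓡∂ m) q q) κ :=
    ⟨by rw [mem_closedBall, dist_eq_norm]; linarith, hx₀.ge⟩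
  refine h.chartEnergy_le hst hv hint hx₀D ha0
    (by rw [hc]; linarith [show 0 ≤ μ * (1 + 2 * μ ^ 2) * μ ^ 2 + μ ^ 4 by positivity])
    (abs_nonneg β) ?_ (Or.inl hx₀) ?_ ht htr hr
  · intro y hy
    refine ⟨?_, hy.2⟩
    have h1 : dist y x₀ ≤ μ ^ 2 * η := hy.1
    rw [mem_closedBall]
    rw [← dist_eq_norm] at hx₀q
    linarith [dist_triangle y x₀ (extChartAt (𝓡∂ m) q q)]
  · intro r' hr' hr'η
    have hr'2 : μ ^ 2 * r' ≤ μ ^ 2 * η := by gcongr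
    refine ⟨-β + |β| * (μ * (1 + 2 * μ ^ 2) * (μ ^ 2 * r')), ?_, fun x hx l hl hl2 hlx => ?_⟩
    · have h1 : |β| * (μ * (1 + 2 * μ ^ 2) * (μ ^ 2 * r')) ≤ μ * (1 + 2 * μ ^ 2) * (μ ^ 2 * r') :=
        mul_le_of_le_one_left (by positivity) (abs_le.2 ⟨hβ.1.le, hβ.2.le⟩)
      have h2 : 0 ≤ 16 * μ ^ 9 * r' := by positivity
      rw [ha, hc]
      linarith
    · refine h.bdryDist_rpow_le_of_boundary hbdry h0 hx₀ (by linarith) ?_ ?_ hx.2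
        (by rw [← dist_eq_norm]; exact hx.1) hl hl2 (by rw [← dist_eq_norm]; exact hlx.1) β
      · calc 2 * (1 + 2 * μ ^ 2) * (μ ^ 2 * r') ≤ 2 * (1 + 2 * μ ^ 2) * (μ ^ 2 * η) := by gcongr
          _ ≤ κ / 2 := by linarith
      · calc μ * (‖x₀ - extChartAt (𝓡∂ m) q q‖ + μ ^ 2 * r') ≤ μ * (μ ^ 2 * η + μ ^ 2 * η) := by
              gcongr
              exact hx₀q.trans (le_mul_of_one_le_left hη0.le hμ2)
          _ = 2 * μ ^ 3 * η := by ring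
          _ < ρ := by
            have : 0 < 2 * μ ^ 3 * η := by positivity
            linarith

/-- Growth of the energy about an interior point, on balls that stay away from the boundary. -/
lemma IsGoodChart.exists_chartEnergy_le_of_interior (h : IsGoodChart (m := m) q κ μ ρ)
    (hbdry : ∀ p : M, (connectedComponent p ∩ (𝓡∂ m).boundary M).Nonempty)
    (hm : 3 ≤ m) (hβ : β ∈ Ioo (-1 : ℝ) 1) :
    ∃ C > 0, ∃ η > 0, ∃ c₀ > 0, c₀ ≤ 1 / 2 ∧
      ∀ (n : ℕ) (v : M → EuclideanSpace ℝ (Fin n)), IsInnerStationaryFree m β v →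
      (∃ Dv, HasWeakDifferential (m := m) v Dv) →
      (∀ K : Set M, IsCompact K → IntegrableOn (energyDensity m β v) K (riemVolume m M)) →
      ∀ x₀ : Eu m, 0 < x₀ 0 → ‖x₀ - extChartAt (𝓡∂ m) q q‖ ≤ η → ∀ t r : ℝ, 0 < t → t ≤ r →
      r ≤ η → r ≤ c₀ * x₀ 0 →
      chartEnergy β v q x₀ t ≤ C * (t / r) ^ (m - 2 : ℝ) * chartEnergy β v q x₀ r := by
  obtain ⟨ν, hν1, hν⟩ := h.exists_bdryDist_comparable hbdry
  have hμ1 := h.one_le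
  have hμ : 0 < μ := zero_lt_one.trans_le hμ1
  have hν0 : 0 < ν := zero_lt_one.trans_le hν1
  have hρ := h.ρ_pos
  have hκ := h.κ_pos
  have hm' : (3 : ℝ) ≤ m := by exact_mod_cast hm
  have hμ2 : 1 ≤ μ ^ 2 := one_le_pow₀ hμ1
  set a : ℝ := m - 2 with ha
  have ha0 : 0 ≤ a := by linarith
  set Y : ℝ := extChartAt (𝓡∂ m) q q 0 + κ with hY
  have hY0 : 0 < Y := by
    have : 0 ≤ extChartAt (𝓡∂ m) q q 0 := coord_nonneg_of_mem_target (mem_extChartAt_target q)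
    linarith
  -- the error in the exponent on balls of radius `r` is `A r / x₀ 0`, which is bounded for
  -- `r ≤ c₀ * x₀ 0`; the second term of `A` absorbs the coefficients, as heights are at most `Y`
  set A : ℝ := 2 * ν * μ ^ 3 + (μ ^ 4 + 16 * μ ^ 9) * Y with hA
  have hA0 : 0 < A := by positivity
  -- balls of radius `μ² c₀ * x₀ 0` stay at half the height of the centre above the boundary
  set c₀ : ℝ := 1 / (2 * μ ^ 2) with hc₀
  have hc₀0 : 0 < c₀ := by positivity
  set η := min (κ / (4 * μ ^ 2)) (ρ / (4 * μ ^ 3)) with hη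
  have hη0 : 0 < η := by positivity
  have hη1 : 4 * μ ^ 2 * η ≤ κ := by
    have := min_le_left (κ / (4 * μ ^ 2)) (ρ / (4 * μ ^ 3))
    rw [← hη, le_div_iff₀ (by positivity)] at this
    linarith
  have hη2 : 4 * μ ^ 3 * η ≤ ρ := by
    have := min_le_right (κ / (4 * μ ^ 2)) (ρ / (4 * μ ^ 3))
    rw [← hη, le_div_iff₀ (by positivity)] at this
    linarith
  have hημ : η ≤ μ ^ 2 * η := le_mul_of_one_le_left hη0.le hμ2
  refine ⟨Real.exp (A * (1 + a / 2) * c₀) * (2 * μ ^ 3) ^ a, by positivity, η, hη0, c₀, hc₀0, ?_,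
    fun n v hst hv hint x₀ hx₀ hx₀q t r ht htr hrη hr => ?_⟩
  · rw [hc₀]
    gcongr
    linarith
  have hx₀D : x₀ ∈ halfBall (extChartAt (𝓡∂ m) q q) κ :=
    ⟨by rw [mem_closedBall, dist_eq_norm]; linarith, hx₀.le⟩
  have hx₀Y : x₀ 0 ≤ Y := by
    have h1 := (le_abs_self _).trans
      ((abs_coord_le_norm (x₀ - extChartAt (𝓡∂ m) q q) 0).trans hx₀q)
    rw [PiLp.sub_apply] at h1
    rw [hY]
    linarith
  have hYx : 1 ≤ Y / x₀ 0 := (one_le_div hx₀).2 hx₀Y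
  set r₁ := min η (c₀ * x₀ 0) with hr₁
  have hr₁η : r₁ ≤ η := min_le_left _ _
  have hr₁x : μ ^ 2 * r₁ ≤ x₀ 0 / 2 := by
    calc μ ^ 2 * r₁ ≤ μ ^ 2 * (c₀ * x₀ 0) := by gcongr; exact min_le_right _ _
      _ = _ := by rw [hc₀]; field_simp
  have hmem : ∀ r', r' ≤ r₁ → ∀ y ∈ halfBall x₀ (μ ^ 2 * r'),
      y ∈ halfBall (extChartAt (𝓡∂ m) q q) κ ∧
        x₀ 0 / (2 * ν) ≤ bdryDist m ((extChartAt (𝓡∂ m) q).symm y) := by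
    intro r' hr' y hy
    have h1 : dist y x₀ ≤ μ ^ 2 * r₁ := le_trans hy.1 (by gcongr)
    have h2 : dist y x₀ ≤ μ ^ 2 * η := h1.trans (by gcongr)
    rw [← dist_eq_norm] at hx₀q
    have h3 := dist_triangle y x₀ (extChartAt (𝓡∂ m) q q)
    have hyD : y ∈ halfBall (extChartAt (𝓡∂ m) q q) κ :=
      ⟨by rw [mem_closedBall]; linarith, hy.2⟩
    refine ⟨hyD, ?_⟩
    have hyρ := h.symm_mem_eball hyD (r := ρ) (by
      rw [← dist_eq_norm]
      calc μ * dist y (extChartAt (𝓡∂ m) q q) ≤ μ * (μ ^ 2 * η + μ ^ 2 * η) := by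
            gcongr
            linarith
        _ = 2 * μ ^ 3 * η := by ring
        _ < ρ := by
          have : 0 < 2 * μ ^ 3 * η := by positivity
          linarith)
    have h4 := (hν y hyD hyρ).2
    have h5 := (abs_le.1 ((abs_coord_le_norm (y - x₀) 0).trans
      (by rw [← dist_eq_norm]; exact h1.trans hr₁x : ‖y - x₀‖ ≤ x₀ 0 / 2))).1
    rw [PiLp.sub_apply] at h5
    rw [div_le_iff₀ (by positivity)]
    linarith
  have hlast : Real.exp (A / x₀ 0 * (1 + a / 2) * r₁) ≤ Real.exp (A * (1 + a / 2) * c₀) := by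
    refine Real.exp_le_exp.2 ?_
    calc A / x₀ 0 * (1 + a / 2) * r₁ ≤ A / x₀ 0 * (1 + a / 2) * (c₀ * x₀ 0) := by
          gcongr
          exact min_le_right _ _
      _ = _ := by field_simp
  have hAx : A / x₀ 0 = 2 * ν * μ ^ 3 / x₀ 0 + (μ ^ 4 + 16 * μ ^ 9) * (Y / x₀ 0) := by
    rw [hA]; ring
  refine (h.chartEnergy_le hst hv hint hx₀D ha0 (c := A / x₀ 0) (r₁ := r₁) ?_ le_rfl
    (fun y hy => (hmem r₁ le_rfl y hy).1) (Or.inr (by linarith)) ?_ ht htr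
    (le_min hrη hr)).trans ?_
  · rw [hAx]
    have h1 : 16 * μ ^ 9 * 1 ≤ 16 * μ ^ 9 * (Y / x₀ 0) := by gcongr
    have h2 : 0 ≤ 2 * ν * μ ^ 3 / x₀ 0 := by positivity
    have h3 : 0 ≤ μ ^ 4 * (Y / x₀ 0) := by positivity
    linarith
  · intro r' hr' hr'1
    refine ⟨|β| * (μ * (μ ^ 2 * r') / (x₀ 0 / (2 * ν))), ?_, fun x hx l hl hl2 hlx => ?_⟩
    · have h1 : |β| * (μ * (μ ^ 2 * r') / (x₀ 0 / (2 * ν))) ≤ 2 * ν * μ ^ 3 / x₀ 0 * r' := by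
        calc _ ≤ μ * (μ ^ 2 * r') / (x₀ 0 / (2 * ν)) :=
              mul_le_of_le_one_left (by positivity) (abs_le.2 ⟨hβ.1.le, hβ.2.le⟩)
          _ = _ := by field_simp
      have h2 : μ ^ 4 * 1 * r' ≤ (μ ^ 4 + 16 * μ ^ 9) * (Y / x₀ 0) * r' := by
        gcongr
        linarith [show 0 ≤ 16 * μ ^ 9 by positivity]
      rw [hAx]
      linarith
    · have h1 := h.bdryDist_rpow_le_of_interior hbdry (hmem r' hr'1 x hx).1
        (hmem r' hr'1 _ hlx).1 (b := x₀ 0 / (2 * ν)) (d := (l - 1) * (μ ^ 2 * r')) (by positivity)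
        (hmem r' hr'1 x hx).2 (hmem r' hr'1 _ hlx).2 (by
          have : x₀ + l • (x - x₀) - x = (l - 1) • (x - x₀) := by
            rw [sub_smul, one_smul]; abel
          rw [this, norm_smul, Real.norm_eq_abs, abs_of_nonneg (by linarith)]
          have hx1 : ‖x - x₀‖ ≤ μ ^ 2 * r' := by rw [← dist_eq_norm]; exact hx.1
          have := sub_nonneg.2 hl
          gcongr) β
      refine h1.trans (le_of_eq ?_)
      congr 2
      ring
  · have := h.chartEnergy_nonneg (β := β) (v := v) (x := x₀) (t := r) (fun y hy =>
      (hmem r₁ le_rfl y (halfBall_mono ((le_min hrη hr).trans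
        (le_mul_of_one_le_left (le_trans (ht.trans_le htr).le (le_min hrη hr)) hμ2)) hy)).1)
    have h5 : 0 < r := ht.trans_le htr
    gcongr

end EnergyGrowth

/-! ### Combination of the interior and the boundary growth -/

/-- Powers with exponent in `[-1, 1]` of two numbers that are comparable with constant `l` are
comparable with the same constant. -/
lemma rpow_le_mul_rpow {x y l β : ℝ} (hx : 0 ≤ x) (hy : 0 ≤ y) (hl : 1 ≤ l) (hxy : x ≤ l * y)
    (hyx : y ≤ l * x) (hβ : |β| ≤ 1) : x ^ β ≤ l * y ^ β := by
  have hl0 : 0 < l := zero_lt_one.trans_le hl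
  have hlog : 0 ≤ Real.log l := Real.log_nonneg hl
  have h := rpow_le_rpow_mul_exp (β := β) (c₁ := Real.log l) (c₂ := Real.log l)
    (c := Real.log l) hx hy (by rwa [Real.exp_log hl0, mul_comm])
    (by rwa [Real.exp_log hl0, mul_comm])
    (fun _ => mul_le_of_le_one_left hlog ((le_abs_self _).trans hβ))
    (fun _ => mul_le_of_le_one_left hlog ((neg_le_abs _).trans hβ))
  rwa [Real.exp_log hl0, mul_comm] at h

/-- The growth rate of the energy on balls of radius `t` whose centre has height `p` above the
boundary; times `t²`, it is comparable to the weighted volume. -/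
def growthProfile (a β p t : ℝ) : ℝ := t ^ a * (t + p) ^ β

section Profile

variable {a β p t r : ℝ}

lemma growthProfile_pos (hp : 0 ≤ p) (ht : 0 < t) : 0 < growthProfile a β p t :=
  mul_pos (Real.rpow_pos_of_pos ht _) (Real.rpow_pos_of_pos (by linarith) _)

/-- The growth profile is doubling. -/
lemma growthProfile_le (ha : 0 ≤ a) (hβ : |β| ≤ 1) (hp : 0 ≤ p) (ht : 0 < t) (htr : t ≤ r)
    {l : ℝ} (hl : 1 ≤ l) (hrt : r ≤ l * t) :
    growthProfile a β p r ≤ l ^ (a + 1) * growthProfile a β p t := by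
  have hl0 : 0 < l := zero_lt_one.trans_le hl
  have hr : 0 < r := ht.trans_le htr
  have h2 : p ≤ l * p := le_mul_of_one_le_left hp hl
  have h4 : (r + p) ^ β ≤ l * (t + p) ^ β := by
    refine rpow_le_mul_rpow (by linarith) (by linarith) hl (by linarith) ?_ hβ
    calc t + p ≤ r + p := by gcongr
        _ ≤ _ := le_mul_of_one_le_left (by linarith) hl
  calc r ^ a * (r + p) ^ β ≤ (l * t) ^ a * (l * (t + p) ^ β) := by gcongr
    _ = _ := by
      rw [Real.mul_rpow hl0.le ht.le, Real.rpow_add_one hl0.ne', growthProfile]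
      ring

/-- If a quantity grows with exponent `a` about a centre at height `p`, on balls that stay away from
the boundary, and with exponent `a + β` about the projection of the centre to the boundary, then it
grows at least like the growth profile. Here `P` and `P'` are the quantity on balls about the centre
and about its projection. -/
lemma mul_growthProfile_le {P P' : ℝ → ℝ} {C c₀ R : ℝ} (ha : 1 ≤ a) (hβ : |β| ≤ 1)
    (hp : 0 ≤ p) (hC : 0 ≤ C) (hc₀ : 0 < c₀) (hc₀1 : c₀ ≤ 1 / 2)
    (hP0 : ∀ t ≤ R, 0 ≤ P t) (hmono : ∀ t r, 0 < t → t ≤ r → r ≤ R → P t ≤ P r)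
    (hint : ∀ t r, 0 < t → t ≤ r → r ≤ R → r ≤ c₀ * p → P t ≤ C * (t / r) ^ a * P r)
    (hbd : c₀ * p < R → (∀ t r, 0 < t → t ≤ r → r ≤ R → P' t ≤ C * (t / r) ^ (a + β) * P' r) ∧
      (∀ t, 0 < t → t + p ≤ R → P t ≤ P' (t + p)) ∧ ∀ r ≤ R, p ≤ r / 2 → P' (r / 2) ≤ P r)
    (ht : 0 < t) (htr : t ≤ r) (hr : r ≤ R) :
    P t * growthProfile a β p r ≤
      ((2 * (1 + 1 / c₀)) ^ (a + 1) + 3 * (2 * (1 + 1 / c₀)) ^ a * C + 2 * C) ^ 2 *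
        growthProfile a β p t * P r := by
  set L := 1 + 1 / c₀ with hL
  have hL1 : 1 ≤ L := by rw [hL]; linarith [one_div_pos.2 hc₀]
  set K := (2 * L) ^ (a + 1) + 3 * (2 * L) ^ a * C + 2 * C with hK
  have hK0 : 0 ≤ 3 * (2 * L) ^ a * C := by positivity
  have hK1 : 1 ≤ K := by
    have : 1 ≤ (2 * L) ^ (a + 1) := Real.one_le_rpow (by linarith) (by linarith)
    linarith
  -- on scales below `c₀ p` the factor `(t + p) ^ β` of the profile is almost constant
  have hinterior : ∀ t r, 0 < t → t ≤ r → r ≤ R → r ≤ c₀ * p →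
      P t * growthProfile a β p r ≤ K * growthProfile a β p t * P r := by
    intro t r ht htr hr hrp
    have hr0 : 0 < r := ht.trans_le htr
    have h1 := hint t r ht htr hr hrp
    have h2 : (r + p) ^ β ≤ 2 * (t + p) ^ β := by
      have : c₀ * p ≤ 1 / 2 * p := by gcongr
      refine rpow_le_mul_rpow (by linarith) (by linarith) one_le_two ?_ ?_ hβ <;> linarith
    have hPr := hP0 r hr
    have h3 : (t / r) ^ a * r ^ a = t ^ a := by
      rw [← Real.mul_rpow (by positivity) hr0.le, div_mul_cancel₀ _ hr0.ne']
    calc P t * growthProfile a β p r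
        ≤ (C * (t / r) ^ a * P r) * (r ^ a * (2 * (t + p) ^ β)) := by
          rw [growthProfile]
          have : 0 ≤ (r + p) ^ β := Real.rpow_nonneg (by linarith) _
          gcongr
      _ = 2 * C * ((t / r) ^ a * r ^ a * (t + p) ^ β) * P r := by ring
      _ = 2 * C * growthProfile a β p t * P r := by rw [h3, growthProfile]
      _ ≤ K * growthProfile a β p t * P r := by
        have := (growthProfile_pos (a := a) (β := β) hp ht).le
        gcongr
        have : 0 ≤ (2 * L) ^ (a + 1) := by positivity
        linarith
  -- on scales above `c₀ p` balls are enlarged to balls about the projection, at the cost of `L`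
  have hboundary : ∀ t r, 0 < t → t ≤ r → r ≤ R → c₀ * p ≤ t → c₀ * p < R →
      P t * growthProfile a β p r ≤ K * growthProfile a β p t * P r := by
    intro t r ht htr hr hpt hpR
    obtain ⟨h1, h2, h3⟩ := hbd hpR
    have hr0 : 0 < r := ht.trans_le htr
    have hPr := hP0 r hr
    have hΘ := (growthProfile_pos (a := a) (β := β) hp ht).le
    have htL : t + p ≤ L * t := by
      have : p ≤ t / c₀ := by rw [le_div_iff₀ hc₀]; linarith
      rw [hL]
      have e : (1 + 1 / c₀) * t = t + t / c₀ := by ring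
      linarith
    rcases le_total r (2 * L * t) with hrt | hrt
    · have h4 := growthProfile_le (by linarith : 0 ≤ a) hβ hp ht htr (by linarith : 1 ≤ 2 * L) hrt
      calc P t * growthProfile a β p r ≤ P r * ((2 * L) ^ (a + 1) * growthProfile a β p t) :=
            mul_le_mul (hmono t r ht htr hr) h4 (growthProfile_pos hp hr0).le hPr
        _ = (2 * L) ^ (a + 1) * growthProfile a β p t * P r := by ring
        _ ≤ _ := by
          gcongr
          linarith
    · have htp : t + p ≤ r / 2 := by linarith
      have htp0 : 0 < t + p := by linarith
      have hr2 : 0 < r / 2 := by linarith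
      have h4 := h1 (t + p) (r / 2) htp0 htp (by linarith)
      have h5 : P t ≤ C * ((t + p) / (r / 2)) ^ (a + β) * P r := by
        refine (h2 t ht (by linarith)).trans (h4.trans ?_)
        have := h3 r hr (by linarith)
        gcongr
      have h6 : (r + p) ^ β ≤ 3 * (r / 2) ^ β := by
        refine rpow_le_mul_rpow (by linarith) (by linarith) (by norm_num) ?_ ?_ hβ <;> linarith
      have h7 : ((t + p) / (r / 2)) ^ (a + β) * (r / 2) ^ β =
          ((t + p) / (r / 2)) ^ a * (t + p) ^ β := by
        rw [Real.rpow_add (by positivity), mul_assoc, ← Real.mul_rpow (by positivity) hr2.le,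
          div_mul_cancel₀ _ hr2.ne']
      have h8 : ((t + p) / (r / 2)) ^ a * r ^ a ≤ (2 * L) ^ a * t ^ a := by
        rw [← Real.mul_rpow (by positivity) hr0.le, ← Real.mul_rpow (by positivity) ht.le]
        refine Real.rpow_le_rpow (by positivity) ?_ (by linarith)
        calc (t + p) / (r / 2) * r = 2 * (t + p) := by field_simp
          _ ≤ 2 * (L * t) := by gcongr
          _ = _ := by ring
      have hβ0 : 0 ≤ (t + p) ^ β := Real.rpow_nonneg htp0.le _
      have hβ1 : 0 ≤ (r + p) ^ β := Real.rpow_nonneg (by linarith) _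
      calc P t * growthProfile a β p r
          ≤ (C * ((t + p) / (r / 2)) ^ (a + β) * P r) * (r ^ a * (3 * (r / 2) ^ β)) := by
            rw [growthProfile]
            gcongr
        _ = 3 * C * (((t + p) / (r / 2)) ^ (a + β) * (r / 2) ^ β) * r ^ a * P r := by ring
        _ = 3 * C * (((t + p) / (r / 2)) ^ a * r ^ a) * (t + p) ^ β * P r := by rw [h7]; ring
        _ ≤ 3 * C * ((2 * L) ^ a * t ^ a) * (t + p) ^ β * P r := by gcongr
        _ = 3 * (2 * L) ^ a * C * growthProfile a β p t * P r := by rw [growthProfile]; ring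
        _ ≤ _ := by
          gcongr
          have : 0 ≤ (2 * L) ^ (a + 1) := by positivity
          linarith
  have hΘt := growthProfile_pos (a := a) (β := β) hp ht
  have hKK : K ≤ K ^ 2 := le_self_pow₀ hK1 two_ne_zero
  have hup : K * growthProfile a β p t * P r ≤ K ^ 2 * growthProfile a β p t * P r := by
    have := hP0 r hr
    gcongr
  rcases le_total r (c₀ * p) with hrp | hrp
  · exact (hinterior t r ht htr hr hrp).trans hup
  rcases le_or_gt (c₀ * p) t with hpt | hpt
  · rcases htr.eq_or_lt with h | h
    · subst h
      refine le_trans ?_ hup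
      rw [mul_comm (P t)]
      exact mul_le_mul_of_nonneg_right (le_mul_of_one_le_left hΘt.le hK1) (hP0 t hr)
    · exact (hboundary t r ht htr hr hpt (hpt.trans_lt (h.trans_le hr))).trans hup
  rcases hrp.eq_or_lt with h | h
  · exact (hinterior t r ht htr hr h.ge).trans hup
  -- both regimes occur, and meet at the scale `c₀ p`
  set s := c₀ * p with hs
  have hs0 : 0 < s := ht.trans hpt
  have h1 := hinterior t s ht hpt.le (hrp.trans hr) le_rfl
  have h2 := hboundary s r hs0 hrp hr le_rfl (h.trans_le hr)
  have hΘs := growthProfile_pos (a := a) (β := β) hp hs0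
  have hΘr := growthProfile_pos (a := a) (β := β) hp (hs0.trans_le hrp)
  refine le_of_mul_le_mul_left ?_ hΘs
  calc growthProfile a β p s * (P t * growthProfile a β p r)
      = P t * growthProfile a β p s * growthProfile a β p r := by ring
    _ ≤ K * growthProfile a β p t * P s * growthProfile a β p r := by gcongr
    _ = K * growthProfile a β p t * (P s * growthProfile a β p r) := by ring
    _ ≤ K * growthProfile a β p t * (K * growthProfile a β p s * P r) := by gcongr
    _ = _ := by ring

end Profile

/-! ### The weighted volume of balls -/

section HalfBallVolume

variable {m : ℕ} [NeZero m] {β : ℝ}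

lemma sq_mul_growthProfile {p s : ℝ} (hs : 0 < s) :
    s ^ 2 * growthProfile (m - 2) β p s = s ^ m * (s + p) ^ β := by
  have : s ^ 2 * s ^ ((m : ℝ) - 2) = s ^ m := by
    rw [← Real.rpow_natCast s 2, ← Real.rpow_add hs, ← Real.rpow_natCast s m]
    congr 1
    push_cast
    ring
  rw [growthProfile, ← mul_assoc, this]

/-- The powers of the first coordinate are dominated by a product function on half balls. -/
lemma exists_integrable_eq_rpow_coord (hβ : -1 < β) {y : Eu m} (hy : 0 ≤ y 0) {s : ℝ} (hs : 0 < s) :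
    ∃ F : Eu m → ℝ, Integrable F ∧ (∀ z, 0 ≤ F z) ∧ (∀ z ∈ halfBall y s, F z = z 0 ^ β) ∧
      ∫ z, F z = (s + y 0) ^ (β + 1) / (β + 1) * (2 * s) ^ (m - 1) := by
  classical
  set f : Fin m → ℝ → ℝ := fun i => if i = 0 then (Icc 0 (s + y 0)).indicator (fun z => z ^ β)
    else (Icc (y i - s) (y i + s)).indicator 1 with hf
  have hf0 : f 0 = (Icc 0 (s + y 0)).indicator (fun z => z ^ β) := by simp [hf]
  have hfi : ∀ i, i ≠ 0 → f i = (Icc (y i - s) (y i + s)).indicator 1 := fun i hi => by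
    simp [hf, hi]
  have hfint : ∀ i, Integrable (f i) := by
    intro i
    by_cases hi : i = 0
    · subst hi
      rw [hf0, integrable_indicator_iff measurableSet_Icc, integrableOn_Icc_iff_integrableOn_Ioc,
        ← intervalIntegrable_iff_integrableOn_Ioc_of_le (by positivity)]
      exact intervalIntegral.intervalIntegrable_rpow' hβ
    · rw [hfi i hi, integrable_indicator_iff measurableSet_Icc]
      exact integrableOn_const (by simp)
  have hfnn : ∀ i z, 0 ≤ f i z := by
    intro i z
    by_cases hi : i = 0
    · subst hi
      rw [hf0]
      exact indicator_nonneg (fun z hz => Real.rpow_nonneg hz.1 _) z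
    · rw [hfi i hi]
      exact indicator_nonneg (fun _ _ => zero_le_one) z
  have hp : MeasurePreserving (MeasurableEquiv.toLp 2 (Fin m → ℝ)).symm :=
    PiLp.volume_preserving_ofLp (Fin m)
  refine ⟨fun z => ∏ i, f i (z i), ?_, fun z => Finset.prod_nonneg fun i _ => hfnn i _, ?_, ?_⟩
  · exact (hp.integrable_comp_emb (MeasurableEquiv.measurableEmbedding _)).2
      (Integrable.fintype_prod hfint)
  · intro z hz
    have hzy : ‖z - y‖ ≤ s := by rw [← dist_eq_norm]; exact hz.1
    have hc : ∀ i, |z i - y i| ≤ s := fun i => by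
      have := (abs_coord_le_norm (z - y) i).trans hzy
      rwa [PiLp.sub_apply] at this
    refine (Finset.prod_eq_single (0 : Fin m) (fun i _ hi => ?_) (by simp)).trans ?_
    · rw [hfi i hi, indicator_of_mem, Pi.one_apply]
      have := abs_le.1 (hc i)
      exact ⟨by linarith [this.1], by linarith [this.2]⟩
    · rw [hf0, indicator_of_mem]
      have := (abs_le.1 (hc 0)).2
      exact ⟨hz.2, by linarith⟩
  · have h1 : ∫ z : Eu m, ∏ i, f i (z i) = ∫ x : Fin m → ℝ, ∏ i, f i (x i) :=
      hp.integral_comp (MeasurableEquiv.measurableEmbedding _) (fun x => ∏ i, f i (x i))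
    rw [h1, integral_fintype_prod_volume_eq_prod, ← Finset.mul_prod_erase _ _ (Finset.mem_univ 0)]
    congr 1
    · rw [hf0, integral_indicator measurableSet_Icc, integral_Icc_eq_integral_Ioc,
        ← intervalIntegral.integral_of_le (by positivity), integral_rpow (Or.inl hβ),
        Real.zero_rpow (by linarith), sub_zero]
    · rw [Finset.prod_congr rfl (g := fun _ => 2 * s)]
      · simp
      · intro i hi
        rw [hfi i (Finset.ne_of_mem_erase hi), integral_indicator_one measurableSet_Icc,
          measureReal_def, Real.volume_Icc, ENNReal.toReal_ofReal (by linarith)]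
        ring

lemma integrableOn_rpow_coord (hβ : -1 < β) {y : Eu m} (hy : 0 ≤ y 0) {s : ℝ} (hs : 0 < s) :
    IntegrableOn (fun z : Eu m => z 0 ^ β) (halfBall y s) := by
  obtain ⟨F, hF, -, hFe, -⟩ := exists_integrable_eq_rpow_coord hβ hy hs
  exact hF.integrableOn.congr_fun hFe (isCompact_halfBall y s).measurableSet

lemma exists_volume_closedBall (m : ℕ) : ∃ V > 0, ∀ (x : Eu m) (s : ℝ), 0 ≤ s →
    volume.real (closedBall x s) = V * s ^ m := by
  refine ⟨volume.real (closedBall (0 : Eu m) 1), ?_, fun x s hs => ?_⟩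
  · exact ENNReal.toReal_pos (measure_closedBall_pos _ _ one_pos).ne' measure_closedBall_lt_top.ne
  · rw [measureReal_def, Measure.addHaar_closedBall' _ _ hs, ENNReal.toReal_mul,
      ENNReal.toReal_ofReal (by positivity), finrank_euclideanSpace_fin, mul_comm, measureReal_def]

/-- The integral of the weight `z₀ ^ β` over half balls is comparable to `s² · growthProfile`. From
above, the weight is almost constant on balls away from the boundary, and otherwise the half ball is
enclosed in a box; from below, there is a ball of radius `s / 4` at height `y₀ + s / 2`. -/
lemma exists_integral_rpow_coord_bounds (m : ℕ) [NeZero m] (hβ : β ∈ Ioo (-1 : ℝ) 1) :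
    ∃ C > 0, ∀ (y : Eu m) (s : ℝ), 0 ≤ y 0 → 0 < s →
      ∫ z in halfBall y s, z 0 ^ β ≤ C * (s ^ 2 * growthProfile (m - 2) β (y 0) s) ∧
      s ^ 2 * growthProfile (m - 2) β (y 0) s ≤ C * ∫ z in halfBall y s, z 0 ^ β := by
  obtain ⟨V, hV, hvol⟩ := exists_volume_closedBall m
  have hβ1 : |β| ≤ 1 := abs_le.2 ⟨hβ.1.le, hβ.2.le⟩
  have hβ2 : 0 < β + 1 := by linarith [hβ.1]
  set C₁ : ℝ := 3 * V + 3 * 2 ^ (m - 1) / (β + 1) with hC₁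
  set C₂ : ℝ := 4 * 4 ^ m / V with hC₂
  have hC₁0 : 0 < C₁ := by positivity
  have hC₂0 : 0 < C₂ := by positivity
  refine ⟨C₁ + C₂, by positivity, fun y s hy hs => ?_⟩
  have hsp : 0 < s + y 0 := by linarith
  have hI := integrableOn_rpow_coord hβ.1 hy hs
  have hm := (isCompact_halfBall y s).measurableSet
  have hI0 : 0 ≤ ∫ z in halfBall y s, z 0 ^ β :=
    setIntegral_nonneg hm fun z hz => Real.rpow_nonneg hz.2 _
  have hc : ∀ z : Eu m, ∀ c, ‖z - y‖ ≤ c → |z 0 - y 0| ≤ c := fun z c hz => by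
    have := (abs_coord_le_norm (z - y) 0).trans hz
    rwa [PiLp.sub_apply] at this
  have hW : 0 < s ^ m * (s + y 0) ^ β := by positivity
  rw [sq_mul_growthProfile hs]
  constructor
  · suffices ∫ z in halfBall y s, z 0 ^ β ≤ C₁ * (s ^ m * (s + y 0) ^ β) by
      refine this.trans ?_
      gcongr
      linarith
    rcases le_total (2 * s) (y 0) with h | h
    · calc ∫ z in halfBall y s, z 0 ^ β ≤ ∫ z in halfBall y s, 3 * (s + y 0) ^ β := by
            refine setIntegral_mono_on hI (integrableOn_const
              (isCompact_halfBall y s).measure_lt_top.ne) hm fun z hz => ?_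
            have h1 := abs_le.1 (hc z s (by rw [← dist_eq_norm]; exact hz.1))
            refine rpow_le_mul_rpow hz.2 hsp.le (by norm_num) ?_ ?_ hβ1 <;> linarith [h1.1, h1.2]
        _ = volume.real (halfBall y s) * (3 * (s + y 0) ^ β) := by
            rw [setIntegral_const, smul_eq_mul]
        _ ≤ V * s ^ m * (3 * (s + y 0) ^ β) := by
            rw [← hvol y s hs.le]
            gcongr
            · exact measure_closedBall_lt_top.ne
            · exact inter_subset_left
        _ = 3 * V * (s ^ m * (s + y 0) ^ β) := by ring
        _ ≤ _ := by
            gcongr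
            rw [hC₁]
            have : 0 ≤ 3 * 2 ^ (m - 1) / (β + 1) := by positivity
            linarith
    · obtain ⟨F, hF, hF0, hFe, hFi⟩ := exists_integrable_eq_rpow_coord hβ.1 hy hs
      have hsm : s ^ (m - 1) * s = s ^ m := by
        rw [← pow_succ, Nat.sub_add_cancel (NeZero.one_le)]
      calc ∫ z in halfBall y s, z 0 ^ β = ∫ z in halfBall y s, F z :=
            (setIntegral_congr_fun hm hFe).symm
        _ ≤ ∫ z, F z := setIntegral_le_integral hF (Filter.Eventually.of_forall hF0)
        _ = (s + y 0) ^ β * (s + y 0) / (β + 1) * (2 * s) ^ (m - 1) := by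
            rw [hFi, Real.rpow_add_one hsp.ne']
        _ ≤ (s + y 0) ^ β * (3 * s) / (β + 1) * (2 * s) ^ (m - 1) := by
            gcongr
            linarith
        _ = 3 * 2 ^ (m - 1) / (β + 1) * ((s ^ (m - 1) * s) * (s + y 0) ^ β) := by
            rw [mul_pow]; ring
        _ ≤ _ := by
            rw [hsm]
            gcongr
            rw [hC₁]
            linarith
  · suffices s ^ m * (s + y 0) ^ β ≤ C₂ * ∫ z in halfBall y s, z 0 ^ β by
      refine this.trans ?_
      gcongr
      linarith
    set x : Eu m := y + (s / 2) • stdVec 0 with hx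
    have hxy : ‖x - y‖ ≤ s / 2 := by
      rw [hx, add_sub_cancel_left, norm_smul, Real.norm_eq_abs, abs_of_pos (by positivity)]
      simp
    have hx0 : x 0 = y 0 + s / 2 := by simp [hx]
    have hcoord : ∀ z ∈ closedBall x (s / 4), y 0 + s / 4 ≤ z 0 ∧ z 0 ≤ y 0 + 3 * s / 4 := by
      intro z hz
      rw [mem_closedBall, dist_eq_norm] at hz
      have h1 := abs_le.1 ((abs_coord_le_norm (z - x) 0).trans hz)
      rw [PiLp.sub_apply, hx0] at h1
      constructor <;> linarith [h1.1, h1.2]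
    have hsub : closedBall x (s / 4) ⊆ halfBall y s := by
      intro z hz
      refine ⟨?_, ?_⟩
      · rw [← dist_eq_norm] at hxy
        rw [mem_closedBall] at hz ⊢
        linarith [dist_triangle z x y]
      · have := (hcoord z hz).1
        change 0 ≤ z 0
        linarith
    have h1 : V * (s / 4) ^ m * ((s + y 0) ^ β / 4) ≤ ∫ z in halfBall y s, z 0 ^ β := by
      calc V * (s / 4) ^ m * ((s + y 0) ^ β / 4)
          = ∫ z in closedBall x (s / 4), (s + y 0) ^ β / 4 := by
            rw [setIntegral_const, hvol x _ (by positivity), smul_eq_mul]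
        _ ≤ ∫ z in closedBall x (s / 4), z 0 ^ β := by
            refine setIntegral_mono_on (integrableOn_const measure_closedBall_lt_top.ne)
              (hI.mono_set hsub) measurableSet_closedBall fun z hz => ?_
            obtain ⟨h1, h2⟩ := hcoord z hz
            rw [div_le_iff₀ (by norm_num), mul_comm]
            refine rpow_le_mul_rpow hsp.le (by linarith) (by norm_num) ?_ ?_ hβ1 <;> linarith
        _ ≤ _ := by
            refine setIntegral_mono_set hI ?_ (Filter.Eventually.of_forall hsub)
            filter_upwards [ae_restrict_mem hm] with z hz
            exact Real.rpow_nonneg hz.2 _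
    calc s ^ m * (s + y 0) ^ β = C₂ * (V * (s / 4) ^ m * ((s + y 0) ^ β / 4)) := by
          rw [hC₂, div_pow]
          field_simp
      _ ≤ _ := by gcongr

end HalfBallVolume

/-! ### Riemannian balls: weighted volume and energy -/

section LocalMonotonicity

variable {m n : ℕ} [NeZero m] {M : Type*} [EMetricSpace M] [ChartedSpace (EuclideanHalfSpace m) M]
  [IsManifold (𝓡∂ m) ∞ M] [RiemannianBundle (fun x : M => TangentSpace (𝓡∂ m) x)]
  [IsContMDiffRiemannianBundle (𝓡∂ m) ∞ (EuclideanSpace ℝ (Fin m))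
      (fun x : M => TangentSpace (𝓡∂ m) x)]
  [MeasurableSpace M] [BorelSpace M] [SecondCountableTopology M] [IsRiemannianManifold (𝓡∂ m) M]

attribute [local instance] isManifold_one

variable {q : M} {κ μ ρ β : ℝ}

/-- Small Riemannian balls of radius `r` lie between the half balls of radius `r / (2μ)` and `μ r`
of the chart. -/
lemma IsGoodChart.exists_eball_comparison (h : IsGoodChart (m := m) q κ μ ρ) :
    ∃ η > 0, ∀ y ∈ halfBall (extChartAt (𝓡∂ m) q q) η, ∀ r, 0 < r → r ≤ η →
      halfBall y (μ * r) ⊆ halfBall (extChartAt (𝓡∂ m) q q) κ ∧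
      (∀ z ∈ halfBall y (μ * r), (extChartAt (𝓡∂ m) q).symm z ∈ eball q (ENNReal.ofReal ρ)) ∧
      eball ((extChartAt (𝓡∂ m) q).symm y) (ENNReal.ofReal r) ⊆ (extChartAt (𝓡∂ m) q).source ∧
      (extChartAt (𝓡∂ m) q).target ∩ (extChartAt (𝓡∂ m) q).symm ⁻¹'
        eball ((extChartAt (𝓡∂ m) q).symm y) (ENNReal.ofReal r) ⊆ halfBall y (μ * r) ∧
      halfBall y (r / (2 * μ)) ⊆ (extChartAt (𝓡∂ m) q).target ∩ (extChartAt (𝓡∂ m) q).symm ⁻¹'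
        eball ((extChartAt (𝓡∂ m) q).symm y) (ENNReal.ofReal r) := by
  have hμ1 := h.one_le
  have hμ : 0 < μ := zero_lt_one.trans_le hμ1
  have hρ := h.ρ_pos
  have hκ := h.κ_pos
  set η := min (κ / (2 * μ)) (ρ / (4 * μ ^ 2)) with hη
  have hη0 : 0 < η := by positivity
  have hη1 : 2 * μ * η ≤ κ := by
    have := min_le_left (κ / (2 * μ)) (ρ / (4 * μ ^ 2))
    rw [← hη, le_div_iff₀ (by positivity)] at this
    linarith
  have hη2 : 4 * μ ^ 2 * η ≤ ρ := by
    have := min_le_right (κ / (2 * μ)) (ρ / (4 * μ ^ 2))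
    rw [← hη, le_div_iff₀ (by positivity)] at this
    linarith
  have hημ : η ≤ μ * η := le_mul_of_one_le_left hη0.le hμ1
  have hημ2 : μ * η ≤ μ ^ 2 * η := by
    rw [pow_two, mul_assoc]
    exact le_mul_of_one_le_left (by positivity) hμ1
  refine ⟨η, hη0, fun y hy r hr hrη => ?_⟩
  have hyη : dist y (extChartAt (𝓡∂ m) q q) ≤ η := hy.1
  have hrμ : μ * r ≤ μ * η := by gcongr
  have hnear : ∀ z ∈ halfBall y (μ * r), dist z (extChartAt (𝓡∂ m) q q) ≤ 2 * μ * η := by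
    intro z hz
    have h1 : dist z y ≤ μ * r := hz.1
    linarith [dist_triangle z y (extChartAt (𝓡∂ m) q q)]
  have hsub : halfBall y (μ * r) ⊆ halfBall (extChartAt (𝓡∂ m) q q) κ := fun z hz =>
    ⟨(hnear z hz).trans hη1, hz.2⟩
  have hyD : y ∈ halfBall (extChartAt (𝓡∂ m) q q) κ := ⟨hyη.trans (by linarith), hy.2⟩
  have hyρ : (extChartAt (𝓡∂ m) q).symm y ∈ eball q (ENNReal.ofReal ρ) := by
    refine h.symm_mem_eball hyD ?_
    rw [← dist_eq_norm]
    have : μ * dist y (extChartAt (𝓡∂ m) q q) ≤ μ * η := by gcongr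
    have : 0 < μ ^ 2 * η := by positivity
    linarith
  have hball : ∀ x ∈ eball ((extChartAt (𝓡∂ m) q).symm y) (ENNReal.ofReal r),
      x ∈ (extChartAt (𝓡∂ m) q).source ∧
        extChartAt (𝓡∂ m) q x ∈ halfBall (extChartAt (𝓡∂ m) q q) κ := by
    intro x hx
    refine h.eball_subset x ?_
    rw [mem_eball] at hx hyρ ⊢
    refine (edist_triangle x ((extChartAt (𝓡∂ m) q).symm y) q).trans_lt ?_
    refine (ENNReal.add_lt_add hx hyρ).trans_le ?_
    rw [← ENNReal.ofReal_add hr.le hρ.le]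
    exact ENNReal.ofReal_le_ofReal (by linarith)
  refine ⟨hsub, fun z hz => ?_, fun x hx => (hball x hx).1, ?_, ?_⟩
  · refine h.symm_mem_eball (hsub hz) ?_
    rw [← dist_eq_norm]
    calc μ * dist z (extChartAt (𝓡∂ m) q q) ≤ μ * (2 * μ * η) := by
          gcongr
          exact hnear z hz
      _ = 2 * μ ^ 2 * η := by ring
      _ < ρ := by
        have : 0 < μ ^ 2 * η := by positivity
        linarith
  · rintro z ⟨hzT, hz⟩
    refine ⟨?_, coord_nonneg_of_mem_target hzT⟩
    rw [mem_preimage, mem_eball, edist_comm] at hz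
    have h2 := h.enorm_sub_le_edist
      (eball_subset_eball (ENNReal.ofReal_le_ofReal (by linarith)) hyρ)
      (hz.trans_le (ENNReal.ofReal_le_ofReal (by linarith)))
    rw [(extChartAt (𝓡∂ m) q).right_inv hzT,
      (extChartAt (𝓡∂ m) q).right_inv (h.subset_target hyD)] at h2
    have h3 := h2.trans (mul_le_mul_right hz.le _)
    rw [← ENNReal.ofReal_mul hμ.le, ← ofReal_norm, ENNReal.ofReal_le_ofReal_iff (by positivity)]
      at h3
    rwa [mem_closedBall, dist_eq_norm]
  · intro z hz
    have hle : r / (2 * μ) ≤ μ * r := by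
      rw [div_le_iff₀ (by positivity)]
      calc r ≤ μ ^ 2 * r := le_mul_of_one_le_left hr.le (one_le_pow₀ hμ1)
        _ ≤ 2 * (μ ^ 2 * r) := by linarith [show 0 ≤ μ ^ 2 * r by positivity]
        _ = _ := by ring
    have hzD := hsub (halfBall_mono hle hz)
    refine ⟨h.subset_target hzD, ?_⟩
    rw [mem_preimage, mem_eball, edist_comm]
    refine (h.edist_symm_le hyD hzD).trans_lt ((ENNReal.ofReal_lt_ofReal_iff hr).2 ?_)
    have h1 : ‖z - y‖ ≤ r / (2 * μ) := by rw [← dist_eq_norm]; exact hz.1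
    calc μ * ‖z - y‖ ≤ μ * (r / (2 * μ)) := by gcongr
      _ = r / 2 := by field_simp
      _ < r := by linarith

/-- The weighted volume of small balls is comparable to `r² · growthProfile`, since the weight is
comparable to `z₀ ^ β`. -/
lemma IsGoodChart.exists_omega_bounds (h : IsGoodChart (m := m) q κ μ ρ)
    (hbdry : ∀ p : M, (connectedComponent p ∩ (𝓡∂ m).boundary M).Nonempty)
    (hm : 3 ≤ m) (hβ : β ∈ Ioo (-1 : ℝ) 1) :
    ∃ C > 0, ∃ η > 0, ∀ y ∈ halfBall (extChartAt (𝓡∂ m) q q) η, ∀ r, 0 < r → r ≤ η →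
      omega m β ((extChartAt (𝓡∂ m) q).symm y) r ≤
        C * (r ^ 2 * growthProfile (m - 2) β (y 0) r) ∧
      r ^ 2 * growthProfile (m - 2) β (y 0) r ≤
        C * omega m β ((extChartAt (𝓡∂ m) q).symm y) r := by
  have hμ1 := h.one_le
  have hμ : 0 < μ := zero_lt_one.trans_le hμ1
  have hm' : (3 : ℝ) ≤ m := by exact_mod_cast hm
  have hβ1 : |β| ≤ 1 := abs_le.2 ⟨hβ.1.le, hβ.2.le⟩
  have ha : (0 : ℝ) ≤ m - 2 := by linarith
  obtain ⟨ν, hν1, hν⟩ := h.exists_bdryDist_comparable hbdry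
  have hν0 : 0 < ν := zero_lt_one.trans_le hν1
  obtain ⟨η, hη, hcomp⟩ := h.exists_eball_comparison
  obtain ⟨A, hA, hAb⟩ := exists_integral_rpow_coord_bounds m hβ
  set C₁ : ℝ := μ * ν * A * (μ ^ 2 * μ ^ ((m : ℝ) - 2 + 1)) with hC₁
  set C₂ : ℝ := (2 * μ) ^ 2 * (2 * μ) ^ ((m : ℝ) - 2 + 1) * (A * (μ * ν)) with hC₂
  have hC₁0 : 0 < C₁ := by positivity
  have hC₂0 : 0 < C₂ := by positivity
  refine ⟨C₁ + C₂, by positivity, η, hη, fun y hy r hr hrη => ?_⟩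
  obtain ⟨hD, hDρ, hsrc, hup, hlow⟩ := hcomp y hy r hr hrη
  have hy0 : 0 ≤ y 0 := hy.2
  set g : Eu m → ℝ := fun z => volDensity (m := m) q z *
    bdryDist m ((extChartAt (𝓡∂ m) q).symm z) ^ β with hg
  have hμr : 0 < μ * r := by positivity
  have hμr' : 0 < r / (2 * μ) := by positivity
  have hI := integrableOn_rpow_coord hβ.1 hy0 hμr
  have hBm := (isCompact_halfBall y (μ * r)).measurableSet
  have hB'm := (isCompact_halfBall y (r / (2 * μ))).measurableSet
  have hpos : ∀ z ∈ halfBall y (μ * r), 0 ≤ g z := fun z hz =>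
    mul_nonneg (volDensity_pos q (h.subset_target (hD hz))).le
      (Real.rpow_nonneg (bdryDist_nonneg _) _)
  have hgle : ∀ z ∈ halfBall y (μ * r), g z ≤ μ * ν * z 0 ^ β := by
    intro z hz
    have h1 := hν z (hD hz) (hDρ z hz)
    have h2 := rpow_le_mul_rpow (bdryDist_nonneg _) hz.2 hν1 h1.1 h1.2 hβ1
    rw [mul_assoc]
    exact mul_le_mul (h.volDensity_le z (hD hz)) h2 (Real.rpow_nonneg (bdryDist_nonneg _) _) hμ.le
  have hgge : ∀ z ∈ halfBall y (μ * r), z 0 ^ β ≤ μ * ν * g z := by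
    intro z hz
    have h1 := hν z (hD hz) (hDρ z hz)
    have h2 := rpow_le_mul_rpow hz.2 (bdryDist_nonneg _) hν1 h1.2 h1.1 hβ1
    refine h2.trans ?_
    have h3 := h.le_volDensity z (hD hz)
    have h4 : 0 ≤ ν * bdryDist m ((extChartAt (𝓡∂ m) q).symm z) ^ β :=
      mul_nonneg hν0.le (Real.rpow_nonneg (bdryDist_nonneg _) _)
    calc _ ≤ (μ * volDensity (m := m) q z) *
          (ν * bdryDist m ((extChartAt (𝓡∂ m) q).symm z) ^ β) := le_mul_of_one_le_left h4 h3
      _ = _ := by rw [hg]; ring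
  have hgI : IntegrableOn g (halfBall y (μ * r)) := by
    refine Integrable.mono' (hI.const_mul (μ * ν)) ?_ ?_
    · have hT := hD.trans h.subset_target
      refine AEStronglyMeasurable.mul
        (((contDiffOn_volDensity q).continuousOn.mono hT).aestronglyMeasurable hBm) ?_
      have h1 : AEMeasurable (extChartAt (𝓡∂ m) q).symm (volume.restrict (halfBall y (μ * r))) :=
        ((continuousOn_extChartAt_symm q).mono hT).aemeasurable hBm
      have h2 : Measurable (bdryDist m : M → ℝ) := measurable_infEDist.ennreal_toReal
      exact ((h2.comp_aemeasurable h1).pow_const β).aestronglyMeasurable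
    · filter_upwards [ae_restrict_mem hBm] with z hz
      rw [Real.norm_eq_abs, abs_of_nonneg (hpos z hz)]
      exact hgle z hz
  have hω : omega m β ((extChartAt (𝓡∂ m) q).symm y) r =
      ∫ z in (extChartAt (𝓡∂ m) q).target ∩ (extChartAt (𝓡∂ m) q).symm ⁻¹'
        eball ((extChartAt (𝓡∂ m) q).symm y) (ENNReal.ofReal r), g z :=
    setIntegral_riemVolume q isOpen_eball.measurableSet hsrc _
  have hmS : MeasurableSet ((extChartAt (𝓡∂ m) q).target ∩ (extChartAt (𝓡∂ m) q).symm ⁻¹'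
      eball ((extChartAt (𝓡∂ m) q).symm y) (ENNReal.ofReal r)) :=
    measurableSet_target_inter q isOpen_eball.measurableSet
  have hΘ : 0 < growthProfile (m - 2) β (y 0) r := growthProfile_pos hy0 hr
  have h1 : omega m β ((extChartAt (𝓡∂ m) q).symm y) r ≤
      C₁ * (r ^ 2 * growthProfile (m - 2) β (y 0) r) := by
    calc _ ≤ ∫ z in halfBall y (μ * r), g z := by
          rw [hω]
          refine setIntegral_mono_set hgI ?_ (Filter.Eventually.of_forall hup)
          filter_upwards [ae_restrict_mem hBm] with z hz
          exact hpos z hz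
      _ ≤ ∫ z in halfBall y (μ * r), μ * ν * z 0 ^ β :=
          setIntegral_mono_on hgI (hI.const_mul _) hBm hgle
      _ = μ * ν * ∫ z in halfBall y (μ * r), z 0 ^ β := integral_const_mul _ _
      _ ≤ μ * ν * (A * ((μ * r) ^ 2 * growthProfile (m - 2) β (y 0) (μ * r))) := by
          gcongr
          exact (hAb y (μ * r) hy0 hμr).1
      _ ≤ μ * ν * (A * ((μ * r) ^ 2 * (μ ^ ((m : ℝ) - 2 + 1) *
            growthProfile (m - 2) β (y 0) r))) := by
          gcongr
          exact growthProfile_le ha hβ1 hy0 hr (le_mul_of_one_le_left hr.le hμ1) hμ1 le_rfl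
      _ = _ := by rw [hC₁]; ring
  have h2 : r ^ 2 * growthProfile (m - 2) β (y 0) r ≤
      C₂ * omega m β ((extChartAt (𝓡∂ m) q).symm y) r := by
    have h3 : ∫ z in halfBall y (r / (2 * μ)), z 0 ^ β ≤
        μ * ν * omega m β ((extChartAt (𝓡∂ m) q).symm y) r := by
      calc ∫ z in halfBall y (r / (2 * μ)), z 0 ^ β
          ≤ ∫ z in halfBall y (r / (2 * μ)), μ * ν * g z :=
            setIntegral_mono_on (hI.mono_set (hlow.trans hup))
              ((hgI.mono_set (hlow.trans hup)).const_mul _) hB'm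
              fun z hz => hgge z (hup (hlow hz))
        _ = μ * ν * ∫ z in halfBall y (r / (2 * μ)), g z := integral_const_mul _ _
        _ ≤ _ := by
            rw [hω]
            refine mul_le_mul_of_nonneg_left (setIntegral_mono_set (hgI.mono_set hup) ?_
              (Filter.Eventually.of_forall hlow)) (by positivity)
            filter_upwards [ae_restrict_mem hmS] with z hz
            exact hpos z (hup hz)
    have e : r = 2 * μ * (r / (2 * μ)) := by field_simp
    have h4 : growthProfile (m - 2) β (y 0) r ≤
        (2 * μ) ^ ((m : ℝ) - 2 + 1) * growthProfile (m - 2) β (y 0) (r / (2 * μ)) :=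
      growthProfile_le ha hβ1 hy0 hμr' (div_le_self hr.le (by linarith)) (by linarith) e.le
    calc r ^ 2 * growthProfile (m - 2) β (y 0) r
        ≤ r ^ 2 * ((2 * μ) ^ ((m : ℝ) - 2 + 1) *
            growthProfile (m - 2) β (y 0) (r / (2 * μ))) := by gcongr
      _ = (2 * μ) ^ 2 * (2 * μ) ^ ((m : ℝ) - 2 + 1) *
            ((r / (2 * μ)) ^ 2 * growthProfile (m - 2) β (y 0) (r / (2 * μ))) := by
          rw [div_pow]
          field_simp
      _ ≤ (2 * μ) ^ 2 * (2 * μ) ^ ((m : ℝ) - 2 + 1) * (A * (μ * ν *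
            omega m β ((extChartAt (𝓡∂ m) q).symm y) r)) := by
          refine mul_le_mul_of_nonneg_left ((hAb y _ hy0 hμr').2.trans ?_) (by positivity)
          gcongr
      _ = _ := by rw [hC₂]; ring
  -- positivity of the weighted volume lets both bounds have the same constant
  have hω0 : 0 < omega m β ((extChartAt (𝓡∂ m) q).symm y) r := by
    by_contra hcon
    have := mul_nonpos_of_nonneg_of_nonpos hC₂0.le (not_lt.1 hcon)
    have : 0 < r ^ 2 * growthProfile (m - 2) β (y 0) r := by positivity
    linarith
  constructor
  · refine h1.trans ?_
    gcongr
    linarith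
  · refine h2.trans ?_
    gcongr
    linarith

/-- In a good chart the energy on half balls grows at least like the growth profile. -/
lemma IsGoodChart.exists_chartEnergy_growth (h : IsGoodChart (m := m) q κ μ ρ)
    (hbdry : ∀ p : M, (connectedComponent p ∩ (𝓡∂ m).boundary M).Nonempty)
    (hm : 3 ≤ m) (hβ : β ∈ Ioo (-1 : ℝ) 1) :
    ∃ C > 0, ∃ η > 0, ∀ (n : ℕ) (v : M → EuclideanSpace ℝ (Fin n)), IsInnerStationaryFree m β v →
      (∃ Dv, HasWeakDifferential (m := m) v Dv) →
      (∀ K : Set M, IsCompact K → IntegrableOn (energyDensity m β v) K (riemVolume m M)) →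
      ∀ y ∈ halfBall (extChartAt (𝓡∂ m) q q) η, ∀ t r : ℝ, 0 < t → t ≤ r → r ≤ η →
      chartEnergy β v q y t * growthProfile (m - 2) β (y 0) r ≤
        C * growthProfile (m - 2) β (y 0) t * chartEnergy β v q y r := by
  have hκ := h.κ_pos
  have hm' : (3 : ℝ) ≤ m := by exact_mod_cast hm
  have hβ1 : |β| ≤ 1 := abs_le.2 ⟨hβ.1.le, hβ.2.le⟩
  have ha : (1 : ℝ) ≤ m - 2 := by linarith
  obtain ⟨C₁, hC₁, η₁, hη₁, c₀, hc₀, hc₀1, hint₁⟩ :=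
    h.exists_chartEnergy_le_of_interior hbdry hm hβ
  have hball : ∀ {x : Eu m} {s s' : ℝ}, ‖x - extChartAt (𝓡∂ m) q q‖ ≤ s → s + s' ≤ κ →
      halfBall x s' ⊆ halfBall (extChartAt (𝓡∂ m) q q) κ := by
    intro x s s' hx hss z hz
    refine ⟨?_, hz.2⟩
    have h1 : dist z x ≤ s' := hz.1
    rw [← dist_eq_norm] at hx
    rw [mem_closedBall]
    linarith [dist_triangle z x (extChartAt (𝓡∂ m) q q)]
  by_cases h0 : extChartAt (𝓡∂ m) q q 0 = 0
  · obtain ⟨C₂, hC₂, η₂, hη₂, hbd₂⟩ := h.exists_chartEnergy_le_of_boundary hbdry h0 hm hβ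
    set C := max C₁ C₂ with hC
    have hC0 : 0 < C := lt_max_of_lt_left hC₁
    set η := min (κ / 2) (min η₁ η₂) with hη
    have hη0 : 0 < η := lt_min (by positivity) (lt_min hη₁ hη₂)
    have hηκ : η ≤ κ / 2 := min_le_left _ _
    have hηη₁ : η ≤ η₁ := (min_le_right _ _).trans (min_le_left _ _)
    have hηη₂ : η ≤ η₂ := (min_le_right _ _).trans (min_le_right _ _)
    refine ⟨((2 * (1 + 1 / c₀)) ^ ((m : ℝ) - 2 + 1) + 3 * (2 * (1 + 1 / c₀)) ^ ((m : ℝ) - 2) * C +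
      2 * C) ^ 2, by positivity, η, hη0, fun n v hst hv hint y hy t r ht htr hr => ?_⟩
    have hyη : ‖y - extChartAt (𝓡∂ m) q q‖ ≤ η := by rw [← dist_eq_norm]; exact hy.1
    have hpη : ‖bdryProj y - extChartAt (𝓡∂ m) q q‖ ≤ η := (norm_bdryProj_sub_le h0 y).trans hyη
    have hpy := norm_bdryProj_sub_self hy.2
    rw [← dist_eq_norm] at hpy
    refine mul_growthProfile_le (P := chartEnergy β v q y) (P' := chartEnergy β v q (bdryProj y))
      (R := η) ha hβ1 hy.2 hC0.le hc₀ hc₀1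
      (fun s hs => h.chartEnergy_nonneg (hball hyη (by linarith)))
      (fun s s' _ hss hs' => h.chartEnergy_mono hint (halfBall_mono hss)
        (hball hyη (by linarith))) (fun s s' hs hss hs' hs'p => ?_)
      (fun _ => ⟨fun s s' hs hss hs' => ?_, fun s hs hsp => ?_, fun s hs hps => ?_⟩) ht htr hr
    · have hy0 : 0 < y 0 := by
        have : 0 < c₀ * y 0 := hs.trans_le (hss.trans hs'p)
        exact pos_of_mul_pos_right this hc₀.le
      refine (hint₁ n v hst hv hint y hy0 (hyη.trans hηη₁) s s' hs hss (hs'.trans hηη₁)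
        hs'p).trans ?_
      have := h.chartEnergy_nonneg (β := β) (v := v) (hball hyη (by linarith : η + s' ≤ κ))
      have : 0 < s' := hs.trans_le hss
      gcongr
      exact le_max_left _ _
    · refine (hbd₂ n v hst hv hint _ (bdryProj_zero y) (hpη.trans hηη₂) s s' hs hss
        (hs'.trans hηη₂)).trans ?_
      have := h.chartEnergy_nonneg (β := β) (v := v) (hball hpη (by linarith : η + s' ≤ κ))
      have : 0 < s' := hs.trans_le hss
      gcongr
      exact le_max_right _ _
    · refine h.chartEnergy_mono hint (fun z hz => ⟨?_, hz.2⟩) (hball hpη (by linarith))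
      have h1 : dist z y ≤ s := hz.1
      rw [mem_closedBall]
      rw [dist_comm] at hpy
      linarith [dist_triangle z y (bdryProj y)]
    · refine h.chartEnergy_mono hint (fun z hz => ⟨?_, hz.2⟩) (hball hyη (by linarith))
      have h1 : dist z (bdryProj y) ≤ s / 2 := hz.1
      rw [mem_closedBall]
      linarith [dist_triangle z (bdryProj y) y]
  · -- around an interior point, only the interior growth occurs
    have hpos := h.zero_or_pos.resolve_left h0
    have hx0 : 0 < extChartAt (𝓡∂ m) q q 0 := lt_of_le_of_ne
      (coord_nonneg_of_mem_target (mem_extChartAt_target q)) (Ne.symm h0)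
    set η := min (κ / 2) (min η₁ (c₀ * (extChartAt (𝓡∂ m) q q 0 / 2))) with hη
    have hη0 : 0 < η := lt_min (by positivity) (lt_min hη₁ (by positivity))
    have hηκ : η ≤ κ / 2 := min_le_left _ _
    have hηη₁ : η ≤ η₁ := (min_le_right _ _).trans (min_le_left _ _)
    have hηx : η ≤ c₀ * (extChartAt (𝓡∂ m) q q 0 / 2) := (min_le_right _ _).trans (min_le_right _ _)
    refine ⟨((2 * (1 + 1 / c₀)) ^ ((m : ℝ) - 2 + 1) + 3 * (2 * (1 + 1 / c₀)) ^ ((m : ℝ) - 2) * C₁ +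
      2 * C₁) ^ 2, by positivity, η, hη0, fun n v hst hv hint y hy t r ht htr hr => ?_⟩
    have hyη : ‖y - extChartAt (𝓡∂ m) q q‖ ≤ η := by rw [← dist_eq_norm]; exact hy.1
    have hy0 := hpos y (halfBall_mono (by linarith) hy)
    have hηy : η ≤ c₀ * y 0 := hηx.trans (by gcongr)
    exact mul_growthProfile_le (P := chartEnergy β v q y) (P' := 0)
      (R := η) ha hβ1 hy.2 hC₁.le hc₀ hc₀1
      (fun s hs => h.chartEnergy_nonneg (hball hyη (by linarith)))
      (fun s s' _ hss hs' => h.chartEnergy_mono hint (halfBall_mono hss)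
        (hball hyη (by linarith)))
      (fun s s' hs hss hs' hs'p => hint₁ n v hst hv hint y (by linarith) (hyη.trans hηη₁) s s' hs
        hss (hs'.trans hηη₁) hs'p)
      (fun hlt => absurd hlt (not_lt.2 hηy)) ht htr hr

lemma setIntegral_energyDensity {v : M → EuclideanSpace ℝ (Fin n)} {S : Set M}
    (hS : MeasurableSet S) (hSq : S ⊆ (extChartAt (𝓡∂ m) q).source) :
    ∫ x in S, energyDensity m β v x ∂(riemVolume m M) =
      ∫ y in (extChartAt (𝓡∂ m) q).target ∩ (extChartAt (𝓡∂ m) q).symm ⁻¹' S,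
        chartEnergyDensity β v q y := by
  rw [setIntegral_riemVolume q hS hSq]
  exact setIntegral_congr_fun (measurableSet_target_inter q hS) fun y hy =>
    volDensity_mul_energyDensity hy.1

variable (m) in
/-- The monotonicity inequality of the normalised energy with constants `C` and `R`, for balls
centred in `S`, with positivity of the weighted volumes, integrability of the energy density and
nonnegativity of its integral. The constants do not depend on the map or on its target. -/
def IsMonotoneOn (β : ℝ) (S : Set M) (C R : ℝ) : Prop :=
  ∀ (n : ℕ) (v : M → EuclideanSpace ℝ (Fin n)), IsInnerStationaryFree m β v →
    (∃ Dv, HasWeakDifferential (m := m) v Dv) →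
    (∀ K : Set M, IsCompact K → IntegrableOn (energyDensity m β v) K (riemVolume m M)) →
    ∀ p ∈ S, ∀ t r : ℝ, 0 < t → t ≤ r → r ≤ R →
      0 < omega m β p t ∧ 0 < omega m β p r ∧
      IntegrableOn (energyDensity m β v) (eball p (ENNReal.ofReal r)) (riemVolume m M) ∧
      0 ≤ ∫ x in eball p (ENNReal.ofReal r), energyDensity m β v x ∂(riemVolume m M) ∧
      t ^ 2 / omega m β p t *
          ∫ x in eball p (ENNReal.ofReal t), energyDensity m β v x ∂(riemVolume m M) ≤
        C * r ^ 2 / omega m β p r *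
          ∫ x in eball p (ENNReal.ofReal r), energyDensity m β v x ∂(riemVolume m M)

lemma IsMonotoneOn.mono {S S' : Set M} {C C' R R' : ℝ} (h : IsMonotoneOn m β S C R)
    (hS : S' ⊆ S) (hC : C ≤ C') (hR : R' ≤ R) : IsMonotoneOn m β S' C' R' := by
  intro n v hst hv hint p hp t r ht htr hr
  obtain ⟨h1, h2, h3, h4, h5⟩ := h n v hst hv hint p (hS hp) t r ht htr (hr.trans hR)
  refine ⟨h1, h2, h3, h4, h5.trans ?_⟩
  gcongr

/-- Monotonicity near a point. Riemannian balls are compared with half balls of a good chart, and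
the doubling property of the growth profile absorbs the change of radii. -/
lemma exists_isMonotoneOn_nhds
    (hbdry : ∀ p : M, (connectedComponent p ∩ (𝓡∂ m).boundary M).Nonempty)
    (hm : 3 ≤ m) (hβ : β ∈ Ioo (-1 : ℝ) 1) (q : M) :
    ∃ U ∈ 𝓝 q, ∃ C > 0, ∃ R > 0, IsMonotoneOn m β U C R := by
  obtain ⟨κ, μ, ρ, h⟩ := exists_isGoodChart (m := m) q
  have hμ1 := h.one_le
  have hμ : 0 < μ := zero_lt_one.trans_le hμ1
  have hm' : (3 : ℝ) ≤ m := by exact_mod_cast hm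
  have hβ1 : |β| ≤ 1 := abs_le.2 ⟨hβ.1.le, hβ.2.le⟩
  have ha : (0 : ℝ) ≤ m - 2 := by linarith
  obtain ⟨η₁, hη₁, hcomp⟩ := h.exists_eball_comparison
  obtain ⟨A, hA, η₂, hη₂, hω⟩ := h.exists_omega_bounds (β := β) hbdry hm hβ
  obtain ⟨B, hB, η₃, hη₃, hgr⟩ := h.exists_chartEnergy_growth (β := β) hbdry hm hβ
  set η := min η₁ (min η₂ η₃) with hη
  have hη0 : 0 < η := lt_min hη₁ (lt_min hη₂ hη₃)
  have hηη₁ : η ≤ η₁ := min_le_left _ _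
  have hηη₂ : η ≤ η₂ := (min_le_right _ _).trans (min_le_left _ _)
  have hηη₃ : η ≤ η₃ := (min_le_right _ _).trans (min_le_right _ _)
  set D₁ : ℝ := (2 * μ) ^ ((m : ℝ) - 2 + 1) * μ ^ ((m : ℝ) - 2 + 1) * B with hD₁
  set D₂ : ℝ := (2 * μ ^ 2) ^ ((m : ℝ) - 2 + 1) with hD₂
  have hD₁0 : 0 < D₁ := by positivity
  have hD₂0 : 0 < D₂ := by positivity
  refine ⟨(extChartAt (𝓡∂ m) q).source ∩ extChartAt (𝓡∂ m) q ⁻¹' ball (extChartAt (𝓡∂ m) q q) η,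
    ?_, A ^ 2 * (D₁ + D₂), by positivity, η, hη0, fun n v hst hv hint p hp t r ht htr hr => ?_⟩
  · exact ((continuousOn_extChartAt q).isOpen_inter_preimage (isOpen_extChartAt_source q)
      isOpen_ball).mem_nhds ⟨mem_extChartAt_source q, mem_ball_self hη0⟩
  obtain ⟨hpq, hpη⟩ := hp
  have hpT := (extChartAt (𝓡∂ m) q).map_source hpq
  obtain ⟨y, hyT, rfl⟩ : ∃ y ∈ (extChartAt (𝓡∂ m) q).target, (extChartAt (𝓡∂ m) q).symm y = p :=
    ⟨_, hpT, (extChartAt (𝓡∂ m) q).left_inv hpq⟩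
  rw [mem_preimage, (extChartAt (𝓡∂ m) q).right_inv hyT] at hpη
  have hy : y ∈ halfBall (extChartAt (𝓡∂ m) q q) η :=
    ⟨ball_subset_closedBall hpη, coord_nonneg_of_mem_target hyT⟩
  have hy0 : 0 ≤ y 0 := hy.2
  have hr0 : 0 < r := ht.trans_le htr
  have hωt := hω y (halfBall_mono hηη₂ hy) t ht (htr.trans (hr.trans hηη₂))
  have hωr := hω y (halfBall_mono hηη₂ hy) r hr0 (hr.trans hηη₂)
  obtain ⟨hDr, -, hsrcr, hupr, hlowr⟩ := hcomp y (halfBall_mono hηη₁ hy) r hr0 (hr.trans hηη₁)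
  obtain ⟨hDt, -, hsrct, hupt, -⟩ :=
    hcomp y (halfBall_mono hηη₁ hy) t ht (htr.trans (hr.trans hηη₁))
  set p := (extChartAt (𝓡∂ m) q).symm y with hp
  have hΘt : 0 < growthProfile (m - 2) β (y 0) t := growthProfile_pos hy0 ht
  have hΘr : 0 < growthProfile (m - 2) β (y 0) r := growthProfile_pos hy0 hr0
  have hωpos : ∀ {s : ℝ}, 0 < s ^ 2 * growthProfile (m - 2) β (y 0) s →
      s ^ 2 * growthProfile (m - 2) β (y 0) s ≤ A * omega m β p s → 0 < omega m β p s :=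
    fun h1 h2 => pos_of_mul_pos_right (h1.trans_le h2) hA.le
  have hωt0 : 0 < omega m β p t := hωpos (by positivity) hωt.2
  have hωr0 : 0 < omega m β p r := hωpos (by positivity) hωr.2
  have hcr : IntegrableOn (chartEnergyDensity β v q) (halfBall y (μ * r)) :=
    integrableOn_chartEnergyDensity (isCompact_halfBall _ _) (hDr.trans h.subset_target) hint
  have hEI : IntegrableOn (energyDensity m β v) (eball p (ENNReal.ofReal r)) (riemVolume m M) := by
    refine (hint _ ((isCompact_halfBall y (μ * r)).image_of_continuousOn
      ((continuousOn_extChartAt_symm q).mono (hDr.trans h.subset_target)))).mono_set fun x hx => ?_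
    have hxq := hsrcr hx
    refine ⟨extChartAt (𝓡∂ m) q x, hupr ⟨(extChartAt (𝓡∂ m) q).map_source hxq, ?_⟩,
      (extChartAt (𝓡∂ m) q).left_inv hxq⟩
    rw [mem_preimage, (extChartAt (𝓡∂ m) q).left_inv hxq]
    exact hx
  have hEt := setIntegral_energyDensity (β := β) (v := v)
    (isOpen_eball (x := p) (ε := ENNReal.ofReal t)).measurableSet hsrct
  have hEr := setIntegral_energyDensity (β := β) (v := v)
    (isOpen_eball (x := p) (ε := ENNReal.ofReal r)).measurableSet hsrcr
  have hmr : MeasurableSet ((extChartAt (𝓡∂ m) q).target ∩ (extChartAt (𝓡∂ m) q).symm ⁻¹'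
      eball p (ENNReal.ofReal r)) := measurableSet_target_inter q isOpen_eball.measurableSet
  set Et := ∫ x in eball p (ENNReal.ofReal t), energyDensity m β v x ∂(riemVolume m M)
  set Er := ∫ x in eball p (ENNReal.ofReal r), energyDensity m β v x ∂(riemVolume m M)
  have hEr0 : 0 ≤ Er := by
    rw [hEr]
    exact setIntegral_nonneg hmr fun z hz => chartEnergyDensity_nonneg hz.1
  have hEtr : Et ≤ Er := by
    rw [hEt, hEr]
    refine setIntegral_mono_set (hcr.mono_set hupr) ?_ (Filter.Eventually.of_forall
      (inter_subset_inter_right _ (preimage_mono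
        (eball_subset_eball (ENNReal.ofReal_le_ofReal htr)))))
    filter_upwards [ae_restrict_mem hmr] with z hz
    exact chartEnergyDensity_nonneg hz.1
  have hkey : Et * growthProfile (m - 2) β (y 0) r ≤
      (D₁ + D₂) * growthProfile (m - 2) β (y 0) t * Er := by
    -- for comparable radii the energy is just monotone; otherwise there are half balls in between
    rcases le_total r (2 * μ ^ 2 * t) with hrt | hrt
    · have h1 : growthProfile (m - 2) β (y 0) r ≤ D₂ * growthProfile (m - 2) β (y 0) t :=
        growthProfile_le ha hβ1 hy0 ht htr (by linarith [one_le_pow₀ hμ1 (n := 2)]) hrt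
      calc Et * growthProfile (m - 2) β (y 0) r
          ≤ Er * (D₂ * growthProfile (m - 2) β (y 0) t) := by gcongr
        _ = D₂ * growthProfile (m - 2) β (y 0) t * Er := by ring
        _ ≤ _ := by
          gcongr
          linarith
    · have ht' : 0 < μ * t := by positivity
      have hr' : 0 < r / (2 * μ) := by positivity
      have htr' : μ * t ≤ r / (2 * μ) := by
        rw [le_div_iff₀ (by positivity)]
        linarith
      have hrr : r / (2 * μ) ≤ r := div_le_self hr0.le (by linarith)
      have h1 : Et ≤ chartEnergy β v q y (μ * t) := by
        rw [hEt]
        refine setIntegral_mono_set (integrableOn_chartEnergyDensity (isCompact_halfBall _ _)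
          (hDt.trans h.subset_target) hint) ?_ (Filter.Eventually.of_forall hupt)
        filter_upwards [ae_restrict_mem (isCompact_halfBall y (μ * t)).measurableSet] with z hz
        exact chartEnergyDensity_nonneg (h.subset_target (hDt hz))
      have h2 : chartEnergy β v q y (r / (2 * μ)) ≤ Er := by
        rw [hEr]
        refine setIntegral_mono_set (hcr.mono_set hupr) ?_ (Filter.Eventually.of_forall hlowr)
        filter_upwards [ae_restrict_mem hmr] with z hz
        exact chartEnergyDensity_nonneg hz.1
      have h3 := hgr n v hst hv hint y (halfBall_mono hηη₃ hy) (μ * t) (r / (2 * μ)) ht' htr'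
        (hrr.trans (hr.trans hηη₃))
      have e : r = 2 * μ * (r / (2 * μ)) := by field_simp
      have h4 : growthProfile (m - 2) β (y 0) r ≤
          (2 * μ) ^ ((m : ℝ) - 2 + 1) * growthProfile (m - 2) β (y 0) (r / (2 * μ)) :=
        growthProfile_le ha hβ1 hy0 hr' hrr (by linarith) e.le
      have h5 : growthProfile (m - 2) β (y 0) (μ * t) ≤
          μ ^ ((m : ℝ) - 2 + 1) * growthProfile (m - 2) β (y 0) t :=
        growthProfile_le ha hβ1 hy0 ht (le_mul_of_one_le_left ht.le hμ1) hμ1 le_rfl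
      have hP0 : 0 ≤ chartEnergy β v q y (μ * t) := h.chartEnergy_nonneg hDt
      have hP1 : 0 ≤ chartEnergy β v q y (r / (2 * μ)) :=
        h.chartEnergy_nonneg ((hlowr.trans hupr).trans hDr)
      calc Et * growthProfile (m - 2) β (y 0) r
          ≤ chartEnergy β v q y (μ * t) *
              ((2 * μ) ^ ((m : ℝ) - 2 + 1) * growthProfile (m - 2) β (y 0) (r / (2 * μ))) := by
            gcongr
        _ = (2 * μ) ^ ((m : ℝ) - 2 + 1) *
              (chartEnergy β v q y (μ * t) * growthProfile (m - 2) β (y 0) (r / (2 * μ))) := by ring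
        _ ≤ (2 * μ) ^ ((m : ℝ) - 2 + 1) * (B * growthProfile (m - 2) β (y 0) (μ * t) *
              chartEnergy β v q y (r / (2 * μ))) := by gcongr
        _ ≤ (2 * μ) ^ ((m : ℝ) - 2 + 1) * (B * (μ ^ ((m : ℝ) - 2 + 1) *
              growthProfile (m - 2) β (y 0) t) * Er) := by gcongr
        _ = D₁ * growthProfile (m - 2) β (y 0) t * Er := by rw [hD₁]; ring
        _ ≤ _ := by
          gcongr
          linarith
  have hEt0 : 0 ≤ Et := by
    rw [hEt]
    exact setIntegral_nonneg (measurableSet_target_inter q isOpen_eball.measurableSet) fun z hz =>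
      chartEnergyDensity_nonneg hz.1
  refine ⟨hωt0, hωr0, hEI, hEr0, ?_⟩
  rw [div_mul_eq_mul_div, div_mul_eq_mul_div, div_le_div_iff₀ hωt0 hωr0]
  calc t ^ 2 * Et * omega m β p r
      ≤ t ^ 2 * Et * (A * (r ^ 2 * growthProfile (m - 2) β (y 0) r)) := by
        gcongr
        exact hωr.1
    _ = t ^ 2 * A * r ^ 2 * (Et * growthProfile (m - 2) β (y 0) r) := by ring
    _ ≤ t ^ 2 * A * r ^ 2 * ((D₁ + D₂) * growthProfile (m - 2) β (y 0) t * Er) := by gcongr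
    _ = A * r ^ 2 * (D₁ + D₂) * Er * (t ^ 2 * growthProfile (m - 2) β (y 0) t) := by ring
    _ ≤ A * r ^ 2 * (D₁ + D₂) * Er * (A * omega m β p t) :=
        mul_le_mul_of_nonneg_left hωt.2 (by positivity)
    _ = _ := by ring

lemma exists_isMonotoneOn
    (hbdry : ∀ p : M, (connectedComponent p ∩ (𝓡∂ m).boundary M).Nonempty)
    (hm : 3 ≤ m) (hβ : β ∈ Ioo (-1 : ℝ) 1) {K : Set M} (hK : IsCompact K) :
    ∃ C > 0, ∃ R > 0, IsMonotoneOn m β K C R := by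
  refine hK.induction_on (p := fun S => ∃ C > 0, ∃ R > 0, IsMonotoneOn m β S C R) ?_ ?_ ?_ ?_
  · exact ⟨1, one_pos, 1, one_pos, fun n v _ _ _ p hp => absurd hp (notMem_empty p)⟩
  · rintro S S' hSS ⟨C, hC, R, hR, h⟩
    exact ⟨C, hC, R, hR, h.mono hSS le_rfl le_rfl⟩
  · rintro S S' ⟨C, hC, R, hR, h⟩ ⟨C', hC', R', hR', h'⟩
    refine ⟨max C C', lt_max_of_lt_left hC, min R R', lt_min hR hR', ?_⟩
    intro n v hst hv hint p hp
    rcases hp with hp | hp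
    · exact h.mono subset_rfl (le_max_left _ _) (min_le_left _ _) n v hst hv hint p hp
    · exact h'.mono subset_rfl (le_max_right _ _) (min_le_right _ _) n v hst hv hint p hp
  · intro q _
    obtain ⟨U, hU, h⟩ := exists_isMonotoneOn_nhds hbdry hm hβ q
    exact ⟨U, mem_nhdsWithin_of_mem_nhds hU, h⟩

end LocalMonotonicity

end FreeBoundary

end

theorem mainTheorem9 {m : ℕ} [NeZero m] (hm : 3 ≤ m)
    {M : Type*} [EMetricSpace M] [SecondCountableTopology M] [MeasurableSpace M] [BorelSpace M]
    [ChartedSpace (EuclideanHalfSpace m) M] [IsManifold (𝓡∂ m) ∞ M]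
    [RiemannianBundle (fun x : M => TangentSpace (𝓡∂ m) x)]
    [IsContMDiffRiemannianBundle (𝓡∂ m) ∞ (EuclideanSpace ℝ (Fin m))
      (fun x : M => TangentSpace (𝓡∂ m) x)]
    [IsRiemannianManifold (𝓡∂ m) M]
    (hbdry : ∀ p : M, (connectedComponent p ∩ (𝓡∂ m).boundary M).Nonempty)
    {β : ℝ} (hβ : β ∈ Ioo (-1 : ℝ) 1)
    {K : Set M} (hK : IsCompact K) :
    ∃ C > (0 : ℝ), ∃ R > (0 : ℝ),
      ∀ (n k : ℕ) (N : Set (EuclideanSpace ℝ (Fin n))), IsCompact N →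
        FreeBoundary.IsSmoothSubmanifold k N →
      ∀ v : M → EuclideanSpace ℝ (Fin n), FreeBoundary.IsWeaklyStationaryHarmonicFree m β N v →
      ∀ p ∈ K, ∀ t r : ℝ, 0 < t → t ≤ r → r ≤ R →
        0 < FreeBoundary.omega m β p t ∧ 0 < FreeBoundary.omega m β p r ∧
        IntegrableOn (FreeBoundary.energyDensity m β v) (eball p (ENNReal.ofReal r))
          (FreeBoundary.riemVolume m M) ∧
        t ^ 2 / FreeBoundary.omega m β p t *
            ∫ x in eball p (ENNReal.ofReal t), FreeBoundary.energyDensity m β v x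
              ∂(FreeBoundary.riemVolume m M) ≤
          C * r ^ 2 / FreeBoundary.omega m β p r *
            ∫ x in eball p (ENNReal.ofReal r), FreeBoundary.energyDensity m β v x
              ∂(FreeBoundary.riemVolume m M) := by
  obtain ⟨C, hC, R, hR, h⟩ := FreeBoundary.exists_isMonotoneOn hbdry hm hβ hK
  refine ⟨C, hC, R, hR, fun n _ N _ _ v hv p hp t r ht htr hr => ?_⟩
  obtain ⟨h1, h2, h3, -, h4⟩ := h n v hv.innerStationary hv.sobolev.weaklyDifferentiable
    hv.sobolev.integrableOn_energyDensity p hp t r ht htr hr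
  exact ⟨h1, h2, h3, h4⟩
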